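/- Let $A$ be an associative unital ring that is left coherent, i.e. every finitely generated submodule of a finitely presented left $A$-module is finitely presented; then the finitely presented left $A$-modules form an abelian category $A\text{-mod}_{fp}$. A left $A$-module $J$ is called fp-injective if $\operatorname{Hom}_A(-,J)$ takes short exact sequences of finitely presented left $A$-modules to short exact sequences. Let $\operatorname{Hot}(A\text{-mod})$ be the homotopy category of unbounded complexes of left $A$-modules. A complex is called coacyclic if it belongs to the smallest strictly full triangulated subcategory of $\operatorname{Hot}(A\text{-mod})$ that contains the total complexes of all short exact sequences of complexes of left $A$-modules and is closed under infinite direct sums. The coderived category $D^{co}(A\text{-mod})$ is the triangulated quotient category of $\operatorname{Hot}(A\text{-mod})$ by the coacyclic complexes. An object $X$ of a triangulated category with infinite direct sums is compact if $\operatorname{Hom}(X,-)$ preserves infinite direct sums; such a category is compactly generated if it has a set of compact objects $G$ such that any object $X$ with $\operatorname{Hom}(G,X[n])=0$ for all $G$ in the set and all $n\in\mathbb Z$ vanishes. (a) The category $D^{co}(A\text{-mod})$ has infinite direct sums. The functor assigning to a bounded complex of finitely presented left $A$-modules the same complex viewed as an object of $D^{co}(A\text{-mod})$ induces a fully faithful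 functor $D^b(A\text{-mod}_{fp})\to D^{co}(A\text{-mod})$ from the bounded derived category of $A\text{-mod}_{fp}$, whose essential image is the full subcategory of all objects isomorphic to bounded complexes of finitely presented left $A$-modules. All objects of this full subcategory $D^b(A\text{-mod}_{fp})\subset D^{co}(A\text{-mod})$ are compact in $D^{co}(A\text{-mod})$. (b) Assume that every fp-injective left $A$-module has finite injective dimension. Then the triangulated category $D^{co}(A\text{-mod})$ is compactly generated, and an object of it is compact if and only if it belongs to the full subcategory $D^b(A\text{-mod}_{fp})$, i.e. is isomorphic to a bounded complex of finitely presented left $A$-modules. (c) The assumption of (b) holds, in particular, if every left ideal of $A$ is countably generated. -/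

import Mathlib

universe w v u

open CategoryTheory CategoryTheory.Limits CategoryTheory.Pretriangulated Opposite
open scoped ZeroObject

/-- A ring `A` is left coherent if every finitely generated submodule of a finitely presented
left `A`-module is finitely presented. -/
class IsLeftCoherentRing (A : Type u) [Ring A] : Prop where
  finitePresentation_of_fg (M : Type u) [AddCommGroup M] [Module A M]
    [Module.FinitePresentation A M] (N : Submodule A M) (hN : N.FG) :
    Module.FinitePresentation A N

/-- The full subcategory of finitely presented left `A`-modules, as a property of modules. -/
def isFPModule (A : Type u) [Ring A] : ObjectProperty (ModuleCat.{u} A) :=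
  fun M => Module.FinitePresentation A M

/-- The category of finitely presented left `A`-modules. -/
abbrev FPModuleCat (A : Type u) [Ring A] : Type (u + 1) := (isFPModule A).FullSubcategory

/-- A left `A`-module `J` is fp-injective if `Hom_A(-, J)` takes short exact sequences of finitely
presented modules to short exact sequences. Since `Hom_A(-, J)` is left exact, this means that
for a short exact sequence `0 → X₁ → X₂ → X₃ → 0` of finitely presented modules, every morphism
`X₁ → J` extends to `X₂`. -/
def IsFPInjective (A : Type u) [Ring A] (J : ModuleCat.{u} A) : Prop :=
  ∀ (S : ShortComplex (ModuleCat.{u} A)), S.ShortExact →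
    isFPModule A S.X₁ → isFPModule A S.X₂ → isFPModule A S.X₃ →
      ∀ g : S.X₁ ⟶ J, ∃ h : S.X₂ ⟶ J, S.f ≫ h = g

/-- Every fp-injective left `A`-module has finite injective dimension. -/
def FPInjectivesHaveFiniteInjectiveDimension (A : Type u) [Ring A] : Prop :=
  ∀ J : ModuleCat.{u} A, IsFPInjective A J → ∃ n : ℕ, HasInjectiveDimensionLE J n

section FPAbelian

variable (A : Type u) [Ring A]

instance : (isFPModule A).IsClosedUnderIsomorphisms where
  of_iso {X Y} e (_ : Module.FinitePresentation A X) :=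
    (Module.FinitePresentation.of_equiv e.toLinearEquiv : Module.FinitePresentation A Y)

instance : (isFPModule A).ContainsZero where
  exists_zero := ⟨ModuleCat.of A PUnit, ModuleCat.isZero_of_subsingleton _, by
    change Module.FinitePresentation A PUnit.{u + 1}
    infer_instance⟩

instance : (isFPModule A).IsClosedUnderCokernels where
  cokernels_le := by
    rintro _ ⟨f, k, hk, hX, hY⟩
    rename_i X Y
    have hX' : Module.FinitePresentation A X := hX
    have hY' : Module.FinitePresentation A Y := hY
    refine (isFPModule A).prop_of_iso (show ModuleCat.of A (Y ⧸ LinearMap.range f.hom) ≅ k.pt from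
      (ModuleCat.cokernelIsoRangeQuotient f).symm ≪≫
        IsColimit.coconePointUniqueUpToIso (colimit.isColimit (parallelPair f 0)) hk) ?_
    change Module.FinitePresentation A (Y ⧸ LinearMap.range f.hom)
    refine Module.finitePresentation_of_surjective (LinearMap.range f.hom).mkQ
      (Submodule.mkQ_surjective _) ?_
    rw [Submodule.ker_mkQ, LinearMap.range_eq_map]
    exact Module.Finite.fg_top.map _

instance [IsLeftCoherentRing A] : (isFPModule A).IsClosedUnderKernels where
  kernels_le := by
    rintro _ ⟨f, k, hk, hX, hY⟩
    rename_i X Y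
    have hX' : Module.FinitePresentation A X := hX
    have hY' : Module.FinitePresentation A Y := hY
    refine (isFPModule A).prop_of_iso (show ModuleCat.of A (LinearMap.ker f.hom) ≅ k.pt from
      (ModuleCat.kernelIsoKer f).symm ≪≫
        IsLimit.conePointUniqueUpToIso (limit.isLimit (parallelPair f 0)) hk) ?_
    change Module.FinitePresentation A (LinearMap.ker f.hom)
    have hr : (LinearMap.range f.hom).FG := by
      rw [LinearMap.range_eq_map]
      exact Module.Finite.fg_top.map _
    have := IsLeftCoherentRing.finitePresentation_of_fg Y _ hr
    have hk' := Module.FinitePresentation.fg_ker f.hom.rangeRestrict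
      (LinearMap.surjective_rangeRestrict _)
    rw [LinearMap.ker_rangeRestrict] at hk'
    exact IsLeftCoherentRing.finitePresentation_of_fg X _ hk'

instance : (isFPModule A).IsClosedUnderFiniteProducts := by
  have : (isFPModule A).IsClosedUnderBinaryProducts := by
    refine ⟨?_⟩
    rintro X ⟨p⟩
    let M := p.diag.obj ⟨WalkingPair.left⟩
    let N := p.diag.obj ⟨WalkingPair.right⟩
    have hM : Module.FinitePresentation A M := p.prop_diag_obj _
    have hN : Module.FinitePresentation A N := p.prop_diag_obj _
    refine (isFPModule A).prop_of_iso (show ModuleCat.of A (M × N) ≅ X from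
      IsLimit.conePointsIsoOfNatIso (ModuleCat.binaryProductLimitCone M N).isLimit p.isLimit
        (diagramIsoPair p.diag).symm) ?_
    change Module.FinitePresentation A (M × N)
    infer_instance
  exact ObjectProperty.IsClosedUnderFiniteProducts.mk'

end FPAbelian

section Coderived

variable (A : Type u) [Ring A]

/-- The homotopy category `Hot(A-mod)` of unbounded complexes of left `A`-modules. -/
abbrev HotMod : Type (u + 1) := HomotopyCategory (ModuleCat.{u} A) (ComplexShape.up ℤ)

/-- The total complex of a short complex `X₁ → X₂ → X₃` of complexes (viewed as a bicomplex with
three rows), realized as the cone of the morphism `cone(X₁ → X₂) ⟶ X₃`. Its term in degree `n` is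
`X₁ⁿ⁺² ⊕ X₂ⁿ⁺¹ ⊕ X₃ⁿ`. -/
noncomputable def totalization {A : Type u} [Ring A]
    (S : ShortComplex (CochainComplex (ModuleCat.{u} A) ℤ)) :
    CochainComplex (ModuleCat.{u} A) ℤ :=
  CochainComplex.mappingCone (CochainComplex.mappingCone.descShortComplex S)

/-- The coacyclic complexes: the smallest strictly full triangulated subcategory of `Hot(A-mod)`
that contains the total complexes of all short exact sequences of complexes and is closed under
infinite direct sums. -/
inductive coacyclic : ObjectProperty (HotMod A)
  | totalization (S : ShortComplex (CochainComplex (ModuleCat.{u} A) ℤ)) (hS : S.ShortExact) :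
      coacyclic ((HomotopyCategory.quotient _ _).obj (totalization S))
  | iso {X Y : HotMod A} (e : X ≅ Y) (hX : coacyclic X) : coacyclic Y
  | shift {X : HotMod A} (n : ℤ) (hX : coacyclic X) : coacyclic (X⟦n⟧)
  | ext (T : Triangle (HotMod A)) (hT : T ∈ distTriang (HotMod A))
      (h₁ : coacyclic T.obj₁) (h₃ : coacyclic T.obj₃) : coacyclic T.obj₂
  | coproduct {ι : Type u} (X : ι → HotMod A) (c : Cofan X) (hc : IsColimit c)
      (hX : ∀ i, coacyclic (X i)) : coacyclic c.pt

instance : (coacyclic A).IsClosedUnderIsomorphisms where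
  of_iso e hX := coacyclic.iso e hX

instance : (coacyclic A).ContainsZero where
  exists_zero := by
    refine ⟨0, isZero_zero _, ?_⟩
    refine coacyclic.coproduct (ι := PEmpty.{u + 1}) (fun i => i.elim)
      (Cofan.mk 0 (fun i => i.elim)) ?_ (fun i => i.elim)
    exact Cofan.IsColimit.mk _ (fun _ => 0) (fun _ i => i.elim)
      (fun _ _ _ => (isZero_zero _).eq_of_src _ _)

instance : (coacyclic A).IsStableUnderShift ℤ where
  isStableUnderShiftBy n := ⟨fun _ hX => coacyclic.shift n hX⟩

instance : (coacyclic A).IsTriangulatedClosed₂ :=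
  .mk' (fun T hT h₁ h₃ => coacyclic.ext T hT h₁ h₃)

instance : (coacyclic A).IsTriangulated where

/-- The coderived category `D^co(A-mod)`: the Verdier quotient of `Hot(A-mod)` by the coacyclic
complexes, i.e. its localization at the morphisms whose cone is coacyclic. -/
abbrev CoderivedCategory : Type (u + 1) := (coacyclic A).trW.Localization

/-- The canonical functor from complexes of `A`-modules to the coderived category. -/
noncomputable abbrev CoderivedCategory.Q :
    CochainComplex (ModuleCat.{u} A) ℤ ⥤ CoderivedCategory A :=
  HomotopyCategory.quotient _ _ ⋙ (coacyclic A).trW.Q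

end Coderived

section Compact

variable {T : Type u} [Category.{v} T] [Preadditive T]

/-- An object `X` is compact if `Hom(X, -)` preserves coproducts indexed by types of
size `w`. -/
def IsCompactObj (X : T) : Prop :=
  ∀ ι : Type w, PreservesColimitsOfShape (Discrete ι) (preadditiveCoyoneda.obj (op X))

/-- A triangulated category is compactly generated if it has coproducts and there is a set of
compact objects such that every object `X` with `Hom(G, X[n]) = 0` for all `G` in this set and
all `n` vanishes. -/
def IsCompactlyGeneratedTriangulated (T : Type u) [Category.{v} T] [Preadditive T]
    [HasZeroObject T] [HasShift T ℤ] [∀ n : ℤ, (shiftFunctor T n).Additive]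
    [Pretriangulated T] : Prop :=
  HasCoproducts.{w} T ∧
    ∃ (ι : Type w) (G : ι → T), (∀ i, IsCompactObj.{w} (G i)) ∧
      ∀ X : T, (∀ (i : ι) (n : ℤ) (f : G i ⟶ X⟦n⟧), f = 0) → IsZero X

end Compact

section BoundedFP

variable (A : Type u) [Ring A]

/-- The category of bounded complexes of finitely presented left `A`-modules. -/
abbrev BoundedFPComplex : Type (u + 1) :=
  ObjectProperty.FullSubcategory (fun K : CochainComplex (FPModuleCat A) ℤ =>
    ∃ a b : ℤ, K.IsStrictlyGE a ∧ K.IsStrictlyLE b)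

/-- The functor sending a bounded complex of finitely presented modules to the same complex,
viewed as an object of the coderived category of `A`-modules. -/
noncomputable def BoundedFPComplex.toCoderived : BoundedFPComplex A ⥤ CoderivedCategory A :=
  ObjectProperty.ι _ ⋙ (isFPModule A).ι.mapHomologicalComplex (ComplexShape.up ℤ) ⋙
    CoderivedCategory.Q A

/-- The (strictly) full subcategory of the coderived category consisting of the objects
represented by bounded complexes of finitely presented modules. -/
def boundedFP : ObjectProperty (CoderivedCategory A) :=
  (BoundedFPComplex.toCoderived A).essImage

noncomputable instance [IsLeftCoherentRing A] : HasDerivedCategory.{u + 1} (FPModuleCat A) :=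
  HasDerivedCategory.standard _

/-- The functor sending a bounded complex of finitely presented modules to its class in the
bounded derived category `D^b(A-mod_fp)` of the abelian category of finitely presented modules. -/
noncomputable def BoundedFPComplex.toDerived [IsLeftCoherentRing A] :
    BoundedFPComplex A ⥤ DerivedCategory.Bounded (FPModuleCat A) :=
  ObjectProperty.lift _ (ObjectProperty.ι _ ⋙ DerivedCategory.Q) (by
    rintro ⟨K, a, b, ha, hb⟩
    exact ⟨⟨a, ⟨K, Iso.refl _, ha⟩⟩, ⟨b, ⟨K, Iso.refl _, hb⟩⟩⟩)

end BoundedFP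

/-! Morphisms of the coderived category become computable in two situations.

Out of a bounded complex `F` of finitely presented modules: every morphism from `F` to a coacyclic
complex is killed by some `F' ⟶ F` whose cone is coacyclic, bounded and finitely presented
(`coacyclic_le_annihilatesBFP`). The targets with this property are closed under cones, shifts and
direct sums, so only the total complex of a short exact sequence matters. There `F` is covered by a
bounded complex `P` with projective terms; coherence keeps the kernel `K` finitely presented, and on
`cone(K ⟶ P)` the component of the morphism in the third term lifts to the middle term, which makes
it null-homotopic. Hence fractions out of `F` only need denominators between bounded finitely
presented complexes. Compactness follows, because `F` is finitely generated in finitely many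
degrees. A bounded complex is coacyclic exactly when it is acyclic
(`coacyclic_of_acyclic_of_bounded`), so the same fractions compute the bounded derived category;
this is (a).

Into a complex of injective modules: it is right orthogonal to the coacyclic complexes
(`eq_zero_of_coacyclic`), so morphisms are homotopy classes. Under the hypothesis of (b) these
complexes represent all objects. Any complex embeds, with contractible cokernel, into one such that
each term of the embedding factors through an injective module; the colimit of the iterates has
fp-injective terms, and these have a common bound on their injective dimension. If a complex of
injectives receives no nonzero morphism from stalks of finitely presented modules, its cycles are
fp-injective, then injective by dimension shifting, and the complex is contractible. So the stalks
generate.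

By Neeman's argument a compact object is a retract of a bounded finitely presented complex
(`exists_retract_of_isCompactObj`). Such complexes are closed under retracts: if `X ⊞ Y` is one, so
is `X ⊞ X⟦2k+1⟧`, and for large `k` the homologies of the summands are far apart, so that a
truncation isolates one of them.

For (c), embed an fp-injective `J` in an injective `E`. A map from an ideal to `E / J` lifts to `E`
along a chain of finitely generated ideals, each lift extending the previous one, so `E / J` is
injective by Baer's criterion. -/

/-! ### Compactness as finite support of morphisms into coproducts -/

section Compact

open scoped Classical in
/-- A morphism to a coproduct is finitely supported if it is the sum of finitely many of its
components. -/
def IsFinitelySupported {T : Type u} [Category.{v} T] [Preadditive T] {ι : Type w} {Y : ι → T}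
    [HasCoproduct Y] {X : T} (f : X ⟶ ∐ Y) : Prop :=
  ∃ J : Finset ι, f = ∑ j ∈ J, f ≫ Sigma.π Y j ≫ Sigma.ι Y j

variable {T : Type u} [Category.{v} T] [Preadditive T] {ι : Type w} {Y : ι → T} [HasCoproduct Y]

namespace IsFinitelySupported

open scoped Classical in
lemma comp_ι_π_of_notMem {X : T} {f : X ⟶ ∐ Y} {J : Finset ι}
    (hf : f = ∑ j ∈ J, f ≫ Sigma.π Y j ≫ Sigma.ι Y j) {i : ι} (hi : i ∉ J) :
    f ≫ Sigma.π Y i = 0 := by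
  rw [hf, Preadditive.sum_comp]
  refine Finset.sum_eq_zero fun j hj => ?_
  have : j ≠ i := fun h => hi (h ▸ hj)
  simp [Sigma.ι_π_of_ne _ this]

open scoped Classical in
lemma eq_sum_of_subset {X : T} {f : X ⟶ ∐ Y} {J J' : Finset ι}
    (hf : f = ∑ j ∈ J, f ≫ Sigma.π Y j ≫ Sigma.ι Y j) (hJ : J ⊆ J') :
    f = ∑ j ∈ J', f ≫ Sigma.π Y j ≫ Sigma.ι Y j := by
  conv_lhs => rw [hf]
  refine Finset.sum_subset hJ fun j _ hj => ?_
  rw [← Category.assoc, comp_ι_π_of_notMem hf hj, zero_comp]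

lemma zero {X : T} : IsFinitelySupported (0 : X ⟶ ∐ Y) := ⟨∅, by simp⟩

lemma add {X : T} {f g : X ⟶ ∐ Y} (hf : IsFinitelySupported f) (hg : IsFinitelySupported g) :
    IsFinitelySupported (f + g) := by
  classical
  obtain ⟨J, hJ⟩ := hf
  obtain ⟨J', hJ'⟩ := hg
  refine ⟨J ∪ J', ?_⟩
  conv_lhs => rw [eq_sum_of_subset hJ (Finset.subset_union_left (s₂ := J')),
    eq_sum_of_subset hJ' (Finset.subset_union_right (s₁ := J))]
  simp [Finset.sum_add_distrib]

lemma neg {X : T} {f : X ⟶ ∐ Y} (hf : IsFinitelySupported f) : IsFinitelySupported (-f) := by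
  obtain ⟨J, hJ⟩ := hf
  refine ⟨J, ?_⟩
  conv_lhs => rw [hJ]
  simp

lemma precomp {X X' : T} {f : X ⟶ ∐ Y} (hf : IsFinitelySupported f) (g : X' ⟶ X) :
    IsFinitelySupported (g ≫ f) := by
  obtain ⟨J, hJ⟩ := hf
  refine ⟨J, ?_⟩
  conv_lhs => rw [hJ]
  simp [Preadditive.comp_sum]

lemma comp_ι {X : T} {i : ι} (g : X ⟶ Y i) : IsFinitelySupported (g ≫ Sigma.ι Y i) :=
  ⟨{i}, by simp⟩

lemma comp_map {X : T} {ι' : Type*} {Y' : ι' → T} [HasCoproduct Y'] {f : X ⟶ ∐ Y}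
    (hf : IsFinitelySupported f) (φ : ∐ Y ⟶ ∐ Y')
    (hφ : ∀ i, IsFinitelySupported (Sigma.ι Y i ≫ φ)) : IsFinitelySupported (f ≫ φ) := by
  classical
  obtain ⟨J, hJ⟩ := hf
  rw [hJ, Preadditive.sum_comp]
  refine Finset.sum_induction _ IsFinitelySupported (fun _ _ => add) zero fun j _ => ?_
  rw [Category.assoc, Category.assoc, ← Category.assoc f]
  exact (hφ j).precomp _

end IsFinitelySupported

/-- The subgroup of finitely supported morphisms to a coproduct. -/
def finitelySupported (X : T) (Y : ι → T) [HasCoproduct Y] : AddSubgroup (X ⟶ ∐ Y) where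
  carrier := {f | IsFinitelySupported f}
  zero_mem' := .zero
  add_mem' := .add
  neg_mem' := .neg

/-- `Hom(X, ∐ Y)` is the coproduct of the `Hom(X, Y i)`, and its quotient by the finitely supported
morphisms vanishes on every summand. -/
lemma IsCompactObj.isFinitelySupported {X : T} (hX : IsCompactObj.{w} X) (f : X ⟶ ∐ Y) :
    IsFinitelySupported f := by
  have := hX ι
  let hc := isColimitOfPreserves (preadditiveCoyoneda.obj (op X)) (colimit.isColimit (Discrete.functor Y))
  have key : AddCommGrpCat.ofHom (QuotientAddGroup.mk' (finitelySupported X Y)) =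
      (0 : AddCommGrpCat.of (X ⟶ ∐ Y) ⟶ AddCommGrpCat.of ((X ⟶ ∐ Y) ⧸ finitelySupported X Y)) := by
    refine hc.hom_ext ?_
    rintro ⟨i⟩
    ext g
    exact (QuotientAddGroup.eq_zero_iff _).2 (IsFinitelySupported.comp_ι (Y := Y) (i := i) g)
  exact (QuotientAddGroup.eq_zero_iff _).1 (ConcreteCategory.congr_hom key f)

/-- The map out of `Hom(X, ∐ Y)` given by a cocone `σ` must be `f ↦ ∑ᶠ i, σ i (f ≫ π i)`. Finite
support makes this additive and forces uniqueness. -/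
lemma isCompactObj_of_isFinitelySupported [HasCoproducts.{w} T] {X : T}
    (hX : ∀ {ι : Type w} (Y : ι → T) (f : X ⟶ ∐ Y), IsFinitelySupported f) :
    IsCompactObj.{w} X := by
  classical
  intro ι
  refine ⟨fun {K} => ?_⟩
  let Y : ι → T := fun i => K.obj ⟨i⟩
  have hsupp : ∀ f : X ⟶ ∐ Y, {i | f ≫ Sigma.π Y i ≠ 0}.Finite := by
    intro f
    obtain ⟨J, hJ⟩ := hX Y f
    refine J.finite_toSet.subset fun i hi => ?_
    by_contra h
    exact hi (IsFinitelySupported.comp_ι_π_of_notMem hJ h)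
  have hY : PreservesColimit (Discrete.functor Y) (preadditiveCoyoneda.obj (op X)) := by
    refine preservesColimit_of_preserves_colimit_cocone
      (colimit.isColimit (Discrete.functor Y)) ?_
    let σ (s : Cocone (Discrete.functor Y ⋙ preadditiveCoyoneda.obj (op X))) (i : ι) :
        (X ⟶ Y i) →+ s.pt := (s.ι.app ⟨i⟩).hom
    have hs : ∀ (s : Cocone (Discrete.functor Y ⋙ preadditiveCoyoneda.obj (op X)))
        (f : X ⟶ ∐ Y), (Function.support fun i => σ s i (f ≫ Sigma.π Y i)).Finite := fun s f =>
      (hsupp f).subset fun i hi h => hi (by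
        change σ s i (f ≫ Sigma.π Y i) = 0
        rw [h, map_zero])
    let δ (s : Cocone (Discrete.functor Y ⋙ preadditiveCoyoneda.obj (op X))) :
        (X ⟶ ∐ Y) →+ s.pt :=
      { toFun := fun f => ∑ᶠ i, σ s i (f ≫ Sigma.π Y i)
        map_zero' := finsum_eq_zero_of_forall_eq_zero fun i => by simp
        map_add' := fun f g => by
          rw [← finsum_add_distrib (hs s f) (hs s g)]
          exact finsum_congr fun i => by simp }
    have hδ (s) (i : ι) (g : X ⟶ Y i) : δ s (g ≫ Sigma.ι Y i) = σ s i g := by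
      change ∑ᶠ j, σ s j ((g ≫ Sigma.ι Y i) ≫ Sigma.π Y j) = σ s i g
      rw [finsum_eq_single _ i]
      · simp
      · intro j hj
        simp [Sigma.ι_π_of_ne _ hj.symm]
    have hδ' (s) (m : (X ⟶ ∐ Y) →+ s.pt)
        (hm : ∀ (i : ι) (g : X ⟶ Y i), m (g ≫ Sigma.ι Y i) = σ s i g) : m = δ s := by
      ext f
      obtain ⟨J, hJ⟩ := hX Y f
      rw [hJ, map_sum, map_sum]
      refine Finset.sum_congr rfl fun j _ => ?_
      rw [← Category.assoc, hm, hδ]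
    exact
      { desc := fun s => AddCommGrpCat.ofHom (δ s)
        fac := fun s ⟨i⟩ => AddCommGrpCat.hom_ext (AddMonoidHom.ext fun g => hδ s i g)
        uniq := fun s m hm => AddCommGrpCat.hom_ext (hδ' s m.hom fun i g =>
          ConcreteCategory.congr_hom (hm ⟨i⟩) g) }
  have hY' : PreservesColimit (Discrete.functor (K.obj ∘ Discrete.mk))
    (preadditiveCoyoneda.obj (op X)) := hY
  exact preservesColimit_of_iso_diagram _ (Discrete.natIsoFunctor (F := K)).symm

end Compact

/-! ### Coproducts in a Verdier quotient -/

section CoproductsLocalization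

variable {T : Type*} [Category* T] [HasZeroObject T] [HasShift T ℤ] [Preadditive T]
  [∀ n : ℤ, (shiftFunctor T n).Additive] [Pretriangulated T]
  (P : ObjectProperty T) [P.IsTriangulated] [P.IsClosedUnderIsomorphisms]
  {ι : Type*} [HasCoproductsOfShape ι T]

open Pretriangulated.Opposite in
-- A coproduct of distinguished triangles is distinguished, so the cone of the coproduct is the
-- coproduct of the cones. The proof passes to the opposite category to use the corresponding fact
-- for products.
lemma trW_sigmaMap (hP : ∀ Z : ι → T, (∀ i, P (Z i)) → P (∐ Z)) {X Y : ι → T}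
    (s : ∀ i, X i ⟶ Y i) (hs : ∀ i, P.trW (s i)) : P.trW (Limits.Sigma.map s) := by
  have : HasProductsOfShape ι Tᵒᵖ := hasProductsOfShape_opposite ι
  have hs' : ∀ i, P.op.trW (s i).op := fun i => (P.trW_op_iff).2 (hs i)
  choose Z a b hT hZ using hs'
  have h := ObjectProperty.trW.mk P.op (productTriangle_distinguished _ hT) 
    (P.prop_of_iso (opCoproductIsoProduct fun i => (Z i).unop).unop.symm
      (hP (fun i => (Z i).unop) hZ))
  have h' : P.trW (productTriangle fun i => Triangle.mk (s i).op (a i) (b i)).mor₁.unop :=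
    (P.trW_op_iff).1 h
  refine (P.trW.arrow_mk_iso_iff (Arrow.isoMk
    (opCoproductIsoProduct X).unop.symm (opCoproductIsoProduct Y).unop.symm ?_)).2 h'
  refine Quiver.Hom.op_inj ?_
  change Limits.Pi.map (fun i => (s i).op) ≫ (opCoproductIsoProduct X).inv =
    (opCoproductIsoProduct Y).inv ≫ (Limits.Sigma.map s).op
  rw [Iso.comp_inv_eq, Category.assoc, Iso.eq_inv_comp]
  refine Limits.Pi.hom_ext _ _ fun i => ?_
  rw [Category.assoc, Category.assoc, Limits.Pi.map_π, opCoproductIsoProduct_hom_comp_π_assoc,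
    opCoproductIsoProduct_hom_comp_π, ← op_comp, ← op_comp, Sigma.ι_map]

include P in
-- Right fractions chosen for the components assemble into one fraction, because the coproduct of
-- their denominators is again a denominator. For uniqueness, two morphisms are put over a common
-- left denominator and equalized componentwise after precomposition with denominators, which are
-- assembled in the same way.
lemma preservesCoproducts_of_isLocalization [IsTriangulated T] {D : Type*} [Category* D]
    (hP : ∀ Z : ι → T, (∀ i, P (Z i)) → P (∐ Z)) (L : T ⥤ D) [L.IsLocalization P.trW] :
    PreservesColimitsOfShape (Discrete ι) L := by
  have : L.EssSurj := Localization.essSurj L P.trW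
  refine ⟨fun {K} => ?_⟩
  let X : ι → T := fun i => K.obj ⟨i⟩
  have hX : PreservesColimit (Discrete.functor X) L := by
    refine preservesColimit_of_preserves_colimit_cocone (colimit.isColimit _) ?_
    have key : ∀ (W : D) (f : ∀ i, L.obj (X i) ⟶ W),
        ∃! g : L.obj (∐ X) ⟶ W, ∀ i, L.map (Sigma.ι X i) ≫ g = f i := by
      intro W f
      obtain ⟨W', ⟨e⟩⟩ : ∃ W', Nonempty (L.obj W' ≅ W) := ⟨_, ⟨L.objObjPreimageIso W⟩⟩
      refine existsUnique_of_exists_of_unique ?_ ?_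
      · have hf : ∀ i, ∃ (X' : T) (s : X' ⟶ X i) (_ : P.trW s) (g : X' ⟶ W'),
            L.map s ≫ f i = L.map g ≫ e.hom := by
          intro i
          obtain ⟨φ, hφ⟩ := Localization.exists_rightFraction L P.trW (f i ≫ e.inv)
          refine ⟨φ.X', φ.s, φ.hs, φ.f, ?_⟩
          rw [← cancel_mono e.inv, Category.assoc, hφ]
          simp
        choose X' s hs g hg using hf
        have h := Localization.inverts L P.trW _ (trW_sigmaMap P hP s hs)
        refine ⟨inv (L.map (Limits.Sigma.map s)) ≫ L.map (Sigma.desc g) ≫ e.hom, fun i => ?_⟩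
        have := Localization.inverts L P.trW _ (hs i)
        rw [← cancel_epi (L.map (s i)), hg, ← Category.assoc (L.map (s i)), ← L.map_comp,
          ← Sigma.ι_map, L.map_comp, Category.assoc, IsIso.hom_inv_id_assoc, ← L.map_comp_assoc,
          Sigma.ι_desc]
      · intro g₁ g₂ h₁ h₂
        obtain ⟨φ, h₁', h₂'⟩ := Localization.exists_leftFraction₂ L P.trW (g₁ ≫ e.inv) (g₂ ≫ e.inv)
        have := Localization.inverts L P.trW _ φ.hs
        have hfac : ∀ i, ∃ (X' : T) (t : X' ⟶ X i) (_ : P.trW t),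
            t ≫ Sigma.ι X i ≫ φ.f = t ≫ Sigma.ι X i ≫ φ.f' := by
          intro i
          refine (MorphismProperty.map_eq_iff_precomp L P.trW _ _).1 ?_
          have e₁ : L.map φ.f = g₁ ≫ e.inv ≫ L.map φ.s := by
            rw [← Category.assoc, h₁', MorphismProperty.LeftFraction.map_comp_map_s]
          have e₂ : L.map φ.f' = g₂ ≫ e.inv ≫ L.map φ.s := by
            rw [← Category.assoc, h₂', MorphismProperty.LeftFraction.map_comp_map_s]
          rw [L.map_comp, L.map_comp, e₁, e₂, ← Category.assoc, h₁, ← Category.assoc (L.map _), h₂]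
        choose X' t ht hfac using hfac
        have h := Localization.inverts L P.trW _ (trW_sigmaMap P hP t ht)
        have hφ : L.map φ.f = L.map φ.f' := by
          rw [← cancel_epi (L.map (Limits.Sigma.map t)), ← L.map_comp, ← L.map_comp]
          congr 1
          ext i
          simpa using hfac i
        rw [← cancel_mono e.inv, h₁', h₂', ← cancel_mono (L.map φ.s)]
        erw [MorphismProperty.LeftFraction.map_comp_map_s,
          MorphismProperty.LeftFraction.map_comp_map_s]
        exact hφ
    refine IsColimit.ofExistsUnique fun s => ?_
    obtain ⟨g, hg, hg'⟩ := key s.pt fun i => s.ι.app ⟨i⟩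
    exact ⟨g, fun ⟨i⟩ => hg i, fun g' h => hg' g' fun i => h ⟨i⟩⟩
  have hX' : PreservesColimit (Discrete.functor (K.obj ∘ Discrete.mk)) L := hX
  exact preservesColimit_of_iso_diagram _ (Discrete.natIsoFunctor (F := K)).symm

end CoproductsLocalization

/-! ### Coproducts of complexes and of their homotopy classes -/

section HomotopyCategoryCoproducts

variable {V : Type*} [Category* V] [Preadditive V] {α : Type*} (c : ComplexShape α)
  (ι : Type*) [HasCoproductsOfShape ι V]

/-- Homotopies given on the summands glue to a homotopy on the coproduct, since each term of the
coproduct is the coproduct of the terms. -/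
instance : PreservesColimitsOfShape (Discrete ι) (HomotopyCategory.quotient V c) := by
  refine ⟨fun {K} => ?_⟩
  refine preservesColimit_of_preserves_colimit_cocone (colimit.isColimit K) ?_
  let hc (n : α) := isColimitOfPreserves (HomologicalComplex.eval V c n) (colimit.isColimit K)
  refine IsColimit.ofExistsUnique fun s => existsUnique_of_exists_of_unique ?_ ?_
  · choose g hg using fun i : Discrete ι =>
      (HomotopyCategory.quotient V c).map_surjective (X := K.obj i) (Y := s.pt.as) (s.ι.app i)
    refine ⟨(HomotopyCategory.quotient V c).map
      (colimit.desc K ⟨_, Discrete.natTrans g⟩), fun i => ?_⟩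
    refine ((HomotopyCategory.quotient V c).map_comp _ _).symm.trans ?_
    exact (congr_arg (HomotopyCategory.quotient V c).map (colimit.ι_desc _ i)).trans (hg i)
  · intro f₁ f₂ h₁ h₂
    obtain ⟨f₁, rfl⟩ := (HomotopyCategory.quotient V c).map_surjective (X := colimit K) (Y := s.pt.as) f₁
    obtain ⟨f₂, rfl⟩ := (HomotopyCategory.quotient V c).map_surjective (X := colimit K) (Y := s.pt.as) f₂
    have h : ∀ i : Discrete ι, Homotopy (colimit.ι K i ≫ f₁) (colimit.ι K i ≫ f₂) := fun i =>
      HomotopyCategory.homotopyOfEq _ _ ((HomotopyCategory.quotient V c).map_comp _ _ |>.trans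
        ((h₁ i).trans (h₂ i).symm) |>.trans ((HomotopyCategory.quotient V c).map_comp _ _).symm)
    let H (p q : α) : (colimit K).X p ⟶ s.pt.as.X q :=
      (hc p).desc ⟨_, Discrete.natTrans fun i => (h i).hom p q⟩
    have hH (i : Discrete ι) (p q : α) : (colimit.ι K i).f p ≫ H p q = (h i).hom p q :=
      (hc p).fac _ i
    refine HomotopyCategory.eq_of_homotopy _ _ { hom := H, zero := ?_, comm := ?_ }
    · intro p q hpq
      refine (hc p).hom_ext fun i => ?_
      exact (hH i p q).trans (((h i).zero p q hpq).trans comp_zero.symm)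
    · intro n
      refine (hc n).hom_ext fun i => ?_
      have := (h i).comm n
      rw [show (h i).hom = fun p q => (colimit.ι K i).f p ≫ H p q by ext p q; rw [hH],
        dNext_comp_left, prevD_comp_left] at this
      rw [HomologicalComplex.comp_f, HomologicalComplex.comp_f, ← Preadditive.comp_add,
        ← Preadditive.comp_add] at this
      exact this

end HomotopyCategoryCoproducts

section

lemma hasCoproductsOfShape_of_essSurj {C D : Type*} [Category* C] [Category* D] (L : C ⥤ D)
    [L.EssSurj] (ι : Type*) [HasCoproductsOfShape ι C] [PreservesColimitsOfShape (Discrete ι) L] :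
    HasCoproductsOfShape ι D := by
  refine ⟨fun F => ?_⟩
  let e : F ≅ Discrete.functor (fun i => L.objPreimage (F.obj ⟨i⟩)) ⋙ L :=
    Discrete.natIso fun i => (L.objObjPreimageIso (F.obj i)).symm
  exact hasColimit_of_iso e

end

section CoproductElements

variable {A : Type u} [Ring A] {ι : Type*} {α : Type*} {c : ComplexShape α}
  [HasCoproductsOfShape ι (ModuleCat.{u} A)] (K : ι → HomologicalComplex (ModuleCat.{u} A) c)

open scoped Classical in
-- The elements in question form a submodule containing every summand, so its quotient map vanishes.
-- Allowing all `J' ⊇ J` is what makes the condition stable under addition.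
lemma exists_eq_sum_of_sigma (n : α) (x : (∐ K).X n) :
    ∃ J : Finset ι, ∀ J', J ⊆ J' →
      x = ∑ j ∈ J', (Sigma.ι K j).f n ((Sigma.π K j).f n x) := by
  let S : Submodule A ((∐ K).X n) :=
    { carrier := {x | ∃ J : Finset ι, ∀ J', J ⊆ J' →
        x = ∑ j ∈ J', (Sigma.ι K j).f n ((Sigma.π K j).f n x)}
      zero_mem' := ⟨∅, by simp⟩
      add_mem' := by
        rintro x y ⟨J, hJ⟩ ⟨J', hJ'⟩
        refine ⟨J ∪ J', fun J'' h => ?_⟩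
        conv_lhs => rw [hJ J'' (Finset.union_subset_left h), hJ' J'' (Finset.union_subset_right h)]
        simp [Finset.sum_add_distrib]
      smul_mem' := by
        rintro a x ⟨J, hJ⟩
        refine ⟨J, fun J' h => ?_⟩
        conv_lhs => rw [hJ J' h]
        simp [Finset.smul_sum] }
  have hS (i : ι) (y : (K i).X n) : (Sigma.ι K i).f n y ∈ S := by
    refine ⟨{i}, fun J' h => ?_⟩
    have h' (j : ι) : (Sigma.ι K j).f n ((Sigma.π K j).f n ((Sigma.ι K i).f n y)) =
        (Sigma.ι K i ≫ Sigma.π K j ≫ Sigma.ι K j).f n y := rfl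
    rw [Finset.sum_eq_single i]
    · rw [h', Sigma.ι_π_eq_id_assoc]
    · intro j _ hj
      rw [h', Sigma.ι_π_of_ne_assoc _ hj.symm]
      simp
    · intro hi
      exact (hi (h (Finset.mem_singleton_self i))).elim
  suffices h : ModuleCat.ofHom S.mkQ = 0 from
    (Submodule.Quotient.mk_eq_zero S).1 (ConcreteCategory.congr_hom h x)
  refine (isColimitOfPreserves (HomologicalComplex.eval (ModuleCat A) c n)
    (colimit.isColimit (Discrete.functor K))).hom_ext ?_
  rintro ⟨i⟩
  ext y
  exact (Submodule.Quotient.mk_eq_zero S).2 (hS i y)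

open scoped Classical in
lemma sigma_element_ext (n : α) (x : (∐ K).X n) (hx : ∀ i, (Sigma.π K i).f n x = 0) : x = 0 := by
  obtain ⟨J, hJ⟩ := exists_eq_sum_of_sigma K n x
  rw [hJ J subset_rfl]
  simp [hx]

open scoped Classical in
lemma sigma_hom_ext {L : HomologicalComplex (ModuleCat.{u} A) c} (f : L ⟶ ∐ K)
    (hf : ∀ i, f ≫ Sigma.π K i = 0) : f = 0 := by
  ext n x
  refine sigma_element_ext K n _ fun i => ?_
  exact ConcreteCategory.congr_hom (HomologicalComplex.congr_hom (hf i) n) x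

lemma exactAt_sigma (n : α) (hK : ∀ i, (K i).ExactAt n) : (∐ K).ExactAt n := by
  classical
  rw [HomologicalComplex.exactAt_iff, ShortComplex.moduleCat_exact_iff]
  intro (x : (∐ K).X n) (hx : (∐ K).d n (c.next n) x = 0)
  have hx' (i : ι) : (K i).d n (c.next n) ((Sigma.π K i).f n x) = 0 :=
    (ConcreteCategory.congr_hom ((Sigma.π K i).comm n (c.next n)) x).trans (by
      change (Sigma.π K i).f _ ((∐ K).d _ _ x) = 0
      rw [hx, map_zero])
  have hy (i : ι) : ∃ y : (K i).X (c.prev n), (K i).d (c.prev n) n y = (Sigma.π K i).f n x :=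
    ((K i).sc n).moduleCat_exact_iff.1 (hK i) _ (hx' i)
  choose y hy using hy
  obtain ⟨J, hJ⟩ := exists_eq_sum_of_sigma K n x
  refine ⟨∑ j ∈ J, (Sigma.ι K j).f (c.prev n) (y j), ?_⟩
  change (∐ K).d (c.prev n) n (∑ j ∈ J, (Sigma.ι K j).f (c.prev n) (y j)) = x
  rw [hJ J subset_rfl, map_sum]
  refine Finset.sum_congr rfl fun j _ => ?_
  rw [← hy]
  exact (ConcreteCategory.congr_hom ((Sigma.ι K j).comm (c.prev n) n) (y j))

end CoproductElements

/-! ### Coproducts in the coderived category; coacyclic implies acyclic -/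

section CoderivedCoproducts

variable (A : Type u) [Ring A]

instance (ι : Type u) : HasCoproductsOfShape ι (HotMod A) :=
  have : (HomotopyCategory.quotient (ModuleCat.{u} A) (ComplexShape.up ℤ)).EssSurj := inferInstance
  hasCoproductsOfShape_of_essSurj (HomotopyCategory.quotient (ModuleCat.{u} A) (ComplexShape.up ℤ)) ι

variable {A} in
lemma coacyclic_sigma {ι : Type u} (X : ι → HotMod A) (hX : ∀ i, coacyclic A (X i)) :
    coacyclic A (∐ X) :=
  coacyclic.coproduct X _ (coproductIsCoproduct X) hX

instance (ι : Type u) : PreservesColimitsOfShape (Discrete ι) (coacyclic A).trW.Q :=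
  preservesCoproducts_of_isLocalization (coacyclic A) coacyclic_sigma _

instance (ι : Type u) : HasCoproductsOfShape ι (CoderivedCategory A) :=
  have : (coacyclic A).trW.Q.EssSurj := Localization.essSurj _ (coacyclic A).trW
  hasCoproductsOfShape_of_essSurj (coacyclic A).trW.Q ι

instance : (CoderivedCategory.Q A).EssSurj :=
  have : (coacyclic A).trW.Q.EssSurj := Localization.essSurj _ (coacyclic A).trW
  inferInstance

instance (ι : Type u) : PreservesColimitsOfShape (Discrete ι) (CoderivedCategory.Q A) := inferInstance

instance : HasCoproducts.{u} (CoderivedCategory A) := fun _ => inferInstance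

/-- For a short exact sequence the map `cone(X₁ ⟶ X₂) ⟶ X₃` is a quasi-isomorphism, so its cone, the
totalization, is acyclic. Direct sums are handled by their exactness. -/
lemma coacyclic_le_subcategoryAcyclic :
    coacyclic A ≤ HomotopyCategory.subcategoryAcyclic (ModuleCat.{u} A) := by
  intro X hX
  induction hX with
  | totalization S hS =>
    have h := CochainComplex.mappingCone.quasiIso_descShortComplex hS
    refine ((HomotopyCategory.subcategoryAcyclic _).trW_iff_of_distinguished _
      (HomotopyCategory.mappingCone_triangleh_distinguished
        (CochainComplex.mappingCone.descShortComplex S))).1 ?_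
    rw [← HomotopyCategory.quasiIso_eq_trW_subcategoryAcyclic]
    exact (HomotopyCategory.quotient_map_mem_quasiIso_iff _).2 h
  | iso e _ h => exact ObjectProperty.prop_of_iso _ e h
  | shift n _ h => exact ObjectProperty.le_shift _ n _ h
  | ext T hT _ _ h₁ h₃ => exact ObjectProperty.ext_of_isTriangulatedClosed₂ _ T hT h₁ h₃
  | coproduct X c hc _ h =>
    choose K hK using fun i => HomotopyCategory.quotient_obj_surjective (X i)
    obtain rfl : X = fun i => (HomotopyCategory.quotient _ _).obj (K i) := by ext i; exact (hK i).symm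
    have e := (isColimitOfPreserves (HomotopyCategory.quotient _ _) (colimit.isColimit
      (Discrete.functor K))).coconePointsIsoOfNatIso hc (Discrete.natIso fun i => Iso.refl _)
    refine ObjectProperty.prop_of_iso _ e ?_
    refine (HomotopyCategory.quotient_obj_mem_subcategoryAcyclic_iff_exactAt _).2 fun n =>
      exactAt_sigma K n fun i => ?_
    exact (HomotopyCategory.quotient_obj_mem_subcategoryAcyclic_iff_exactAt _).1 (h i) n

end CoderivedCoproducts

/-! ### Short exact sequences and bounded acyclic complexes -/

section ConeOfIdentity

open CochainComplex HomComplex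

variable {C : Type*} [Category* C] [Preadditive C] [HasBinaryBiproducts C]
  {G F : CochainComplex C ℤ}

/-- The morphism from the cone of the identity of `G` to `F` attached to
a cochain of degree `-1` from `G` to `F`. -/
noncomputable def coneIdDesc (α : Cochain G F (-1)) : mappingCone (𝟙 G) ⟶ F :=
  mappingCone.desc (𝟙 G) α
    (Cocycle.homOf (Cocycle.mk (δ (-1) 0 α) 1 (zero_add 1) (δ_δ _ _ _ _)))
    (by rw [Category.id_comp, Cocycle.cochain_ofHom_homOf_eq_coe]; rfl)

@[simp]
lemma inl_v_coneIdDesc_f (α : Cochain G F (-1)) (p q : ℤ) (h : p + (-1) = q) :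
    (mappingCone.inl (𝟙 G)).v p q h ≫ (coneIdDesc α).f q = α.v p q h := by
  simp [coneIdDesc]

lemma inr_f_coneIdDesc_f (α : Cochain G F (-1)) (p : ℤ) :
    (mappingCone.inr (𝟙 G)).f p ≫ (coneIdDesc α).f p = (δ (-1) 0 α).v p p (add_zero p) := by
  simp [coneIdDesc]

lemma isZero_quotient_cone_id [HasZeroObject C] (G : CochainComplex C ℤ) :
    IsZero ((HomotopyCategory.quotient C (ComplexShape.up ℤ)).obj (mappingCone (𝟙 G))) := by
  rw [IsZero.iff_id_eq_zero, ← CategoryTheory.Functor.map_id,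
    HomotopyCategory.quotient_map_eq_zero_iff]
  exact ⟨mappingCone.liftHomotopy _ _ _ (mappingCone.snd _) 0 (by simp) (by simp)⟩

end ConeOfIdentity

section ShortExactCoacyclic

variable {A : Type u} [Ring A]

section

variable (P : ObjectProperty (HotMod A)) [P.IsTriangulated] [P.IsClosedUnderIsomorphisms]
  (hP : coacyclic A ≤ P) {S : ShortComplex (CochainComplex (ModuleCat.{u} A) ℤ)}
  (hS : S.ShortExact)

include hP hS

/-- The totalization is the cone of `cone(S.f) ⟶ S.X₃`, hence invisible to `P`. The lemmas below are
applied with `P` the coacyclic and with `P` the acyclic complexes. -/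
lemma prop_mappingCone_iff_of_shortExact :
    P ((HomotopyCategory.quotient _ _).obj (CochainComplex.mappingCone S.f)) ↔
      P ((HomotopyCategory.quotient _ _).obj S.X₃) :=
  ⟨fun h => P.ext_of_isTriangulatedClosed₂ _ (HomotopyCategory.mappingCone_triangleh_distinguished
    (CochainComplex.mappingCone.descShortComplex S)) h (hP _ (coacyclic.totalization S hS)),
   fun h => P.ext_of_isTriangulatedClosed₁ _ (HomotopyCategory.mappingCone_triangleh_distinguished
    (CochainComplex.mappingCone.descShortComplex S)) h (hP _ (coacyclic.totalization S hS))⟩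

lemma prop_X₂_of_shortExact (h₁ : P ((HomotopyCategory.quotient _ _).obj S.X₁))
    (h₃ : P ((HomotopyCategory.quotient _ _).obj S.X₃)) :
    P ((HomotopyCategory.quotient _ _).obj S.X₂) :=
  P.ext_of_isTriangulatedClosed₂ _ (HomotopyCategory.mappingCone_triangleh_distinguished S.f) h₁
    ((prop_mappingCone_iff_of_shortExact P hP hS).2 h₃)

lemma prop_X₃_of_shortExact (h₁ : P ((HomotopyCategory.quotient _ _).obj S.X₁))
    (h₂ : P ((HomotopyCategory.quotient _ _).obj S.X₂)) :
    P ((HomotopyCategory.quotient _ _).obj S.X₃) :=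
  (prop_mappingCone_iff_of_shortExact P hP hS).1
    (P.ext_of_isTriangulatedClosed₃ _ (HomotopyCategory.mappingCone_triangleh_distinguished S.f)
      h₁ h₂)

end

open CochainComplex HomComplex in
-- The cone is the disk `K.X a = K.X a` in degrees `a` and `a + 1`, mapped by the identity and by
-- the differential. The latter is mono because `K` is exact at its lowest degree `a`.
lemma exists_mono_disk {C : Type*} [Category* C] [Abelian C] (K : CochainComplex C ℤ) (a : ℤ)
    [K.IsStrictlyGE a] (hK : K.ExactAt a) :
    ∃ (G : CochainComplex C ℤ) (φ : mappingCone (𝟙 G) ⟶ K), Mono φ ∧ Epi (φ.f a) := by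
  let G := (HomologicalComplex.single C (ComplexShape.up ℤ) (a + 1)).obj (K.X a)
  let e : G.X (a + 1) ≅ K.X a := HomologicalComplex.singleObjXSelf _ _ _
  have hG (i : ℤ) (hi : i ≠ a + 1) : IsZero (G.X i) :=
    HomologicalComplex.isZero_single_obj_X _ _ _ _ hi
  let α : Cochain G K (-1) := Cochain.single e.hom (-1)
  have hα : α.v (a + 1) a (by lia) = e.hom := by simp [α]
  have hd : Mono (K.d a (a + 1)) := by
    have := (K.exactAt_iff' (a - 1) a (a + 1) (by simp) (by simp)).1 hK
    exact this.mono_g ((K.isZero_of_isStrictlyGE a (a - 1) (by lia)).eq_of_src _ _)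
  have hsplit : (coneIdDesc α).f a ≫ e.inv ≫ (mappingCone.inl (𝟙 G)).v (a + 1) a (by lia) = 𝟙 _ := by
    refine mappingCone.ext_from _ (a + 1) a (by lia) ?_ ((hG a (by lia)).eq_of_src _ _)
    rw [← Category.assoc, inl_v_coneIdDesc_f, hα]
    simp
  have hsplit' : (e.inv ≫ (mappingCone.inl (𝟙 G)).v (a + 1) a (by lia)) ≫ (coneIdDesc α).f a = 𝟙 _ := by
    rw [Category.assoc, inl_v_coneIdDesc_f, hα]
    simp
  refine ⟨G, coneIdDesc α, HomologicalComplex.mono_of_mono_f _ fun i => ?_, ?_⟩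
  · by_cases h1 : i = a
    · subst h1
      exact mono_of_mono_fac hsplit
    by_cases h2 : i = a + 1
    · subst h2
      refine (Preadditive.mono_iff_cancel_zero _).2 fun T x hx => ?_
      have h0 : x ≫ (mappingCone.fst (𝟙 G)).1.v (a + 1) (a + 1 + 1) rfl = 0 :=
        (hG (a + 1 + 1) (by lia)).eq_of_tgt _ _
      have hx' : x = (x ≫ (mappingCone.snd (𝟙 G)).v (a + 1) (a + 1) (add_zero _)) ≫
          (mappingCone.inr (𝟙 G)).f (a + 1) := by
        refine mappingCone.ext_to _ _ (a + 1 + 1) rfl ((hG (a + 1 + 1) (by lia)).eq_of_tgt _ _) ?_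
        simp
      have hδ : (δ (-1) 0 α).v (a + 1) (a + 1) (add_zero _) = e.hom ≫ K.d a (a + 1) := by
        rw [δ_v (-1) 0 (by lia) α (a + 1) (a + 1) (by lia) a (a + 1 + 1) (by lia) (by lia), hα,
          (hG (a + 1 + 1) (by lia)).eq_of_tgt (G.d (a + 1) (a + 1 + 1)) 0]
        simp
      rw [hx', Category.assoc, inr_f_coneIdDesc_f, hδ, ← Category.assoc] at hx
      have h3 := (cancel_mono _).1 (hx.trans zero_comp.symm)
      have h4 := (cancel_mono _).1 (h3.trans zero_comp.symm)
      rw [hx', h4, zero_comp]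
    · have : IsZero ((mappingCone (𝟙 G)).X i) := by
        rw [mappingCone.isZero_X_iff]
        exact ⟨hG _ (by lia), hG _ h2⟩
      exact ⟨fun _ _ _ => this.eq_of_tgt _ _⟩
  · exact epi_of_epi_fac hsplit'

/-- Dividing out the disk on the lowest term removes that degree. The disk is contractible, so the
quotient remains acyclic and coacyclicity passes back to `K`; induct on the length. -/
lemma coacyclic_of_acyclic_of_bounded (K : CochainComplex (ModuleCat.{u} A) ℤ) (a b : ℤ)
    [K.IsStrictlyGE a] [K.IsStrictlyLE b] (hK : K.Acyclic) :
    coacyclic A ((HomotopyCategory.quotient _ _).obj K) := by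
  obtain ⟨n, hn⟩ : ∃ n : ℕ, b < a + n := ⟨(b + 1 - a).toNat, by lia⟩
  induction n generalizing K a with
  | zero =>
    have : IsZero K := by
      rw [IsZero.iff_id_eq_zero]
      ext i : 1
      rcases lt_or_ge i a with h | h
      · exact (K.isZero_of_isStrictlyGE a i h).eq_of_src _ _
      · exact (K.isZero_of_isStrictlyLE b i (by simp at hn; lia)).eq_of_src _ _
    exact ObjectProperty.prop_of_isZero _ (Functor.map_isZero _ this)
  | succ n ih =>
    obtain ⟨G, φ, hφ, hφ'⟩ := exists_mono_disk K a (hK a)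
    have hcone := isZero_quotient_cone_id G
    let S := ShortComplex.mk φ (cokernel.π φ) (cokernel.condition φ)
    have hS : S.ShortExact :=
      { exact := ShortComplex.exact_of_g_is_cokernel S (cokernelIsCokernel φ)
        mono_f := hφ
        epi_g := inferInstanceAs (Epi (cokernel.π φ)) }
    have h1 : coacyclic A ((HomotopyCategory.quotient _ _).obj S.X₁) :=
      ObjectProperty.prop_of_isZero _ hcone
    refine prop_X₂_of_shortExact _ le_rfl hS h1 ?_
    have hepi (i : ℤ) : Epi ((cokernel.π φ).f i) := inferInstance
    -- In degree `a` the cokernel vanishes because `φ` is epi there.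
    have : (cokernel φ).IsStrictlyGE (a + 1) := by
      rw [CochainComplex.isStrictlyGE_iff]
      intro i hi
      rw [IsZero.iff_id_eq_zero, ← cancel_epi ((cokernel.π φ).f i)]
      rcases lt_or_eq_of_le (Int.lt_add_one_iff.1 hi) with h | rfl
      · exact (K.isZero_of_isStrictlyGE a i h).eq_of_src _ _
      · rw [← cancel_epi (φ.f i), Category.comp_id, ← HomologicalComplex.comp_f,
          cokernel.condition, comp_zero, comp_zero]
        rfl
    have : (cokernel φ).IsStrictlyLE b := by
      rw [CochainComplex.isStrictlyLE_iff]
      intro i hi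
      rw [IsZero.iff_id_eq_zero, ← cancel_epi ((cokernel.π φ).f i)]
      exact (K.isZero_of_isStrictlyLE b i hi).eq_of_src _ _
    refine ih (cokernel φ) (a + 1) ?_ (by push_cast at hn; lia)
    rw [← HomotopyCategory.quotient_obj_mem_subcategoryAcyclic_iff_acyclic] at hK ⊢
    exact prop_X₃_of_shortExact _ (coacyclic_le_subcategoryAcyclic A) hS
      (ObjectProperty.prop_of_isZero _ hcone) hK

end ShortExactCoacyclic

section

variable {T : Type*} [Category* T] [HasZeroObject T] [HasShift T ℤ] [Preadditive T]
  [∀ n : ℤ, (shiftFunctor T n).Additive] [Pretriangulated T]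

lemma distinguished_of_iso₃ {X Y Z Z' : T} {f : X ⟶ Y} {g : Y ⟶ Z} {h : Z ⟶ X⟦(1 : ℤ)⟧}
    (hT : Triangle.mk f g h ∈ distTriang T) (e : Z ≅ Z') :
    Triangle.mk f (g ≫ e.hom) (e.inv ≫ h) ∈ distTriang T := by
  refine isomorphic_distinguished _ hT _
    (Triangle.isoMk _ _ (Iso.refl X) (Iso.refl Y) e.symm ?_ ?_ ?_)
  · exact (Category.comp_id f).trans (Category.id_comp f).symm
  · change (g ≫ e.hom) ≫ e.inv = 𝟙 Y ≫ g
    simp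
  · change (e.inv ≫ h) ≫ (𝟙 X)⟦(1 : ℤ)⟧' = e.inv ≫ h
    simp

end

/-! ### Distinguished triangles in the coderived category -/

section CoderivedTriangles

variable {A : Type u} [Ring A]

lemma isZero_trW_Q_obj {X : HotMod A} (hX : coacyclic A X) :
    IsZero ((coacyclic A).trW.Q.obj X) := by
  have h := Localization.inverts (coacyclic A).trW.Q (coacyclic A).trW (0 : 0 ⟶ X)
    (ObjectProperty.trW.mk _ (contractible_distinguished₁ X) hX)
  have h0 : IsZero ((coacyclic A).trW.Q.obj 0) := Functor.map_isZero _ (isZero_zero _)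
  exact h0.of_iso (asIso ((coacyclic A).trW.Q.map (0 : 0 ⟶ X))).symm

lemma isIso_Q_map_of_coacyclic {K L : CochainComplex (ModuleCat.{u} A) ℤ} (f : K ⟶ L)
    (hf : coacyclic A ((HomotopyCategory.quotient _ _).obj (CochainComplex.mappingCone f))) :
    IsIso ((CoderivedCategory.Q A).map f) :=
  Localization.inverts (coacyclic A).trW.Q (coacyclic A).trW _
    (ObjectProperty.trW.mk _ (HomotopyCategory.mappingCone_triangleh_distinguished f) hf)

lemma isStrictlyLE_mappingCone {C : Type*} [Category* C] [Preadditive C] [HasZeroObject C]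
    [HasBinaryBiproducts C] {K L : CochainComplex C ℤ} (f : K ⟶ L) (a b n : ℤ)
    [K.IsStrictlyLE a] [L.IsStrictlyLE b] (ha : a ≤ n + 1) (hb : b ≤ n) :
    (CochainComplex.mappingCone f).IsStrictlyLE n := by
  rw [CochainComplex.isStrictlyLE_iff]
  intro i hi
  rw [CochainComplex.mappingCone.isZero_X_iff]
  exact ⟨K.isZero_of_isStrictlyLE a _ (by lia), L.isZero_of_isStrictlyLE b _ (by lia)⟩

lemma exists_bounds_mappingCone {C : Type*} [Category* C] [Preadditive C] [HasZeroObject C]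
    [HasBinaryBiproducts C] {K L : CochainComplex C ℤ} (f : K ⟶ L)
    (hK : ∃ a b : ℤ, K.IsStrictlyGE a ∧ K.IsStrictlyLE b)
    (hL : ∃ a b : ℤ, L.IsStrictlyGE a ∧ L.IsStrictlyLE b) :
    ∃ a b : ℤ, (CochainComplex.mappingCone f).IsStrictlyGE a ∧
      (CochainComplex.mappingCone f).IsStrictlyLE b := by
  obtain ⟨a, b, _, _⟩ := hK
  obtain ⟨a', b', _, _⟩ := hL
  exact ⟨min (a - 1) a', max b b', CochainComplex.isStrictlyGE_mappingCone f a a' _,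
    isStrictlyLE_mappingCone f b b' _ (by lia) (by lia)⟩

lemma isIso_Q_map_of_quasiIso {K L : CochainComplex (ModuleCat.{u} A) ℤ} (f : K ⟶ L)
    [QuasiIso f] (hK : ∃ a b : ℤ, K.IsStrictlyGE a ∧ K.IsStrictlyLE b)
    (hL : ∃ a b : ℤ, L.IsStrictlyGE a ∧ L.IsStrictlyLE b) :
    IsIso ((CoderivedCategory.Q A).map f) := by
  obtain ⟨a, b, _, _⟩ := exists_bounds_mappingCone f hK hL
  refine isIso_Q_map_of_coacyclic f (coacyclic_of_acyclic_of_bounded _ a b ?_)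
  rw [← HomotopyCategory.quotient_obj_mem_subcategoryAcyclic_iff_acyclic]
  refine ((HomotopyCategory.subcategoryAcyclic _).trW_iff_of_distinguished _
    (HomotopyCategory.mappingCone_triangleh_distinguished f)).1 ?_
  rw [← HomotopyCategory.quasiIso_eq_trW_subcategoryAcyclic]
  exact (HomotopyCategory.quotient_map_mem_quasiIso_iff _).2 (inferInstanceAs (QuasiIso f))

lemma isIso_Q_map_descShortComplex (S : ShortComplex (CochainComplex (ModuleCat.{u} A) ℤ))
    (hS : S.ShortExact) : IsIso ((CoderivedCategory.Q A).map
      (CochainComplex.mappingCone.descShortComplex S)) :=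
  isIso_Q_map_of_coacyclic _ (coacyclic.totalization S hS)

lemma exists_distinguished_of_mappingCone {K L : CochainComplex (ModuleCat.{u} A) ℤ} (f : K ⟶ L) :
    ∃ h, Triangle.mk ((CoderivedCategory.Q A).map f)
      ((CoderivedCategory.Q A).map (CochainComplex.mappingCone.inr f)) h ∈
        distTriang (CoderivedCategory A) :=
  ⟨_, (coacyclic A).trW.Q.map_distinguished _
    (HomotopyCategory.mappingCone_triangleh_distinguished f)⟩

lemma exists_distinguished_of_shortExact (S : ShortComplex (CochainComplex (ModuleCat.{u} A) ℤ))
    (hS : S.ShortExact) :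
    ∃ h, Triangle.mk ((CoderivedCategory.Q A).map S.f) ((CoderivedCategory.Q A).map S.g) h ∈
      distTriang (CoderivedCategory A) := by
  obtain ⟨h, hT⟩ := exists_distinguished_of_mappingCone S.f
  have := isIso_Q_map_descShortComplex S hS
  have hT' := distinguished_of_iso₃ hT (asIso ((CoderivedCategory.Q A).map
    (CochainComplex.mappingCone.descShortComplex S)))
  rw [asIso_hom, ← Functor.map_comp, CochainComplex.mappingCone.inr_descShortComplex] at hT'
  exact ⟨_, hT'⟩

end CoderivedTriangles

/-! ### Null-homotopies of morphisms to a totalization -/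

section TotalizationNullHomotopy

open CochainComplex HomComplex

variable {C : Type*} [Category* C] [Abelian C]

/-- A cochain whose composition with the epimorphism of a short exact sequence vanishes
factors through the monomorphism. -/
lemma exists_cochain_lift_of_shortExact {S : ShortComplex (CochainComplex C ℤ)}
    (hS : S.ShortExact) {F : CochainComplex C ℤ} {n : ℤ} (v : Cochain F S.X₂ n)
    (hv : v.comp (Cochain.ofHom S.g) (add_zero n) = 0) :
    ∃ w : Cochain F S.X₁ n, w.comp (Cochain.ofHom S.f) (add_zero n) = v := by
  have hS' (q : ℤ) : (S.map (HomologicalComplex.eval C (ComplexShape.up ℤ) q)).ShortExact :=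
    hS.map_of_exact _
  have hmono (q : ℤ) : Mono (S.map (HomologicalComplex.eval C (ComplexShape.up ℤ) q)).f :=
    (hS' q).mono_f
  have h (p q : ℤ) (hpq : p + n = q) : ∃ w : F.X p ⟶ S.X₁.X q, w ≫ S.f.f q = v.v p q hpq := by
    have hv' := Cochain.congr_v hv p q hpq
    rw [Cochain.comp_zero_cochain_v, Cochain.ofHom_v] at hv'
    exact ⟨(hS' q).exact.lift (v.v p q hpq) hv', (hS' q).exact.lift_f (v.v p q hpq) hv'⟩
  choose w hw using h
  exact ⟨Cochain.mk w, by ext p q hpq; simp [hw]⟩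

lemma comp_ofHom_f_injective_of_shortExact {S : ShortComplex (CochainComplex C ℤ)}
    (hS : S.ShortExact) {F : CochainComplex C ℤ} {n : ℤ} {v w : Cochain F S.X₁ n}
    (hv : v.comp (Cochain.ofHom S.f) (add_zero n) = w.comp (Cochain.ofHom S.f) (add_zero n)) :
    v = w := by
  have := hS.mono_f
  ext p q hpq
  have := Cochain.congr_v hv p q hpq
  simpa [cancel_mono] using this

lemma ofHom_descShortComplex (S : ShortComplex (CochainComplex C ℤ)) :
    Cochain.ofHom (mappingCone.descShortComplex S) =
      (mappingCone.snd S.f).comp (Cochain.ofHom S.g) (add_zero 0) := by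
  rw [mappingCone.ext_cochain_from_iff _ (-1) 0 (by lia)]
  simp [mappingCone.descShortComplex]

/-- The hypothesis is only that the component of `g` in `S.X₃` lifts to `S.X₂` as a graded map.
Correcting by the differential of this lift leaves a cocycle `v` with values in the kernel of
`cone(S.f) ⟶ S.X₃`. That kernel is isomorphic to the cone of the identity of `S.X₁`, so it is
contractible and `v` is a coboundary `δ ξ` within it. -/
lemma nonempty_homotopy_zero_of_lift {S : ShortComplex (CochainComplex C ℤ)}
    (hS : S.ShortExact) {F : CochainComplex C ℤ}
    (g : F ⟶ mappingCone (mappingCone.descShortComplex S)) (l : Cochain F S.X₂ 0)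
    (hl : l.comp (Cochain.ofHom S.g) (add_zero 0) =
      (Cochain.ofHom g).comp (mappingCone.snd _) (add_zero 0)) :
    Nonempty (Homotopy g 0) := by
  let π := mappingCone.descShortComplex S
  let u : Cochain F (mappingCone S.f) 1 := (Cochain.ofHom g).comp (mappingCone.fst π).1 (zero_add 1)
  have hu : δ 1 2 u = 0 := by simp [u]
  let z : Cochain F S.X₃ 0 := (Cochain.ofHom g).comp (mappingCone.snd π) (add_zero 0)
  have huz : u.comp (Cochain.ofHom π) (add_zero 1) = - δ 0 1 z := by
    simp [u, z, mappingCone.δ_snd]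
  let l' : Cochain F (mappingCone S.f) 0 := l.comp (Cochain.ofHom (mappingCone.inr S.f)) (add_zero 0)
  have hl' : l'.comp (Cochain.ofHom π) (add_zero 0) = z := by
    rw [Cochain.comp_assoc_of_second_is_zero_cochain, ← Cochain.ofHom_comp,
      mappingCone.inr_descShortComplex, hl]
  let v := u + δ 0 1 l'
  have hv : δ 1 2 v = 0 := by simp [v, hu, δ_δ]
  have hvπ : v.comp (Cochain.ofHom π) (add_zero 1) = 0 := by
    simp only [v, Cochain.add_comp, huz, ← hl', δ_comp_ofHom, neg_add_cancel]
  have hπ : Cochain.ofHom π = (mappingCone.snd S.f).comp (Cochain.ofHom S.g) (add_zero 0) :=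
    ofHom_descShortComplex S
  obtain ⟨w, hw⟩ := exists_cochain_lift_of_shortExact hS
    (v.comp (mappingCone.snd S.f) (add_zero 1)) (by
      rw [Cochain.comp_assoc_of_second_is_zero_cochain, ← hπ, hvπ])
  have hw' : v.comp (mappingCone.fst S.f).1 (show 1 + 1 = 2 by rfl) = - δ 1 2 w := by
    apply comp_ofHom_f_injective_of_shortExact hS
    have h := δ_comp_zero_cochain v (mappingCone.snd S.f) 2 (by lia)
    rw [hv, Cochain.zero_comp, add_zero, ← hw, δ_comp_ofHom, mappingCone.δ_snd] at h
    rw [Cochain.neg_comp, h]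
    simp [Cochain.comp_assoc_of_third_is_zero_cochain]
  -- Contracting the cone of the identity moves the `S.X₁`-valued coordinate `w` of `v` into the
  -- shifted copy of `S.X₁`; the other coordinate of the primitive is zero.
  let ξ := mappingCone.liftCochain S.f w (0 : Cochain F S.X₂ 0) (by lia)
  have hξ : δ 0 1 ξ = v := by
    rw [mappingCone.δ_liftCochain _ _ _ _ 2 (by lia),
      mappingCone.ext_cochain_to_iff _ 1 2 (by lia)]
    simp [hw, hw']
  have hξπ : ξ.comp (Cochain.ofHom π) (add_zero 0) = 0 := by
    rw [hπ, ← Cochain.comp_assoc_of_second_is_zero_cochain, mappingCone.liftCochain_snd,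
      Cochain.zero_comp]
  refine ⟨mappingCone.liftHomotopy _ _ _ (l' - ξ) 0 ?_ ?_⟩
  · rw [δ_sub, hξ]
    simp [v, u, π]
  · rw [Cochain.sub_comp]
    change z = _
    rw [← hl', hξπ]
    simp
    rfl

end TotalizationNullHomotopy

/-! ### Bounded complexes of finitely presented modules -/

section BoundedFinitelyPresented

open CochainComplex HomComplex

variable {A : Type u} [Ring A]

lemma isFPModule_of_biprod {M N : ModuleCat.{u} A} (hM : isFPModule A M) (hN : isFPModule A N) :
    isFPModule A (M ⊞ N) := by
  have : Module.FinitePresentation A M := hM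
  have : Module.FinitePresentation A N := hN
  refine (isFPModule A).prop_of_iso (ModuleCat.biprodIsoProd M N).symm ?_
  change Module.FinitePresentation A (M × N)
  infer_instance

lemma isFPModule_of_isZero {M : ModuleCat.{u} A} (hM : IsZero M) : isFPModule A M :=
  (isFPModule A).prop_of_isZero hM

/-- Bounded complexes of finitely presented modules. -/
def IsBoundedFP (K : CochainComplex (ModuleCat.{u} A) ℤ) : Prop :=
  (∃ a b : ℤ, K.IsStrictlyGE a ∧ K.IsStrictlyLE b) ∧ ∀ n, isFPModule A (K.X n)

lemma IsBoundedFP.mappingCone {K L : CochainComplex (ModuleCat.{u} A) ℤ} (hK : IsBoundedFP K)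
    (hL : IsBoundedFP L) (f : K ⟶ L) : IsBoundedFP (mappingCone f) :=
  ⟨exists_bounds_mappingCone f hK.1 hL.1, fun n => (isFPModule A).prop_of_iso
    (HomologicalComplex.homotopyCofiber.XIsoBiprod f n (n + 1) rfl).symm
      (isFPModule_of_biprod (hK.2 _) (hL.2 _))⟩

lemma IsBoundedFP.shift {K : CochainComplex (ModuleCat.{u} A) ℤ} (hK : IsBoundedFP K) (n : ℤ) :
    IsBoundedFP (K⟦n⟧) := by
  obtain ⟨⟨a, b, _, _⟩, h⟩ := hK
  exact ⟨⟨a - n, b - n, K.isStrictlyGE_shift a n _ (by lia), K.isStrictlyLE_shift b n _ (by lia)⟩,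
    fun i => h (i + n)⟩

variable (A) in
/-- The bounded complexes of finitely presented modules in the homotopy category. -/
def bfp : ObjectProperty (HotMod A) := fun X => IsBoundedFP X.as

lemma bfp_quotient_obj {K : CochainComplex (ModuleCat.{u} A) ℤ} (hK : IsBoundedFP K) :
    bfp A ((HomotopyCategory.quotient _ _).obj K) := hK

instance : (bfp A).ContainsZero where
  exists_zero := ⟨(HomotopyCategory.quotient _ _).obj 0, Functor.map_isZero _ (isZero_zero _),
    bfp_quotient_obj ⟨⟨0, 0, inferInstance, inferInstance⟩, fun n => isFPModule_of_isZero
      (Functor.map_isZero (HomologicalComplex.eval _ _ n) (isZero_zero _))⟩⟩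

instance : (bfp A).IsStableUnderShift ℤ where
  isStableUnderShiftBy n :=
    { le_shift X hX := by
        obtain ⟨K, rfl⟩ := X.quotient_obj_surjective
        rw [ObjectProperty.prop_shift_iff, HomotopyCategory.shift_quotient_obj]
        exact bfp_quotient_obj (IsBoundedFP.shift hX n) }

/-- `bfp` constrains the actual terms and is not closed under isomorphisms, so the third vertex is
only isomorphic to a member, namely the cone of a chain map representing the first morphism. -/
instance : (bfp A).IsTriangulatedClosed₃ where
  ext₃' T hT h₁ h₂ := by
    obtain ⟨f : T.obj₁.as ⟶ T.obj₂.as, hf⟩ := (HomotopyCategory.quotient _ _).map_surjective T.mor₁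
    refine ⟨_, bfp_quotient_obj (IsBoundedFP.mappingCone h₁ h₂ f),
      ⟨Triangle.π₃.mapIso (isoTriangleOfIso₁₂ T _ hT
        (HomotopyCategory.mappingCone_triangleh_distinguished f)
        (Iso.refl _) (Iso.refl _) ?_)⟩⟩
    exact (Category.comp_id _).trans (hf.symm.trans (Category.id_comp _).symm)

instance : (bfp A).IsTriangulated where
  toIsTriangulatedClosed₂ := .of_isTriangulatedClosed₃

end BoundedFinitelyPresented

section FinitelySupportedMap

lemma IsFinitelySupported.map {T T' : Type*} [Category* T] [Category* T'] [Preadditive T]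
    [Preadditive T'] (G : T ⥤ T') [G.Additive] {ι : Type*} {Y : ι → T} [HasCoproduct Y]
    [HasCoproduct fun i => G.obj (Y i)] [PreservesColimit (Discrete.functor Y) G] {X : T}
    {f : X ⟶ ∐ Y} (hf : IsFinitelySupported f) :
    IsFinitelySupported (G.map f ≫ (PreservesCoproduct.iso G Y).hom) := by
  classical
  obtain ⟨J, hJ⟩ := hf
  have h : G.map f ≫ (PreservesCoproduct.iso G Y).hom = ∑ j ∈ J, (G.map (f ≫ Sigma.π Y j)) ≫
      Sigma.ι (fun i => G.obj (Y i)) j := by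
    rw [← cancel_mono (PreservesCoproduct.iso G Y).inv, Category.assoc, Iso.hom_inv_id,
      Category.comp_id, Preadditive.sum_comp]
    conv_lhs => rw [hJ, G.map_sum]
    refine Finset.sum_congr rfl fun j _ => ?_
    rw [Category.assoc, PreservesCoproduct.inv_hom, ι_comp_sigmaComparison, ← G.map_comp,
      Category.assoc]
  rw [h]
  exact Finset.sum_induction _ IsFinitelySupported (fun _ _ => .add) .zero fun j _ => .comp_ι _

end FinitelySupportedMap

section BoundedFPCompact

variable {A : Type u} [Ring A] {ι : Type u}

/-- In each of the finitely many nonzero degrees, the images of finitely many generators involve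
only finitely many summands. -/
lemma IsBoundedFP.isFinitelySupported {F : CochainComplex (ModuleCat.{u} A) ℤ}
    (hF : IsBoundedFP F) {K : ι → CochainComplex (ModuleCat.{u} A) ℤ} (f : F ⟶ ∐ K) :
    IsFinitelySupported f := by
  classical
  obtain ⟨⟨a, b, _, _⟩, hfp⟩ := hF
  have key (n : ℤ) : ∃ J : Finset ι, ∀ J', J ⊆ J' → ∀ x : F.X n,
      f.f n x = ∑ j ∈ J', (Sigma.ι K j).f n ((Sigma.π K j).f n (f.f n x)) := by
    have : Module.FinitePresentation A (F.X n) := hfp n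
    obtain ⟨S, hS⟩ := (Module.Finite.fg_top : (⊤ : Submodule A (F.X n)).FG)
    choose J hJ using fun x : F.X n => exists_eq_sum_of_sigma K n (f.f n x)
    refine ⟨S.biUnion J, fun J' hJ' x => ?_⟩
    have hx : x ∈ Submodule.span A (S : Set (F.X n)) := hS ▸ Submodule.mem_top
    induction hx using Submodule.span_induction with
    | mem x hx => exact hJ x _ ((Finset.subset_biUnion_of_mem J hx).trans hJ')
    | zero => simp
    | add x y _ _ hx hy =>
      simp only [map_add, Finset.sum_add_distrib]
      rw [← hx, ← hy]
    | smul r x _ hx =>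
      simp only [map_smul, ← Finset.smul_sum]
      rw [← hx]
  choose J hJ using key
  refine ⟨(Finset.Icc a b).biUnion J, ?_⟩
  ext n x
  by_cases hn : n ∈ Finset.Icc a b
  · refine (hJ n _ (Finset.subset_biUnion_of_mem J hn) x).trans ?_
    have h := map_sum (HomologicalComplex.Hom.fAddMonoidHom (C₁ := F) (C₂ := ∐ K) n)
      (fun j => f ≫ Sigma.π K j ≫ Sigma.ι K j) ((Finset.Icc a b).biUnion J)
    have h' := congr(ModuleCat.Hom.hom $h x)
    rw [ModuleCat.hom_sum, LinearMap.sum_apply] at h'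
    exact h'.symm
  · have : IsZero (F.X n) := by
      rw [Finset.mem_Icc, not_and_or, not_le, not_le] at hn
      exact hn.elim (fun h => F.isZero_of_isStrictlyGE a n h) fun h => F.isZero_of_isStrictlyLE b n h
    have := ModuleCat.subsingleton_of_isZero this
    rw [Subsingleton.elim x 0, map_zero, map_zero]

lemma IsBoundedFP.isFinitelySupported_quotient {F : CochainComplex (ModuleCat.{u} A) ℤ}
    (hF : IsBoundedFP F) {K : ι → CochainComplex (ModuleCat.{u} A) ℤ}
    (f : (HomotopyCategory.quotient _ _).obj F ⟶
      ∐ fun i => (HomotopyCategory.quotient _ _).obj (K i)) :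
    IsFinitelySupported f := by
  let q := HomotopyCategory.quotient (ModuleCat.{u} A) (ComplexShape.up ℤ)
  obtain ⟨g, hg⟩ := q.map_surjective (f ≫ (PreservesCoproduct.iso q K).inv)
  have h := (hF.isFinitelySupported g).map q
  rw [hg, Category.assoc, Iso.inv_hom_id, Category.comp_id] at h
  exact h

lemma bfp.isFinitelySupported {F : HotMod A} (hF : bfp A F) {X : ι → HotMod A} (f : F ⟶ ∐ X) :
    IsFinitelySupported f :=
  IsBoundedFP.isFinitelySupported_quotient (K := fun i => (X i).as) hF f

end BoundedFPCompact

/-! ### Killing morphisms from bounded finitely presented complexes to coacyclic ones -/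

section VerdierLocalizing

open CochainComplex HomComplex

variable {A : Type u} [Ring A]

/-- The last clause keeps complexes built from these covers bounded. -/
lemma exists_projective_cover {M : ModuleCat.{u} A} (hM : isFPModule A M) :
    ∃ (Q : ModuleCat.{u} A) (e : Q ⟶ M), isFPModule A Q ∧ Projective Q ∧ Epi e ∧
      (IsZero M → IsZero Q) := by
  by_cases h : IsZero M
  · exact ⟨M, 𝟙 M, hM, Projective.of_iso h.isoZero.symm inferInstance , inferInstance, id⟩
  have : Module.FinitePresentation A M := hM
  obtain ⟨n, f, hf⟩ := Module.Finite.exists_fin' A M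
  refine ⟨ModuleCat.of A (Fin n → A), ModuleCat.ofHom f, ?_, ?_, ?_, fun h' => (h h').elim⟩
  · change Module.FinitePresentation A (Fin n → A)
    infer_instance
  · exact ModuleCat.projective_of_free (Pi.basisFun A (Fin n))
  · rwa [ModuleCat.epi_iff_surjective]

/-- `P` is a sum of disks, one for each covered term of `F`: the cone of the identity of a complex
`G` with zero differential and the cover of `F.X (n - 1)` in degree `n`. -/
lemma IsBoundedFP.exists_epi {F : CochainComplex (ModuleCat.{u} A) ℤ} (hF : IsBoundedFP F) :
    ∃ (P : CochainComplex (ModuleCat.{u} A) ℤ) (p : P ⟶ F), IsBoundedFP P ∧ Epi p ∧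
      ∀ n, Projective (P.X n) := by
  choose Q e hQ hQ' he hQ0 using fun n => exists_projective_cover (hF.2 n)
  let G : CochainComplex (ModuleCat.{u} A) ℤ := { X n := Q (n - 1), d _ _ := 0 }
  have hGproj (n : ℤ) : Projective (G.X n) := hQ' (n - 1)
  have hG : IsBoundedFP G := by
    obtain ⟨⟨a, b, _, _⟩, -⟩ := hF
    refine ⟨⟨a + 1, b + 1, ?_, ?_⟩, fun n => hQ (n - 1)⟩
    · rw [isStrictlyGE_iff]
      exact fun i hi => hQ0 _ (F.isZero_of_isStrictlyGE a _ (by lia))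
    · rw [isStrictlyLE_iff]
      exact fun i hi => hQ0 _ (F.isZero_of_isStrictlyLE b _ (by lia))
  let α : Cochain G F (-1) := Cochain.mk fun p q hpq => e (p - 1) ≫ eqToHom (by congr 1)
  refine ⟨CochainComplex.mappingCone (𝟙 G), coneIdDesc α, hG.mappingCone hG _, ?_, fun n => ?_⟩
  · refine HomologicalComplex.epi_of_epi_f _ fun q => ?_
    have h : Epi (α.v (q + 1) q (by lia)) := by
      dsimp only [α, Cochain.mk_v]
      infer_instance
    exact epi_of_epi_fac (inl_v_coneIdDesc_f α (q + 1) q _)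
  · exact Projective.of_iso (HomologicalComplex.homotopyCofiber.XIsoBiprod (𝟙 G) n (n + 1) rfl).symm
      inferInstance

variable [IsLeftCoherentRing A]

/-- `F'` is the cone of `ker p ⟶ P`, with `p : P ⟶ F` as in `IsBoundedFP.exists_epi`; coherence
makes the kernel finitely presented. The cone of `F' ⟶ F` is the totalization of `ker p ⟶ P ⟶ F`, so
it is coacyclic. On `F'` the component of `f` in `S.X₃` factors through `P`, whose projective terms
allow it to be lifted to `S.X₂`. -/
lemma exists_bfp_coacyclic_trW_totalization {F : CochainComplex (ModuleCat.{u} A) ℤ}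
    (hF : IsBoundedFP F) (S : ShortComplex (CochainComplex (ModuleCat.{u} A) ℤ))
    (hS : S.ShortExact) (f : F ⟶ totalization S) :
    ∃ (F' : CochainComplex (ModuleCat.{u} A) ℤ) (s : F' ⟶ F), IsBoundedFP F' ∧
      (bfp A ⊓ coacyclic A).trW ((HomotopyCategory.quotient _ _).map s) ∧
      (HomotopyCategory.quotient _ _).map (s ≫ f) = 0 := by
  obtain ⟨P, p, hP, hp, hproj⟩ := hF.exists_epi
  let S' := ShortComplex.mk (kernel.ι p) p (kernel.condition p)
  have hS' : S'.ShortExact :=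
    { exact := ShortComplex.exact_of_f_is_kernel S' (kernelIsKernel p)
      mono_f := inferInstanceAs (Mono (kernel.ι p))
      epi_g := hp }
  have hK : IsBoundedFP (kernel p) := by
    obtain ⟨⟨a, b, _, _⟩, hfp⟩ := hP
    have hmono (i : ℤ) : Mono ((kernel.ι p).f i) := inferInstance
    refine ⟨⟨a, b, ?_, ?_⟩, fun n => ?_⟩
    · rw [isStrictlyGE_iff]
      exact fun i hi => IsZero.of_mono ((kernel.ι p).f i) (P.isZero_of_isStrictlyGE a _ hi)
    · rw [isStrictlyLE_iff]
      exact fun i hi => IsZero.of_mono ((kernel.ι p).f i) (P.isZero_of_isStrictlyLE b _ hi)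
    · exact (isFPModule A).prop_of_iso
        (PreservesKernel.iso (HomologicalComplex.eval _ _ n) p).symm
        ((isFPModule A).prop_kernel _ (hfp n) (hF.2 n))
  refine ⟨mappingCone (kernel.ι p), mappingCone.descShortComplex S', hK.mappingCone hP _, ?_, ?_⟩
  · exact ObjectProperty.trW.mk _ (HomotopyCategory.mappingCone_triangleh_distinguished
      (mappingCone.descShortComplex S')) ⟨bfp_quotient_obj ((hK.mappingCone hP _).mappingCone hF _),
        coacyclic.totalization S' hS'⟩
  · rw [HomotopyCategory.quotient_map_eq_zero_iff]
    have := hS.epi_g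
    let g : F ⟶ mappingCone (mappingCone.descShortComplex S) := f
    -- The lifts are chosen degree by degree and need not commute with the differentials;
    -- `nonempty_homotopy_zero_of_lift` does not require it.
    let l₀ : Cochain P S.X₂ 0 := Cochain.ofHoms fun n =>
      Projective.factorThru (p.f n ≫ g.f n ≫ (mappingCone.snd _).v n n (add_zero n)) (S.g.f n)
    have hl₀ : l₀.comp (Cochain.ofHom S.g) (add_zero 0) =
      (Cochain.ofHom (p ≫ g)).comp (mappingCone.snd _) (add_zero 0) := by
      ext n
      simp [l₀]
    refine nonempty_homotopy_zero_of_lift hS (mappingCone.descShortComplex S' ≫ g)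
      ((mappingCone.snd _).comp l₀ (add_zero 0)) ?_
    rw [Cochain.comp_assoc_of_second_is_zero_cochain, hl₀, Cochain.ofHom_comp, Cochain.ofHom_comp,
      ofHom_descShortComplex]
    simp only [Cochain.comp_assoc_of_second_is_zero_cochain]
    rfl

variable (A) in
/-- The complexes `C` such that every morphism from a bounded complex of finitely presented modules
to `C` is annihilated by a morphism whose cone is a coacyclic bounded complex of finitely
presented modules. -/
def annihilatesBFP : ObjectProperty (HotMod A) := fun C =>
  ∀ ⦃F : HotMod A⦄ (_ : bfp A F) (f : F ⟶ C), ∃ (F' : HotMod A) (s : F' ⟶ F), bfp A F' ∧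
    (bfp A ⊓ coacyclic A).trW s ∧ s ≫ f = 0

omit [IsLeftCoherentRing A] in
lemma exists_comp_eq_zero_of_finset {ι : Type*} {X : ι → HotMod A}
    (hX : ∀ i, annihilatesBFP A (X i)) {F : HotMod A} (hF : bfp A F) (f : ∀ i, F ⟶ X i)
    (J : Finset ι) : ∃ (F' : HotMod A) (s : F' ⟶ F), bfp A F' ∧
      (bfp A ⊓ coacyclic A).trW s ∧ ∀ j ∈ J, s ≫ f j = 0 := by
  classical
  induction J using Finset.induction_on with
  | empty => exact ⟨F, 𝟙 F, hF, MorphismProperty.id_mem _ _, by simp⟩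
  | insert i J _ ih =>
    obtain ⟨F', s, hF', hs, h⟩ := ih
    obtain ⟨F'', s', hF'', hs', h'⟩ := hX i hF' (s ≫ f i)
    refine ⟨F'', s' ≫ s, hF'', MorphismProperty.comp_mem _ _ _ hs' hs, fun j hj => ?_⟩
    rw [Category.assoc]
    rcases Finset.mem_insert.1 hj with rfl | hj
    · exact h'
    · rw [h j hj, comp_zero]

/-- For an extension, first kill the image in the third vertex, then factor through the first vertex
and kill again. For a coproduct, only finitely many components of `f` matter, and they are killed
one after another. -/
lemma coacyclic_le_annihilatesBFP : coacyclic A ≤ annihilatesBFP A := by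
  intro C hC
  induction hC with
  | totalization S hS =>
    intro F hF f
    obtain ⟨F, rfl⟩ := F.quotient_obj_surjective
    obtain ⟨f, rfl⟩ := (HomotopyCategory.quotient _ _).map_surjective f
    obtain ⟨F', s, hF', hs, h⟩ := exists_bfp_coacyclic_trW_totalization (F := F) hF S hS f
    exact ⟨_, (HomotopyCategory.quotient _ _).map s, hF', hs, by rw [← Functor.map_comp, h]⟩
  | @iso X Y e _ ih =>
    intro F hF f
    obtain ⟨F', s, hF', hs, h⟩ := ih hF (f ≫ e.inv)
    exact ⟨F', s, hF', hs, by rw [← cancel_mono e.inv, Category.assoc, h, zero_comp]⟩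
  | @shift X n _ ih =>
    intro F hF f
    obtain ⟨g, hg⟩ := (CategoryTheory.shiftFunctor (HotMod A) n).map_surjective ((shiftNegShift F n).hom ≫ f)
    obtain ⟨F', s, hF', hs, h⟩ := ih ((bfp A).le_shift (-n) _ hF) g
    refine ⟨F'⟦n⟧, s⟦n⟧' ≫ (shiftNegShift F n).hom, (bfp A).le_shift n _ hF', ?_, ?_⟩
    · exact (MorphismProperty.cancel_right_of_respectsIso _ _ _).2 (ObjectProperty.trW.shift hs n)
    · rw [Category.assoc, ← hg, ← Functor.map_comp, h, Functor.map_zero]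
  | ext T hT _ _ ih₁ ih₃ =>
    intro F hF f
    obtain ⟨F', s, hF', hs, h⟩ := ih₃ hF (f ≫ T.mor₂)
    obtain ⟨g, hg⟩ := Triangle.coyoneda_exact₂ T hT (s ≫ f) (by rw [Category.assoc, h])
    obtain ⟨F'', s', hF'', hs', h'⟩ := ih₁ hF' g
    exact ⟨F'', s' ≫ s, hF'', MorphismProperty.comp_mem _ _ _ hs' hs, by
      rw [Category.assoc, hg, reassoc_of% h', zero_comp]⟩
  | @coproduct ι X c hc _ ih =>
    classical
    intro F hF f
    let e : c.pt ≅ ∐ X := hc.coconePointUniqueUpToIso (coproductIsCoproduct X)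
    obtain ⟨J, hJ⟩ := hF.isFinitelySupported (f ≫ e.hom)
    obtain ⟨F', s, hF', hs, h⟩ := exists_comp_eq_zero_of_finset ih hF
      (fun i => (f ≫ e.hom) ≫ Sigma.π X i) J
    refine ⟨F', s, hF', hs, ?_⟩
    rw [← cancel_mono e.hom, zero_comp, Category.assoc, hJ, Preadditive.comp_sum]
    refine Finset.sum_eq_zero fun j hj => ?_
    simpa using h j hj =≫ Sigma.ι X j

/-- A morphism killed by `s` factors through the cone of `s`, which is both bounded finitely
presented and coacyclic. -/
instance : (bfp A).IsVerdierLeftLocalizing (coacyclic A) where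
  fac f hX hY := by
    obtain ⟨F', s, hF', ⟨Z, a, b, hT, hZ⟩, h⟩ := coacyclic_le_annihilatesBFP _ hY hX f
    obtain ⟨g, hg⟩ := Triangle.yoneda_exact₂ _ hT f h
    exact ⟨Z, a, g, hZ.1, hZ.2, hg.symm⟩

end VerdierLocalizing

/-! ### Fractions out of bounded finitely presented complexes, and compactness -/

section Fractions

variable {A : Type u} [Ring A] [IsLeftCoherentRing A]

lemma exists_rightFraction_of_bfp {F X : HotMod A} (hF : bfp A F)
    (φ : (coacyclic A).trW.Q.obj F ⟶ (coacyclic A).trW.Q.obj X) :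
    ∃ (F' : HotMod A) (s : F' ⟶ F) (f : F' ⟶ X), bfp A F' ∧ (bfp A ⊓ coacyclic A).trW s ∧
      (coacyclic A).trW.Q.map s ≫ φ = (coacyclic A).trW.Q.map f := by
  obtain ⟨ρ, hρ⟩ := Localization.exists_rightFraction (coacyclic A).trW.Q (coacyclic A).trW φ
  obtain ⟨F', s, a, hF', hs, fac⟩ :=
    ObjectProperty.IsVerdierLeftLocalizing.fac' (A := bfp A) ρ.s hF ρ.hs
  refine ⟨F', s, a ≫ ρ.f, hF', hs, ?_⟩
  rw [hρ, ← fac, Functor.map_comp, Functor.map_comp, Category.assoc,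
    MorphismProperty.RightFraction.map_s_comp_map]

lemma exists_comp_eq_zero_of_bfp {F X : HotMod A} (hF : bfp A F) (f : F ⟶ X)
    (hf : (coacyclic A).trW.Q.map f = 0) :
    ∃ (F' : HotMod A) (s : F' ⟶ F), bfp A F' ∧ (bfp A ⊓ coacyclic A).trW s ∧ s ≫ f = 0 := by
  rw [← (coacyclic A).trW.Q.map_zero,
    MorphismProperty.map_eq_iff_precomp (coacyclic A).trW.Q (coacyclic A).trW] at hf
  obtain ⟨Z, s, hs, h⟩ := hf
  obtain ⟨F', s', a, hF', hs', fac⟩ :=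
    ObjectProperty.IsVerdierLeftLocalizing.fac' (A := bfp A) s hF hs
  exact ⟨F', s', hF', hs', by rw [← fac, Category.assoc, h, comp_zero, comp_zero]⟩

omit [IsLeftCoherentRing A] in
lemma isIso_Q_map_of_trW_inf {X Y : HotMod A} {s : X ⟶ Y} (hs : (bfp A ⊓ coacyclic A).trW s) :
    IsIso ((coacyclic A).trW.Q.map s) :=
  Localization.inverts (coacyclic A).trW.Q (coacyclic A).trW _
    (ObjectProperty.trW_monotone inf_le_right _ hs)

/-- The numerator of a fraction with source in `bfp` has finite support already in the homotopy
category. -/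
lemma bfp.isFinitelySupported_Q {ι : Type u} {F : HotMod A} (hF : bfp A F)
    {X : ι → HotMod A} (φ : (coacyclic A).trW.Q.obj F ⟶ ∐ fun i => (coacyclic A).trW.Q.obj (X i)) :
    IsFinitelySupported φ := by
  let L := (coacyclic A).trW.Q
  obtain ⟨F', s, f, hF', hs, h⟩ := exists_rightFraction_of_bfp hF
    (φ ≫ (PreservesCoproduct.iso L X).inv)
  have := isIso_Q_map_of_trW_inf hs
  have h' := ((hF'.isFinitelySupported f).map L).precomp (inv ((coacyclic A).trW.Q.map s))
  rw [← h, Category.assoc, Category.assoc, Iso.inv_hom_id, Category.comp_id] at h'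
  simpa only [IsIso.inv_hom_id_assoc] using h'

lemma bfp.isCompactObj {F : HotMod A} (hF : bfp A F) :
    IsCompactObj.{u} ((coacyclic A).trW.Q.obj F) := by
  refine isCompactObj_of_isFinitelySupported fun {ι} Y f => ?_
  let L := (coacyclic A).trW.Q
  have : L.EssSurj := Localization.essSurj L (coacyclic A).trW
  let e (i : ι) : L.obj (L.objPreimage (Y i)) ≅ Y i := L.objObjPreimageIso (Y i)
  have h := (hF.isFinitelySupported_Q (f ≫ Limits.Sigma.map fun i => (e i).inv)).comp_map
    (Limits.Sigma.map fun i => (e i).hom) fun i => by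
      rw [Limits.Sigma.ι_map]
      exact .comp_ι _
  have h' : (Limits.Sigma.map fun i => (e i).inv) ≫ (Limits.Sigma.map fun i => (e i).hom) =
      𝟙 (∐ Y) := by
    ext i
    simp
  rwa [Category.assoc, h', Category.comp_id] at h

end Fractions

/-! ### Comparing two functors with common fractions -/

section ExtensionAlongFractions

variable {C D₁ D₂ : Type*} [Category* C] [Category* D₁] [Category* D₂]

/-- Two morphisms `φ` and `ψ` correspond to each other if they are represented by the
same right fraction. -/
def FractionRel (L₁ : C ⥤ D₁) (L₂ : C ⥤ D₂) {X Y : C} (φ : L₁.obj X ⟶ L₁.obj Y)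
    (ψ : L₂.obj X ⟶ L₂.obj Y) : Prop :=
  ∃ (Z : C) (s : Z ⟶ X) (f : Z ⟶ Y), IsIso (L₁.map s) ∧ IsIso (L₂.map s) ∧
    L₁.map s ≫ φ = L₁.map f ∧ L₂.map s ≫ ψ = L₂.map f

/-- Any morphism between objects in the image of `L₁` is represented by a fraction whose
denominator is inverted both by `L₁` and `L₂`. -/
def HasFractions (L₁ : C ⥤ D₁) (L₂ : C ⥤ D₂) : Prop :=
  ∀ ⦃X Y : C⦄ (φ : L₁.obj X ⟶ L₁.obj Y), ∃ (Z : C) (s : Z ⟶ X) (f : Z ⟶ Y),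
    IsIso (L₁.map s) ∧ IsIso (L₂.map s) ∧ L₁.map s ≫ φ = L₁.map f

variable {L₁ : C ⥤ D₁} {L₂ : C ⥤ D₂}

namespace FractionRel

lemma symm {X Y : C} {φ : L₁.obj X ⟶ L₁.obj Y} {ψ : L₂.obj X ⟶ L₂.obj Y}
    (h : FractionRel L₁ L₂ φ ψ) : FractionRel L₂ L₁ ψ φ := by
  obtain ⟨Z, s, f, h₁, h₂, h₃, h₄⟩ := h
  exact ⟨Z, s, f, h₂, h₁, h₄, h₃⟩

lemma of_map {X Y : C} (f : X ⟶ Y) : FractionRel L₁ L₂ (L₁.map f) (L₂.map f) :=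
  ⟨X, 𝟙 X, f, inferInstance, inferInstance, by simp, by simp⟩

lemma exists_of_hasFractions (h : HasFractions L₁ L₂) {X Y : C} (φ : L₁.obj X ⟶ L₁.obj Y) :
    ∃ ψ, FractionRel L₁ L₂ φ ψ := by
  obtain ⟨Z, s, f, h₁, h₂, h₃⟩ := h φ
  exact ⟨inv (L₂.map s) ≫ L₂.map f, Z, s, f, h₁, h₂, h₃, by simp⟩

variable (hL : HasFractions L₁ L₂)
  (heq : ∀ ⦃X Y : C⦄ (f g : X ⟶ Y), L₁.map f = L₁.map g → L₂.map f = L₂.map g)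

include hL heq

/-- The two denominators acquire a common refinement by writing `L₁.map s ≫ inv (L₁.map s')` as a
fraction; `heq` then transports the resulting equalities to `L₂`. -/
lemma unique {X Y : C} {φ : L₁.obj X ⟶ L₁.obj Y} {ψ ψ' : L₂.obj X ⟶ L₂.obj Y}
    (h : FractionRel L₁ L₂ φ ψ) (h' : FractionRel L₁ L₂ φ ψ') : ψ = ψ' := by
  obtain ⟨Z, s, f, hs₁, hs₂, hf₁, hf₂⟩ := h
  obtain ⟨Z', s', f', hs₁', hs₂', hf₁', hf₂'⟩ := h'
  obtain ⟨T, t, t', ht₁, ht₂, ht⟩ := hL (L₁.map s ≫ inv (L₁.map s'))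
  have e₁ : L₁.map (t ≫ s) = L₁.map (t' ≫ s') := by
    simp [← ht]
  have e₂ : L₁.map (t ≫ f) = L₁.map (t' ≫ f') := by
    simp [← ht, ← hf₁', ← hf₁]
  have e₃ := heq _ _ e₁
  have e₄ := heq _ _ e₂
  rw [← cancel_epi (L₂.map s), ← cancel_epi (L₂.map t), hf₂, ← Functor.map_comp, e₄,
    Functor.map_comp, ← hf₂', ← Functor.map_comp_assoc, ← e₃, Functor.map_comp_assoc]

lemma comp {X Y V : C} {φ : L₁.obj X ⟶ L₁.obj Y} {ψ : L₂.obj X ⟶ L₂.obj Y}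
    {φ' : L₁.obj Y ⟶ L₁.obj V} {ψ' : L₂.obj Y ⟶ L₂.obj V}
    (h : FractionRel L₁ L₂ φ ψ) (h' : FractionRel L₁ L₂ φ' ψ') :
    FractionRel L₁ L₂ (φ ≫ φ') (ψ ≫ ψ') := by
  obtain ⟨Z, s, f, hs₁, hs₂, hf₁, hf₂⟩ := h
  obtain ⟨Z', s', f', hs₁', hs₂', hf₁', hf₂'⟩ := h'
  obtain ⟨T, t, t', ht₁, ht₂, ht⟩ := hL (L₁.map f ≫ inv (L₁.map s'))
  have e₁ : L₁.map (t ≫ f) = L₁.map (t' ≫ s') := by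
    simp [← ht]
  have e₃ := heq _ _ e₁
  simp only [Functor.map_comp] at e₁ e₃
  refine ⟨T, t ≫ s, t' ≫ f', ?_, ?_, ?_, ?_⟩
  · rw [Functor.map_comp]; infer_instance
  · rw [Functor.map_comp]; infer_instance
  · simp [reassoc_of% hf₁, reassoc_of% e₁, hf₁']
  · simp [reassoc_of% hf₂, reassoc_of% e₃, hf₂']

end FractionRel

/-- `FractionRel` is the graph of a bijection on Hom groups compatible with composition. It defines
a functor on the category with the objects of `C` and the morphisms of `D₁`, which is equivalent to
`D₁` by essential surjectivity. -/
lemma exists_fullyFaithful_of_hasFractions [L₁.EssSurj] (h₁ : HasFractions L₁ L₂)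
    (h₂ : HasFractions L₂ L₁)
    (heq : ∀ ⦃X Y : C⦄ (f g : X ⟶ Y), L₁.map f = L₁.map g ↔ L₂.map f = L₂.map g) :
    ∃ F : D₁ ⥤ D₂, Nonempty (L₁ ⋙ F ≅ L₂) ∧ F.Full ∧ F.Faithful := by
  have heq₁ : ∀ ⦃X Y : C⦄ (f g : X ⟶ Y), L₁.map f = L₁.map g → L₂.map f = L₂.map g :=
    fun _ _ f g => (heq f g).1
  have heq₂ : ∀ ⦃X Y : C⦄ (f g : X ⟶ Y), L₂.map f = L₂.map g → L₁.map f = L₁.map g :=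
    fun _ _ f g => (heq f g).2
  choose m hm using fun (X Y : C) (φ : L₁.obj X ⟶ L₁.obj Y) =>
    FractionRel.exists_of_hasFractions h₁ φ
  have hm_map {X Y : C} (f : X ⟶ Y) : m _ _ (L₁.map f) = L₂.map f :=
    (hm _ _ _).unique h₁ heq₁ (.of_map f)
  let G : InducedCategory D₁ L₁.obj ⥤ D₂ :=
    { obj X := L₂.obj X
      map φ := m _ _ φ.hom
      map_id X := by
        have := hm_map (@CategoryStruct.id C _ X)
        rw [L₁.map_id, L₂.map_id] at this
        exact this
      map_comp φ φ' := (hm _ _ _).unique h₁ heq₁ ((hm _ _ _).comp h₁ heq₁ (hm _ _ _)) }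
  let L₁' : C ⥤ InducedCategory D₁ L₁.obj :=
    { obj X := X
      map f := InducedCategory.homMk (L₁.map f) }
  have hfull : G.Full := ⟨fun {X Y} ψ => by
    obtain ⟨φ, hφ⟩ := FractionRel.exists_of_hasFractions h₂ ψ
    exact ⟨InducedCategory.homMk φ, (hm _ _ _).unique h₁ heq₁ hφ.symm⟩⟩
  have hfaith : G.Faithful := ⟨fun {X Y} φ φ' h => by
    have h' : m _ _ φ.hom = m _ _ φ'.hom := h
    have h3 := hm _ _ φ'.hom
    rw [← h'] at h3
    exact InducedCategory.Hom.ext ((hm _ _ φ.hom).symm.unique h₂ heq₂ h3.symm)⟩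
  have hess : (inducedFunctor L₁.obj).EssSurj :=
    ⟨fun Y => ⟨L₁.objPreimage Y, ⟨L₁.objObjPreimageIso Y⟩⟩⟩
  have : (inducedFunctor L₁.obj).IsEquivalence := {}
  let E := (inducedFunctor L₁.obj).asEquivalence
  refine ⟨E.inverse ⋙ G, ⟨?_⟩, inferInstance, inferInstance⟩
  let e₁ : L₁' ⋙ E.functor ≅ L₁ := NatIso.ofComponents (fun X => Iso.refl _)
    fun f => (Category.comp_id (L₁.map f)).trans (Category.id_comp _).symm
  let e₂ : L₁' ⋙ G ≅ L₂ := NatIso.ofComponents (fun X => Iso.refl _)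
    fun f => (Category.comp_id _).trans ((hm_map f).trans (Category.id_comp _).symm)
  exact Functor.isoWhiskerRight e₁.symm _ ≪≫ Functor.isoWhiskerLeft L₁' (
    (Functor.associator _ _ _).symm ≪≫ Functor.isoWhiskerRight E.unitIso.symm G ≪≫ G.leftUnitor) ≪≫ e₂

end ExtensionAlongFractions

section HomotopyReflection

variable {V W : Type*} [Category* V] [Category* W] [Preadditive V] [Preadditive W]

lemma nonempty_homotopy_zero_of_map (F : V ⥤ W) [F.Additive] [F.Full] [F.Faithful] {ι : Type*}
    {c : ComplexShape ι} {K L : HomologicalComplex V c} {f : K ⟶ L}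
    (h : Homotopy ((F.mapHomologicalComplex c).map f) 0) : Nonempty (Homotopy f 0) := by
  choose k hk using fun i j => F.map_surjective (show F.obj (K.X i) ⟶ F.obj (L.X j) from h.hom i j)
  refine ⟨{ hom := k, zero i j hij := ?_, comm i := ?_ }⟩
  · exact F.map_injective ((hk i j).trans ((h.zero i j hij).trans (F.map_zero _ _).symm))
  · apply F.map_injective
    have := h.comm i
    simp only [dNext, prevD, AddMonoidHom.mk'_apply] at this ⊢
    simp only [F.map_add, F.map_comp, hk]
    simp only [HomologicalComplex.zero_f, add_zero, F.map_zero] at this ⊢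
    exact this

end HomotopyReflection

/-! ### The embedding of the bounded derived category -/

section ComplexesOfFPModules

variable (A : Type u) [Ring A]

/-- The functor sending a complex of finitely presented modules to the underlying complex of
modules. -/
noncomputable abbrev fpComplexToMod :
    CochainComplex (FPModuleCat A) ℤ ⥤ CochainComplex (ModuleCat.{u} A) ℤ :=
  (isFPModule A).ι.mapHomologicalComplex (ComplexShape.up ℤ)

instance [IsLeftCoherentRing A] : (isFPModule A).ι.PreservesHomology where
  preservesKernels := (isFPModule A).preservesKernels_ι
  preservesCokernels := (isFPModule A).preservesCokernels_ι

variable {A}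

lemma isBoundedFP_fpComplexToMod_obj (K : BoundedFPComplex A) :
    IsBoundedFP ((fpComplexToMod A).obj K.obj) := by
  obtain ⟨K, a, b, _, _⟩ := K
  exact ⟨⟨a, b, inferInstanceAs (HomologicalComplex.IsStrictlySupported _ _),
    inferInstanceAs (HomologicalComplex.IsStrictlySupported _ _)⟩, fun n => (K.X n).property⟩

lemma IsBoundedFP.exists_iso {K : CochainComplex (ModuleCat.{u} A) ℤ} (hK : IsBoundedFP K) :
    ∃ K' : BoundedFPComplex A, Nonempty ((fpComplexToMod A).obj K'.obj ≅ K) := by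
  let K' := K.liftObjectProperty (isFPModule A) hK.2
  let e : (fpComplexToMod A).obj K' ≅ K := HomologicalComplex.Hom.isoOfComponents
    (fun n => Iso.refl _) (fun i j _ => by
      exact (Category.id_comp _).trans (Category.comp_id _).symm)
  obtain ⟨a, b, _, _⟩ := hK.1
  refine ⟨⟨K', a, b, ?_, ?_⟩, ⟨e⟩⟩
  · have : ((fpComplexToMod A).obj K').IsStrictlyGE a :=
      HomologicalComplex.isStrictlySupported_of_iso e.symm _
    exact (K'.isStrictlySupported_mapHomologicalComplex_obj_iff (isFPModule A).ι _).1 this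
  · have : ((fpComplexToMod A).obj K').IsStrictlyLE b :=
      HomologicalComplex.isStrictlySupported_of_iso e.symm _
    exact (K'.isStrictlySupported_mapHomologicalComplex_obj_iff (isFPModule A).ι _).1 this

lemma boundedFP_iff (X : CoderivedCategory A) : boundedFP A X ↔
    ∃ K, IsBoundedFP K ∧ Nonempty ((CoderivedCategory.Q A).obj K ≅ X) := by
  constructor
  · rintro ⟨K, ⟨e⟩⟩
    exact ⟨_, isBoundedFP_fpComplexToMod_obj K, ⟨e⟩⟩
  · rintro ⟨K, hK, ⟨e⟩⟩
    obtain ⟨K', ⟨e'⟩⟩ := hK.exists_iso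
    exact ⟨K', ⟨(CoderivedCategory.Q A).mapIso e' ≪≫ e⟩⟩

variable [IsLeftCoherentRing A]

lemma isCompactObj_of_iso {T : Type*} [Category* T] [Preadditive T] {X Y : T} (e : X ≅ Y)
    (hX : IsCompactObj.{w} X) : IsCompactObj.{w} Y := fun ι => by
  have := hX ι
  exact preservesColimitsOfShape_of_natIso (preadditiveCoyoneda.mapIso e.symm.op)

lemma isCompactObj_of_boundedFP {X : CoderivedCategory A} (hX : boundedFP A X) :
    IsCompactObj.{u} X := by
  rw [boundedFP_iff] at hX
  obtain ⟨K, hK, ⟨e⟩⟩ := hX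
  exact isCompactObj_of_iso e (bfp_quotient_obj hK).isCompactObj

lemma toDerived_map_isIso_iff {K L : BoundedFPComplex A} (f : K ⟶ L) :
    IsIso ((BoundedFPComplex.toDerived A).map f) ↔ QuasiIso f.hom := by
  rw [← DerivedCategory.isIso_Q_map_iff_quasiIso]
  exact (isIso_iff_of_reflects_iso _ DerivedCategory.Bounded.ι).symm

lemma quasiIso_fpComplexToMod_map_iff {K L : CochainComplex (FPModuleCat A) ℤ} (f : K ⟶ L) :
    QuasiIso ((fpComplexToMod A).map f) ↔ QuasiIso f :=
  HomologicalComplex.quasiIso_map_iff_of_preservesHomology f (isFPModule A).ι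

lemma isIso_toCoderived_map {K L : BoundedFPComplex A} (f : K ⟶ L) (hf : QuasiIso f.hom) :
    IsIso ((BoundedFPComplex.toCoderived A).map f) := by
  have := (quasiIso_fpComplexToMod_map_iff f.hom).2 hf
  exact isIso_Q_map_of_quasiIso ((fpComplexToMod A).map f.hom)
    (isBoundedFP_fpComplexToMod_obj K).1 (isBoundedFP_fpComplexToMod_obj L).1

omit [IsLeftCoherentRing A] in
lemma quasiIso_of_trW_coacyclic {K L : CochainComplex (ModuleCat.{u} A) ℤ} (f : K ⟶ L)
    (hf : (coacyclic A).trW ((HomotopyCategory.quotient _ _).map f)) : QuasiIso f := by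
  have h := ObjectProperty.trW_monotone (coacyclic_le_subcategoryAcyclic A) _ hf
  rw [← HomotopyCategory.quasiIso_eq_trW_subcategoryAcyclic] at h
  exact (HomotopyCategory.quotient_map_mem_quasiIso_iff _).1 h

lemma hasFractions_toDerived :
    HasFractions (BoundedFPComplex.toDerived A) (BoundedFPComplex.toCoderived A) := by
  rintro ⟨K, a, b, _, _⟩ ⟨L, a', b', _, _⟩ φ
  -- A single lower bound for source and target lets the denominator be chosen bounded.
  have : K.IsStrictlyGE (min a a') := K.isStrictlyGE_of_ge _ _ (min_le_left a a')
  have : L.IsStrictlyGE (min a a') := L.isStrictlyGE_of_ge _ _ (min_le_right a a')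
  obtain ⟨K', h₁, h₂, s, hs, g, hg⟩ :=
    DerivedCategory.right_fac_of_isStrictlyLE_of_isStrictlyGE (X := K) (Y := L) (min a a') b φ.hom
  have hs' := hs
  rw [DerivedCategory.isIso_Q_map_iff_quasiIso] at hs'
  refine ⟨⟨K', min a a', b, h₁, h₂⟩, ObjectProperty.homMk s, ObjectProperty.homMk g,
    (toDerived_map_isIso_iff _).2 hs', isIso_toCoderived_map _ hs', ?_⟩
  ext
  change DerivedCategory.Q.map s ≫ φ.hom = DerivedCategory.Q.map g
  exact (congr_arg (fun ψ => DerivedCategory.Q.map s ≫ ψ) hg).trans (IsIso.hom_inv_id_assoc _ _)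

lemma exists_fpComplex_of_bfp {K : BoundedFPComplex A} {F : HotMod A} (hF : bfp A F)
    (s : F ⟶ (HomotopyCategory.quotient _ _).obj ((fpComplexToMod A).obj K.obj))
    (hs : (bfp A ⊓ coacyclic A).trW s) :
    ∃ (F' : BoundedFPComplex A) (e : (HomotopyCategory.quotient _ _).obj
      ((fpComplexToMod A).obj F'.obj) ≅ F) (s' : F' ⟶ K),
      (HomotopyCategory.quotient _ _).map ((fpComplexToMod A).map s'.hom) = e.hom ≫ s ∧
      IsIso ((BoundedFPComplex.toDerived A).map s') ∧
      IsIso ((BoundedFPComplex.toCoderived A).map s') := by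
  obtain ⟨F', ⟨e⟩⟩ := IsBoundedFP.exists_iso hF
  let e' := (HomotopyCategory.quotient _ _).mapIso e
  obtain ⟨s₁, hs₁⟩ := (HomotopyCategory.quotient _ _).map_surjective (e'.hom ≫ s)
  obtain ⟨s₂, rfl⟩ := (fpComplexToMod A).map_surjective s₁
  have hs₂ : QuasiIso s₂ := by
    rw [← quasiIso_fpComplexToMod_map_iff]
    apply quasiIso_of_trW_coacyclic
    rw [hs₁]
    exact (MorphismProperty.cancel_left_of_respectsIso _ _ _).2
      (ObjectProperty.trW_monotone inf_le_right _ hs)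
  exact ⟨F', e', ObjectProperty.homMk s₂, hs₁, (toDerived_map_isIso_iff _).2 hs₂,
    isIso_toCoderived_map _ hs₂⟩

lemma exists_fraction_coderived (K L : BoundedFPComplex A)
    (φ : (CoderivedCategory.Q A).obj ((fpComplexToMod A).obj K.obj) ⟶
      (CoderivedCategory.Q A).obj ((fpComplexToMod A).obj L.obj)) :
    ∃ (F : BoundedFPComplex A) (s : F ⟶ K) (f : F ⟶ L),
      IsIso ((BoundedFPComplex.toCoderived A).map s) ∧
      IsIso ((BoundedFPComplex.toDerived A).map s) ∧
      (CoderivedCategory.Q A).map ((fpComplexToMod A).map s.hom) ≫ φ =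
        (CoderivedCategory.Q A).map ((fpComplexToMod A).map f.hom) := by
  obtain ⟨F, s, f, hF, hs, h⟩ := exists_rightFraction_of_bfp
    (bfp_quotient_obj (isBoundedFP_fpComplexToMod_obj K)) φ
  obtain ⟨F', e, s', hs', h₁, h₂⟩ := exists_fpComplex_of_bfp hF s hs
  obtain ⟨f₁, hf₁⟩ := (HomotopyCategory.quotient _ _).map_surjective (e.hom ≫ f)
  obtain ⟨f₂, rfl⟩ := (fpComplexToMod A).map_surjective f₁
  refine ⟨F', s', ObjectProperty.homMk f₂, h₂, h₁, ?_⟩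
  rw [Functor.comp_map, hs', Functor.map_comp, Category.assoc, h, ← Functor.map_comp, ← hf₁]
  rfl

lemma hasFractions_toCoderived :
    HasFractions (BoundedFPComplex.toCoderived A) (BoundedFPComplex.toDerived A) :=
  fun K L φ => exists_fraction_coderived K L φ

lemma toDerived_map_eq_zero_of_homotopy {K L : CochainComplex (FPModuleCat A) ℤ} {f : K ⟶ L}
    (hf : (HomotopyCategory.quotient _ _).map ((fpComplexToMod A).map f) = 0) :
    DerivedCategory.Q.map f = 0 := by
  rw [HomotopyCategory.quotient_map_eq_zero_iff] at hf
  obtain ⟨h⟩ := hf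
  obtain ⟨h'⟩ := nonempty_homotopy_zero_of_map _ h
  rw [DerivedCategory.Q_map_eq_of_homotopy _ h', Functor.map_zero]

lemma Q_map_eq_zero_of_coderived {K L : BoundedFPComplex A} (f : K.obj ⟶ L.obj)
    (hf : (CoderivedCategory.Q A).map ((fpComplexToMod A).map f) = 0) :
    DerivedCategory.Q.map f = 0 := by
  obtain ⟨F, s, hF, hs, h⟩ := exists_comp_eq_zero_of_bfp
    (bfp_quotient_obj (isBoundedFP_fpComplexToMod_obj K)) _ hf
  obtain ⟨F', e, s', hs', h₁, -⟩ := exists_fpComplex_of_bfp hF s hs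
  have : IsIso (DerivedCategory.Q.map s'.hom) := by
    rwa [DerivedCategory.isIso_Q_map_iff_quasiIso, ← toDerived_map_isIso_iff]
  rw [← cancel_epi (DerivedCategory.Q.map s'.hom), comp_zero, ← Functor.map_comp]
  apply toDerived_map_eq_zero_of_homotopy
  rw [Functor.map_comp, Functor.map_comp, hs', Category.assoc, h, comp_zero]

/-- As `f` vanishes in the derived category, `L ⟶ cone f` has a retraction there. Writing it as a
bounded left fraction `(g, s)`, the chain map `inr ≫ g` is a quasi-isomorphism of bounded complexes,
hence invertible in the coderived category too. It annihilates `f` up to homotopy because `f ≫ inr`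
is null-homotopic. -/
lemma coderived_map_eq_zero_of_Q {K L : BoundedFPComplex A} (f : K.obj ⟶ L.obj)
    (hf : DerivedCategory.Q.map f = 0) :
    (CoderivedCategory.Q A).map ((fpComplexToMod A).map f) = 0 := by
  obtain ⟨a, b, _, _⟩ := exists_bounds_mappingCone f K.property L.property
  obtain ⟨a', b', _, _⟩ := L.property
  have : L.obj.IsStrictlyLE (max b b') := L.obj.isStrictlyLE_of_le _ _ (le_max_right b b')
  have : (CochainComplex.mappingCone f).IsStrictlyLE (max b b') :=
    (CochainComplex.mappingCone f).isStrictlyLE_of_le _ _ (le_max_left b b')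
  have hT := DerivedCategory.mappingCone_triangle_distinguished f
  obtain ⟨ρ, hρ⟩ : ∃ ρ : DerivedCategory.Q.obj (CochainComplex.mappingCone f) ⟶
      DerivedCategory.Q.obj L.obj, 𝟙 _ =
        DerivedCategory.Q.map (CochainComplex.mappingCone.inr f) ≫ ρ :=
    Triangle.yoneda_exact₂ _ hT (𝟙 (DerivedCategory.Q.obj L.obj))
      ((Category.comp_id _).trans hf)
  obtain ⟨L', h₁, h₂, g, s, hs, fac⟩ :=
    DerivedCategory.left_fac_of_isStrictlyLE_of_isStrictlyGE a' (max b b') ρ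
  let L'' : BoundedFPComplex A := ⟨L', a', max b b', h₁, h₂⟩
  let t : L ⟶ L'' := ObjectProperty.homMk (CochainComplex.mappingCone.inr f ≫ g)
  have ht : DerivedCategory.Q.map (CochainComplex.mappingCone.inr f ≫ g) =
      DerivedCategory.Q.map s := by
    rw [fac, ← Category.assoc, ← Functor.map_comp] at hρ
    rw [← cancel_mono (inv (DerivedCategory.Q.map s)), ← hρ, IsIso.hom_inv_id]
  have : IsIso ((CoderivedCategory.Q A).map ((fpComplexToMod A).map t.hom)) := by
    refine isIso_toCoderived_map t ?_
    rw [← DerivedCategory.isIso_Q_map_iff_quasiIso]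
    exact ht ▸ hs
  rw [← cancel_mono ((CoderivedCategory.Q A).map ((fpComplexToMod A).map t.hom)), zero_comp,
    ← Functor.map_comp, ← Functor.map_comp]
  have h₀ : Homotopy (f ≫ CochainComplex.mappingCone.inr f) 0 :=
    HomologicalComplex.homotopyCofiber.inrCompHomotopy f fun j => ⟨j - 1, by simp⟩
  have h : (HomotopyCategory.quotient _ _).map ((fpComplexToMod A).map (f ≫ t.hom)) = 0 := by
    rw [HomotopyCategory.quotient_map_eq_zero_iff]
    have h₁ : Homotopy (f ≫ t.hom) 0 :=
      (Homotopy.ofEq (Category.assoc _ _ _).symm).trans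
        ((h₀.compRight g).trans (Homotopy.ofEq zero_comp))
    exact ⟨((isFPModule A).ι.mapHomotopy h₁).trans (Homotopy.ofEq (Functor.map_zero _ _ _))⟩
  rw [Functor.comp_map, h, Functor.map_zero]

lemma toDerived_map_eq_iff {K L : BoundedFPComplex A} (f g : K ⟶ L) :
    (BoundedFPComplex.toDerived A).map f = (BoundedFPComplex.toDerived A).map g ↔
      (BoundedFPComplex.toCoderived A).map f = (BoundedFPComplex.toCoderived A).map g := by
  have h₁ : (BoundedFPComplex.toDerived A).map f = (BoundedFPComplex.toDerived A).map g ↔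
      DerivedCategory.Q.map f.hom = DerivedCategory.Q.map g.hom :=
    ⟨fun h => congr_arg (fun φ => φ.hom) h, fun h => ObjectProperty.hom_ext _ h⟩
  have h₂ : (BoundedFPComplex.toCoderived A).map f = (BoundedFPComplex.toCoderived A).map g ↔
      (CoderivedCategory.Q A).map ((fpComplexToMod A).map f.hom) =
        (CoderivedCategory.Q A).map ((fpComplexToMod A).map g.hom) := Iff.rfl
  rw [h₁, h₂, ← sub_eq_zero, ← sub_eq_zero (a := (CoderivedCategory.Q A).map _),
    ← Functor.map_sub, ← Functor.map_sub, ← Functor.map_sub]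
  exact ⟨coderived_map_eq_zero_of_Q _, Q_map_eq_zero_of_coderived _⟩

instance : (BoundedFPComplex.toDerived A).EssSurj where
  mem_essImage X := by
    obtain ⟨⟨a, ha⟩, ⟨b, hb⟩⟩ := X.property
    have : X.obj.IsGE a := ha
    have : X.obj.IsLE b := hb
    obtain ⟨K, h₁, h₂, ⟨e⟩⟩ := X.obj.exists_iso_Q_obj_of_isGE_of_isLE a b
    exact ⟨⟨K, a, b, h₁, h₂⟩, ⟨ObjectProperty.isoMk _ e.symm⟩⟩

variable (A) in
lemma exists_fullyFaithful_boundedDerived :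
    ∃ F : DerivedCategory.Bounded (FPModuleCat A) ⥤ CoderivedCategory A,
      Nonempty (BoundedFPComplex.toDerived A ⋙ F ≅ BoundedFPComplex.toCoderived A) ∧
        F.Full ∧ F.Faithful ∧ F.essImage = boundedFP A := by
  obtain ⟨F, ⟨e⟩, h₁, h₂⟩ := exists_fullyFaithful_of_hasFractions hasFractions_toDerived
    (hasFractions_toCoderived (A := A)) fun _ _ => toDerived_map_eq_iff
  refine ⟨F, ⟨e⟩, h₁, h₂, ?_⟩
  ext X
  constructor
  · rintro ⟨Y, ⟨e'⟩⟩
    exact ⟨(BoundedFPComplex.toDerived A).objPreimage Y, ⟨(e.app _).symm ≪≫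
      F.mapIso ((BoundedFPComplex.toDerived A).objObjPreimageIso Y) ≪≫ e'⟩⟩
  · rintro ⟨K, ⟨e'⟩⟩
    exact ⟨_, ⟨e.app K ≪≫ e'⟩⟩

end ComplexesOfFPModules

/-! ### Countably generated ideals and fp-injective modules -/

section FPInjective

variable {A : Type u} [Ring A]

lemma shortExact_submodule {M : Type u} [AddCommGroup M] [Module A M] (N : Submodule A M) :
    (ShortComplex.mk (ModuleCat.ofHom N.subtype) (ModuleCat.ofHom N.mkQ)
      (by ext; simp)).ShortExact where
  exact := by
    rw [ShortComplex.moduleCat_exact_iff]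
    intro x hx
    exact ⟨⟨x, (Submodule.Quotient.mk_eq_zero N).1 hx⟩, rfl⟩
  mono_f := (ModuleCat.mono_iff_injective _).2 N.injective_subtype
  epi_g := (ModuleCat.epi_iff_surjective _).2 N.mkQ_surjective

/-- A linear map which vanishes after composition with the second map of an exact pair lifts along
the first map. -/
lemma exists_comp_eq_of_exact {J E Q M : Type*} [AddCommGroup J] [AddCommGroup E] [AddCommGroup Q]
    [AddCommGroup M] [Module A J] [Module A E] [Module A Q] [Module A M] (i : J →ₗ[A] E)
    (p : E →ₗ[A] Q) (hi : Function.Injective i) (hip : Function.Exact i p) (l : M →ₗ[A] E)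
    (hl : ∀ x, p (l x) = 0) : ∃ d : M →ₗ[A] J, ∀ x, i (d x) = l x :=
  ⟨(LinearEquiv.ofInjective i hi).symm.toLinearMap ∘ₗ
    l.codRestrict (LinearMap.range i) fun x => (hip _).1 (hl x), fun x =>
      congr_arg Subtype.val ((LinearEquiv.ofInjective i hi).apply_symm_apply
        (l.codRestrict (LinearMap.range i) (fun x => (hip _).1 (hl x)) x))⟩

variable [IsLeftCoherentRing A]

lemma IsFPInjective.exists_extend {J : ModuleCat.{u} A} (hJ : IsFPInjective A J) {M : Type u}
    [AddCommGroup M] [Module A M] [Module.FinitePresentation A M] (N : Submodule A M) (hN : N.FG)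
    (g : N →ₗ[A] J) : ∃ h : M →ₗ[A] J, ∀ x : N, h x = g x := by
  obtain ⟨h, hh⟩ := hJ _ (shortExact_submodule N)
    (IsLeftCoherentRing.finitePresentation_of_fg M N hN)
    (inferInstanceAs (Module.FinitePresentation A M))
    (Module.finitePresentation_of_surjective N.mkQ N.mkQ_surjective (by rwa [N.ker_mkQ]))
    (ModuleCat.ofHom g)
  exact ⟨h.hom, fun x => congr(ModuleCat.Hom.hom $hh x)⟩

section

variable {J E Q : ModuleCat.{u} A} (hJ : IsFPInjective A J) (i : J →ₗ[A] E)
  (p : E →ₗ[A] Q) (hi : Function.Injective i) (hip : Function.Exact i p)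
  (hp : Function.Surjective p)

include hJ hi hip hp

/-- This is the vanishing of `Ext¹(N, J)`. Lift over a finite free cover of `N`; on the finitely
generated kernel the lift takes values in `J`, and subtracting an extension of that map lets it
descend to `N`. -/
lemma IsFPInjective.exists_lift {N : Type u} [AddCommGroup N] [Module A N]
    [Module.FinitePresentation A N] (g : N →ₗ[A] Q) : ∃ h : N →ₗ[A] E, ∀ x, p (h x) = g x := by
  obtain ⟨n, π, hπ⟩ := Module.Finite.exists_fin' A N
  obtain ⟨l, hl⟩ := Module.projective_lifting_property p (g ∘ₗ π) hp
  replace hl (x) : p (l x) = g (π x) := congr($hl x)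
  obtain ⟨d, hd⟩ := exists_comp_eq_of_exact i p hi hip (l ∘ₗ (LinearMap.ker π).subtype)
    fun x => by simp [hl, show π x = 0 from x.2]
  obtain ⟨d', hd'⟩ := hJ.exists_extend (LinearMap.ker π) (Module.FinitePresentation.fg_ker π hπ) d
  let l' := l - i ∘ₗ d'
  have hl' : LinearMap.ker π ≤ LinearMap.ker l' := fun x hx => by
    have h1 := hd' ⟨x, hx⟩
    have h2 := hd ⟨x, hx⟩
    simp only [LinearMap.mem_ker, l', LinearMap.sub_apply, LinearMap.comp_apply] at h1 h2 ⊢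
    rw [h1, h2]
    exact sub_self _
  let e := π.quotKerEquivOfSurjective hπ
  refine ⟨(LinearMap.ker π).liftQ l' hl' ∘ₗ e.symm.toLinearMap, fun x => ?_⟩
  obtain ⟨y, rfl⟩ := hπ x
  have : e.symm (π y) = (LinearMap.ker π).mkQ y := by
    rw [LinearEquiv.symm_apply_eq]
    rfl
  simp [this, l', hl, hip.apply_apply_eq_zero]

variable [Module.Injective A E]

lemma IsFPInjective.exists_lift_of_ideal (I : Ideal A) (hI : I.FG) (g : I →ₗ[A] Q) :
    ∃ h : A →ₗ[A] E, ∀ x : I, p (h x) = g x := by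
  have := IsLeftCoherentRing.finitePresentation_of_fg A I hI
  obtain ⟨h, hh⟩ := hJ.exists_lift i p hi hip hp g
  obtain ⟨h', hh'⟩ := Module.Injective.out I.subtype I.injective_subtype h
  exact ⟨h', fun x => by rw [← hh, ← hh']; rfl⟩

/-- A lift over a finitely generated ideal can be modified so that it agrees with
a given lift over a smaller finitely generated ideal. -/
lemma IsFPInjective.exists_lift_extending {I I' : Ideal A} (hII' : I ≤ I') (hI : I.FG)
    (hI' : I'.FG) (g : I' →ₗ[A] Q) (h : A →ₗ[A] E)
    (hh : ∀ x (hx : x ∈ I), p (h x) = g ⟨x, hII' hx⟩) :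
    ∃ h' : A →ₗ[A] E, (∀ x : I', p (h' x) = g x) ∧ ∀ x ∈ I, h' x = h x := by
  obtain ⟨k, hk⟩ := hJ.exists_lift_of_ideal i p hi hip hp I' hI' g
  obtain ⟨d, hd⟩ := exists_comp_eq_of_exact i p hi hip ((k - h) ∘ₗ I.subtype) fun x => by
    simpa [sub_eq_zero, hh _ x.2] using hk ⟨x, hII' x.2⟩
  obtain ⟨d', hd'⟩ := hJ.exists_extend I hI d
  refine ⟨k - i ∘ₗ d', fun x => ?_, fun x hx => ?_⟩
  · simp [hk, hip.apply_apply_eq_zero]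
  · have h1 := hd' ⟨x, hx⟩
    have h2 := hd ⟨x, hx⟩
    simp only [LinearMap.sub_apply, LinearMap.comp_apply, Submodule.subtype_apply] at h1 h2 ⊢
    rw [h1, h2]
    exact sub_sub_cancel _ _

/-- The ideal is the union of a chain of finitely generated ideals. Lifts to `E` are chosen so that
each agrees with its predecessor, hence they glue to a lift on the whole ideal, which extends to `A`
because `E` is injective. -/
lemma IsFPInjective.baer_of_countably_generated
    (hA : ∀ I : Ideal A, ∃ s : Set A, s.Countable ∧ Ideal.span s = I) : Module.Baer A Q := by
  intro I g
  obtain ⟨s, hs, hsI⟩ := hA I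
  -- Adding `0` to the generators makes the set nonempty, hence the range of a sequence, without
  -- changing the ideal.
  obtain ⟨a, ha⟩ := (hs.insert 0).exists_eq_range (Set.insert_nonempty _ _)
  let I' (n : ℕ) : Ideal A := Ideal.span (a '' Set.Iio n)
  have hFG (n : ℕ) : (I' n).FG := Submodule.fg_span ((Set.finite_Iio n).image a)
  have hmono : Monotone I' := fun m n hmn => Ideal.span_mono (Set.image_mono (Set.Iio_subset_Iio hmn))
  have hle (n : ℕ) : I' n ≤ I := by
    rw [Ideal.span_le, ← hsI]
    rintro _ ⟨k, -, rfl⟩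
    have : a k ∈ insert 0 s := ha ▸ Set.mem_range_self k
    rcases Set.mem_insert_iff.1 this with h | h
    · rw [h]; exact zero_mem _
    · exact Ideal.subset_span h
  have hsup (x : A) (hx : x ∈ I) : ∃ n, x ∈ I' n := by
    have : I ≤ ⨆ n, I' n := by
      rw [← hsI, Ideal.span_le]
      intro y hy
      have hy' : y ∈ Set.range a := ha ▸ Set.mem_insert_of_mem _ hy
      obtain ⟨k, rfl⟩ := hy'
      exact Submodule.mem_iSup_of_mem (k + 1) (Ideal.subset_span ⟨k, by simp, rfl⟩)
    exact (Submodule.mem_iSup_of_directed _ hmono.directed_le).1 (this hx)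
  let T (n : ℕ) := { h : A →ₗ[A] E // ∀ x (hx : x ∈ I' n), p (h x) = g ⟨x, hle n hx⟩ }
  have hstep (n : ℕ) (h : T n) : ∃ h' : T (n + 1), ∀ x ∈ I' n, h'.1 x = h.1 x := by
    obtain ⟨h', h1, h2⟩ := hJ.exists_lift_extending i p hi hip hp (hmono n.le_succ) (hFG n)
      (hFG (n + 1)) (g ∘ₗ Submodule.inclusion (hle (n + 1))) h.1 h.2
    exact ⟨⟨h', fun x hx => h1 ⟨x, hx⟩⟩, h2⟩
  choose next hnext using hstep
  obtain ⟨h0, hh0⟩ := hJ.exists_lift_of_ideal i p hi hip hp (I' 0) (hFG 0)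
    (g ∘ₗ Submodule.inclusion (hle 0))
  let h (n : ℕ) : T n := Nat.rec ⟨h0, fun x hx => hh0 ⟨x, hx⟩⟩ next n
  have hcompat (n k : ℕ) (x : A) (hx : x ∈ I' n) : (h (n + k)).1 x = (h n).1 x := by
    induction k with
    | zero => rfl
    | succ k ih => exact (hnext (n + k) (h (n + k)) x (hmono (Nat.le_add_right n k) hx)).trans ih
  choose N hN using fun x : I => hsup x x.2
  have hh (x : I) (n : ℕ) (hn : N x ≤ n) : (h n).1 x = (h (N x)).1 x := by
    obtain ⟨k, rfl⟩ := Nat.exists_eq_add_of_le hn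
    exact hcompat _ _ _ (hN x)
  let H : I →ₗ[A] E :=
    { toFun x := (h (N x)).1 x
      map_add' x y := by
        let m := max (N (x + y)) (max (N x) (N y))
        rw [← hh (x + y) m (by lia), ← hh x m (by lia), ← hh y m (by lia)]
        exact map_add _ _ _
      map_smul' r x := by
        let m := max (N (r • x)) (N x)
        rw [← hh (r • x) m (by lia), ← hh x m (by lia)]
        exact map_smul _ _ _ }
  obtain ⟨H', hH'⟩ := Module.Injective.out I.subtype I.injective_subtype H
  exact ⟨p ∘ₗ H', fun x hx => (congr_arg p (hH' ⟨x, hx⟩)).trans ((h _).2 x (hN ⟨x, hx⟩))⟩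

end

lemma fpInjectivesHaveFiniteInjectiveDimension_of_countably_generated
    (hA : ∀ I : Ideal A, ∃ s : Set A, s.Countable ∧ Ideal.span s = I) :
    FPInjectivesHaveFiniteInjectiveDimension A := by
  intro J hJ
  refine ⟨1, ?_⟩
  let S := ShortComplex.mk (Injective.ι J) (cokernel.π (Injective.ι J)) (cokernel.condition _)
  have hS : S.ShortExact :=
    { exact := ShortComplex.exact_of_g_is_cokernel S (cokernelIsCokernel _)
      mono_f := inferInstanceAs (Mono (Injective.ι J))
      epi_g := inferInstanceAs (Epi (cokernel.π (Injective.ι J))) }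
  have hinj₂ : Injective S.X₂ := inferInstanceAs (Injective (Injective.under J))
  have : Module.Injective A S.X₂ := (Module.injective_iff_injective_object A S.X₂).2 hinj₂
  have hbaer := hJ.baer_of_countably_generated S.f.hom S.g.hom
    ((ModuleCat.mono_iff_injective _).1 hS.mono_f)
    ((ShortComplex.ShortExact.moduleCat_exact_iff_function_exact S).1 hS.exact)
    ((ModuleCat.epi_iff_surjective _).1 hS.epi_g) hA
  have : Injective S.X₃ := (Module.injective_iff_injective_object A S.X₃).1 hbaer.injective
  exact hS.hasInjectiveDimensionLT_X₁ 1 inferInstance inferInstance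

end FPInjective

/-! ### Complexes of injectives are orthogonal to coacyclic complexes -/

section InjectiveTerms

open CochainComplex HomComplex

variable {C : Type*} [Category* C] [Abelian C]

lemma exists_cochain_desc_of_shortExact {S : ShortComplex (CochainComplex C ℤ)}
    (hS : S.ShortExact) {F : CochainComplex C ℤ} {n : ℤ} (v : Cochain S.X₂ F n)
    (hv : (Cochain.ofHom S.f).comp v (zero_add n) = 0) :
    ∃ w : Cochain S.X₃ F n, (Cochain.ofHom S.g).comp w (zero_add n) = v := by
  have hS' (q : ℤ) : (S.map (HomologicalComplex.eval C (ComplexShape.up ℤ) q)).ShortExact :=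
    hS.map_of_exact _
  have hepi (q : ℤ) : Epi (S.map (HomologicalComplex.eval C (ComplexShape.up ℤ) q)).g :=
    (hS' q).epi_g
  have h (p q : ℤ) (hpq : p + n = q) : ∃ w : S.X₃.X p ⟶ F.X q, S.g.f p ≫ w = v.v p q hpq := by
    have hv' := Cochain.congr_v hv p q hpq
    rw [Cochain.zero_cochain_comp_v, Cochain.ofHom_v] at hv'
    exact ⟨(hS' p).exact.desc (v.v p q hpq) hv', (hS' p).exact.g_desc (v.v p q hpq) hv'⟩
  choose w hw using h
  exact ⟨Cochain.mk w, by ext p q hpq; simp [hw]⟩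

lemma comp_ofHom_g_injective_of_shortExact {S : ShortComplex (CochainComplex C ℤ)}
    (hS : S.ShortExact) {F : CochainComplex C ℤ} {n : ℤ} {v w : Cochain S.X₃ F n}
    (hv : (Cochain.ofHom S.g).comp v (zero_add n) = (Cochain.ofHom S.g).comp w (zero_add n)) :
    v = w := by
  have := hS.epi_g
  ext p q hpq
  have := Cochain.congr_v hv p q hpq
  simpa [cancel_epi] using this

lemma exists_cochain_extension {S : ShortComplex (CochainComplex C ℤ)} (hS : S.ShortExact)
    {I : CochainComplex C ℤ} (hI : ∀ n, Injective (I.X n)) {n : ℤ} (v : Cochain S.X₁ I n) :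
    ∃ w : Cochain S.X₂ I n, (Cochain.ofHom S.f).comp w (zero_add n) = v := by
  have := hS.mono_f
  exact ⟨Cochain.mk fun p q hpq => Injective.factorThru (v.v p q hpq) (S.f.f p), by
    ext p q hpq; simp⟩

/-- Write `g` as a cochain `a` on `cone(S.f)` and a chain map `b` on `S.X₃` with `δ a = π ≫ b`.
Injectivity permits subtracting a coboundary `δ γ` so that `a` vanishes on the shifted `S.X₁`. What
remains is a cochain on `S.X₂` which kills `S.X₁`, and so descends to a primitive `e` of `b`. -/
lemma nonempty_homotopy_zero_of_injective {S : ShortComplex (CochainComplex C ℤ)}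
    (hS : S.ShortExact) {I : CochainComplex C ℤ} (hI : ∀ n, Injective (I.X n))
    (g : mappingCone (mappingCone.descShortComplex S) ⟶ I) : Nonempty (Homotopy g 0) := by
  let π := mappingCone.descShortComplex S
  have hπ : Cochain.ofHom π = (mappingCone.snd S.f).comp (Cochain.ofHom S.g) (add_zero 0) :=
    ofHom_descShortComplex S
  have hinr : Cochain.ofHom (mappingCone.inr S.f ≫ π) = Cochain.ofHom S.g := by
    rw [mappingCone.inr_descShortComplex]
  let a : Cochain (mappingCone S.f) I (-1) :=
    (mappingCone.inl π).comp (Cochain.ofHom g) (add_zero (-1))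
  let b : Cochain S.X₃ I 0 := Cochain.ofHom (mappingCone.inr π ≫ g)
  have hab : δ (-1) 0 a = (Cochain.ofHom π).comp b (zero_add 0) := by
    simp only [a, b, δ_comp_ofHom, mappingCone.δ_inl, ← Cochain.ofHom_comp, Category.assoc]
  -- The sign cancels the one in the differential of `mappingCone.snd`.
  obtain ⟨m, hm⟩ := exists_cochain_extension hS hI
    (-((mappingCone.inl S.f).comp a (show -1 + -1 = -2 by lia)))
  let γ := (mappingCone.snd S.f).comp m (zero_add (-2))
  let a' := a - δ (-2) (-1) γ
  have hγ : (mappingCone.inl S.f).comp (δ (-2) (-1) γ) (show -1 + -1 = -2 by lia) =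
      (mappingCone.inl S.f).comp a (show -1 + -1 = -2 by lia) := by
    have h := δ_zero_cochain_comp (mappingCone.snd S.f) m (-1) (by lia)
    rw [h, mappingCone.δ_snd]
    simp [hm, Int.negOnePow_even 2 even_two]
  let c := (Cochain.ofHom (mappingCone.inr S.f)).comp a' (zero_add (-1))
  have ha' : a' = (mappingCone.snd S.f).comp c (zero_add (-1)) := by
    rw [mappingCone.ext_cochain_from_iff _ (-2) (-1) (by lia)]
    constructor
    · simp [a', hγ]
    · simp [c]
  have hδa' : δ (-1) 0 a' = (Cochain.ofHom π).comp b (zero_add 0) := by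
    simp [a', hab, δ_δ]
  have hc : (Cochain.ofHom S.f).comp c (zero_add (-1)) = 0 := by
    have h := δ_zero_cochain_comp (mappingCone.snd S.f) c 0 (by lia)
    rw [← ha', hδa', mappingCone.δ_snd] at h
    have h' := congr_arg (fun z => (mappingCone.inl S.f).comp z (add_zero (-1))) h
    rw [hπ] at h'
    simpa using h'.symm
  obtain ⟨e, he⟩ := exists_cochain_desc_of_shortExact hS c hc
  have ha'' : a' = (Cochain.ofHom π).comp e (zero_add (-1)) := by
    rw [ha', ← he, hπ]
    simp
  have heb : δ (-1) 0 e = b := by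
    apply comp_ofHom_g_injective_of_shortExact hS
    rw [ha'', δ_ofHom_comp] at hδa'
    have h := congr_arg (fun z => (Cochain.ofHom (mappingCone.inr S.f)).comp z (zero_add 0)) hδa'
    simp only [← Cochain.comp_assoc_of_first_is_zero_cochain, ← Cochain.ofHom_comp] at h
    rwa [hinr] at h
  refine ⟨mappingCone.descHomotopy _ _ _ γ e ?_ ?_⟩
  · rw [← ha'']
    simp [a', a, π]
  · rw [heb]
    simp [b, π]

end InjectiveTerms

section InjectiveLocal

open CochainComplex

variable {A : Type u} [Ring A]

/-- Complexes of modules with injective terms. -/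
def HasInjectiveTerms (I : CochainComplex (ModuleCat.{u} A) ℤ) : Prop := ∀ n, Injective (I.X n)

lemma HasInjectiveTerms.shift {I : CochainComplex (ModuleCat.{u} A) ℤ} (hI : HasInjectiveTerms I)
    (n : ℤ) : HasInjectiveTerms (I⟦n⟧) := fun i => hI (i + n)

lemma HasInjectiveTerms.mappingCone {I J : CochainComplex (ModuleCat.{u} A) ℤ}
    (hI : HasInjectiveTerms I) (hJ : HasInjectiveTerms J) (f : I ⟶ J) :
    HasInjectiveTerms (mappingCone f) := fun n => by
  have := hI (n + 1)
  have := hJ n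
  exact Injective.of_iso (HomologicalComplex.homotopyCofiber.XIsoBiprod f n (n + 1) rfl).symm
    inferInstance

/-- The target varies within the induction because a morphism from `X⟦n⟧` to `I` is a morphism from
`X` to `I⟦-n⟧`. -/
lemma eq_zero_of_coacyclic {X : HotMod A} (hX : coacyclic A X) :
    ∀ ⦃I : CochainComplex (ModuleCat.{u} A) ℤ⦄, HasInjectiveTerms I →
      ∀ f : X ⟶ (HomotopyCategory.quotient _ _).obj I, f = 0 := by
  induction hX with
  | totalization S hS =>
    intro I hI f
    obtain ⟨f, rfl⟩ := (HomotopyCategory.quotient _ _).map_surjective f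
    rw [HomotopyCategory.quotient_map_eq_zero_iff]
    exact nonempty_homotopy_zero_of_injective hS hI f
  | @iso X Y e _ ih =>
    intro I hI f
    rw [← cancel_epi e.hom, comp_zero]
    exact ih hI _
  | @shift X n _ ih =>
    intro I hI f
    let e : (HomotopyCategory.quotient _ _).obj (I⟦-n⟧) ≅
        ((HomotopyCategory.quotient _ _).obj I)⟦-n⟧ :=
      ((HomotopyCategory.quotient (ModuleCat.{u} A) (ComplexShape.up ℤ)).commShiftIso (-n)).app I
    have h := ih (hI.shift (-n)) ((shiftShiftNeg X n).inv ≫ f⟦-n⟧' ≫ e.inv)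
    rw [← Category.assoc, Preadditive.IsIso.comp_right_eq_zero,
      Preadditive.IsIso.comp_left_eq_zero] at h
    exact (CategoryTheory.shiftFunctor (HotMod A) (-n)).map_injective (h.trans (Functor.map_zero _ _ _).symm)
  | ext T hT _ _ ih₁ ih₃ =>
    intro I hI f
    obtain ⟨g, rfl⟩ := Triangle.yoneda_exact₂ T hT f (ih₁ hI _)
    rw [ih₃ hI g, comp_zero]
  | @coproduct ι X c hc _ ih =>
    intro I hI f
    exact Cofan.IsColimit.hom_ext hc _ _ fun i => (ih i hI _).trans (ih i hI _).symm

lemma HasInjectiveTerms.rightOrthogonal {I : CochainComplex (ModuleCat.{u} A) ℤ}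
    (hI : HasInjectiveTerms I) :
    (coacyclic A).rightOrthogonal ((HomotopyCategory.quotient _ _).obj I) :=
  fun _ f hX => eq_zero_of_coacyclic hX hI f

lemma HasInjectiveTerms.Q_map_bijective {I : CochainComplex (ModuleCat.{u} A) ℤ}
    (hI : HasInjectiveTerms I) (X : HotMod A) : Function.Bijective
      ((coacyclic A).trW.Q.map : (X ⟶ (HomotopyCategory.quotient _ _).obj I) → _) :=
  hI.rightOrthogonal.map_bijective_of_isTriangulated (coacyclic A).trW.Q X

lemma HasInjectiveTerms.Q_map_surjective {K I : CochainComplex (ModuleCat.{u} A) ℤ}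
    (hI : HasInjectiveTerms I)
    (φ : (CoderivedCategory.Q A).obj K ⟶ (CoderivedCategory.Q A).obj I) :
    ∃ f : K ⟶ I, (CoderivedCategory.Q A).map f = φ := by
  obtain ⟨f, hf⟩ := (hI.Q_map_bijective _).2 φ
  obtain ⟨g, rfl⟩ := (HomotopyCategory.quotient _ _).map_surjective f
  exact ⟨g, hf⟩

variable (A) in
/-- The objects of the coderived category which are represented by complexes with injective
terms. -/
def injectivelyResolved : ObjectProperty (CoderivedCategory A) := fun X =>
  ∃ I, HasInjectiveTerms I ∧ Nonempty ((CoderivedCategory.Q A).obj I ≅ X)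

lemma HasInjectiveTerms.injectivelyResolved {I : CochainComplex (ModuleCat.{u} A) ℤ}
    (hI : HasInjectiveTerms I) : injectivelyResolved A ((CoderivedCategory.Q A).obj I) :=
  ⟨I, hI, ⟨Iso.refl _⟩⟩

instance : (injectivelyResolved A).IsClosedUnderIsomorphisms where
  of_iso := by
    rintro X Y e ⟨I, hI, ⟨e'⟩⟩
    exact ⟨I, hI, ⟨e' ≪≫ e⟩⟩

instance : (injectivelyResolved A).ContainsZero where
  exists_zero := ⟨(CoderivedCategory.Q A).obj 0, Functor.map_isZero _ (isZero_zero _),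
    HasInjectiveTerms.injectivelyResolved fun n =>
      have : IsZero ((0 : CochainComplex (ModuleCat.{u} A) ℤ).X n) :=
        Functor.map_isZero (HomologicalComplex.eval _ _ n) (isZero_zero _)
      this.injective⟩

instance : (injectivelyResolved A).IsStableUnderShift ℤ where
  isStableUnderShiftBy n :=
    { le_shift X hX := by
        obtain ⟨I, hI, ⟨e⟩⟩ := hX
        exact ⟨I⟦n⟧, hI.shift n, ⟨((CoderivedCategory.Q A).commShiftIso n).app I ≪≫
          (CategoryTheory.shiftFunctor _ n).mapIso e⟩⟩ }

instance : (injectivelyResolved A).IsTriangulatedClosed₃ := .mk' fun T hT h₁ h₂ => by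
  obtain ⟨I, hI, ⟨e⟩⟩ := h₁
  obtain ⟨J, hJ, ⟨e'⟩⟩ := h₂
  obtain ⟨f, hf⟩ := hJ.Q_map_surjective (e.hom ≫ T.mor₁ ≫ e'.inv)
  obtain ⟨h, hT'⟩ := exists_distinguished_of_mappingCone f
  refine ⟨CochainComplex.mappingCone f, hI.mappingCone hJ f, ⟨Triangle.π₃.mapIso
    (isoTriangleOfIso₁₂ _ T hT' hT e e' ?_)⟩⟩
  change (CoderivedCategory.Q A).map f ≫ e'.hom = e.hom ≫ T.mor₁
  rw [hf]
  simp

instance : (injectivelyResolved A).IsTriangulated where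
  toIsTriangulatedClosed₂ := .of_isTriangulatedClosed₃

end InjectiveLocal

/-! ### Replacing complexes of bounded injective dimension by complexes of injectives -/

section InjectiveDimensionOfComplexes

open CochainComplex HomComplex

variable {A : Type u} [Ring A]

lemma exists_mono_hasInjectiveTerms (X : CochainComplex (ModuleCat.{u} A) ℤ) :
    ∃ (J : CochainComplex (ModuleCat.{u} A) ℤ) (i : X ⟶ J), Mono i ∧ HasInjectiveTerms J := by
  refine ⟨mappingCone (𝟙 (cm5b.I X)), cm5b.i (0 : X ⟶ 0) ≫ biprod.fst, ?_, fun n => inferInstance⟩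
  refine HomologicalComplex.mono_of_mono_f _ fun n => ?_
  have h : (cm5b.i (0 : X ⟶ 0) ≫ biprod.fst).f n ≫
      (mappingCone.snd (𝟙 (cm5b.I X))).v n n (add_zero n) = Injective.ι (X.X n) := by
    rw [HomologicalComplex.comp_f, Category.assoc]
    exact cm5b.i_f_comp (0 : X ⟶ 0) n
  have : Mono ((cm5b.i (0 : X ⟶ 0) ≫ biprod.fst).f n ≫
      (mappingCone.snd (𝟙 (cm5b.I X))).v n n (add_zero n)) := by
    rw [h]
    exact inferInstanceAs (Mono (Injective.ι (X.X n)))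
  exact mono_of_mono _ ((mappingCone.snd (𝟙 (cm5b.I X))).v n n (add_zero n))

lemma shortExact_cokernel {C : Type*} [Category* C] [Abelian C] {X Y : C} (f : X ⟶ Y) [Mono f] :
    (ShortComplex.mk f (cokernel.π f) (cokernel.condition f)).ShortExact where
  exact := ShortComplex.exact_of_g_is_cokernel _ (cokernelIsCokernel f)
  mono_f := inferInstance
  epi_g := inferInstanceAs (Epi (cokernel.π f))

/-- Embed `X` in a complex with injective terms. The cokernel has terms of dimension one less, and
the first vertex of a triangle is injectively resolved once the other two are. -/
lemma injectivelyResolved_of_hasInjectiveDimensionLE (N : ℕ)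
    (X : CochainComplex (ModuleCat.{u} A) ℤ) (hX : ∀ n, HasInjectiveDimensionLE (X.X n) N) :
    injectivelyResolved A ((CoderivedCategory.Q A).obj X) := by
  induction N generalizing X with
  | zero =>
    exact HasInjectiveTerms.injectivelyResolved fun n =>
      injective_iff_hasInjectiveDimensionLT_one.2 (hX n)
  | succ N ih =>
    obtain ⟨J, i, hi, hJ⟩ := exists_mono_hasInjectiveTerms X
    have hS := shortExact_cokernel i
    obtain ⟨h, hT⟩ := exists_distinguished_of_shortExact _ hS
    refine (injectivelyResolved A).ext_of_isTriangulatedClosed₁ _ hT hJ.injectivelyResolved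
      (ih _ fun n => ?_)
    have hJn : Injective (J.X n) := hJ n
    exact (hS.map_of_exact (HomologicalComplex.eval _ _ n)).hasInjectiveDimensionLT_X₃ (N + 1)
      (inferInstanceAs (HasInjectiveDimensionLT (J.X n) (N + 1))) (hX n)

end InjectiveDimensionOfComplexes

/-! ### Embeddings that factor termwise through injectives -/

section EffaceableEmbedding

open CochainComplex HomComplex

variable {C : Type*} [Category* C] [Abelian C]

/-- Any complex admits a degreewise split epimorphism from a cone of an identity morphism. -/
lemma exists_degreewise_splitEpi (F : CochainComplex C ℤ) :
    ∃ (G : CochainComplex C ℤ) (e : mappingCone (𝟙 G) ⟶ F),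
      ∀ n, ∃ σ : F.X n ⟶ (mappingCone (𝟙 G)).X n, σ ≫ e.f n = 𝟙 _ := by
  let G : CochainComplex C ℤ := { X n := F.X (n - 1), d _ _ := 0 }
  let α : Cochain G F (-1) := Cochain.mk fun p q hpq => eqToHom (by dsimp [G]; congr 1)
  refine ⟨G, coneIdDesc α, fun n => ⟨eqToHom (by dsimp [G]; congr 1; lia) ≫
    (mappingCone.inl (𝟙 G)).v (n + 1) n (by lia), ?_⟩⟩
  rw [Category.assoc, inl_v_coneIdDesc_f]
  dsimp only [α]
  rw [Cochain.mk_v, eqToHom_trans, eqToHom_refl]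

lemma shortExact_pullback {X J F E : C} (i : X ⟶ J) (p : J ⟶ F) (w : i ≫ p = 0)
    (hS : (ShortComplex.mk i p w).ShortExact) (e : E ⟶ F) :
    (ShortComplex.mk (pullback.lift i 0 (by rw [w, zero_comp]) : X ⟶ pullback p e)
      (pullback.snd p e) (pullback.lift_snd _ _ _)).ShortExact := by
  have hp : Epi p := hS.epi_g
  have hi : Mono i := hS.mono_f
  have hmono : Mono (pullback.lift i 0 (by rw [w, zero_comp]) : X ⟶ pullback p e) :=
    mono_of_mono_fac (pullback.lift_fst i 0 _)
  refine { exact := ?_, mono_f := hmono, epi_g := inferInstanceAs (Epi (pullback.snd p e)) }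
  have h {T : C} (k : T ⟶ pullback p e) (hk : k ≫ pullback.snd p e = 0) :
      ∃ l : T ⟶ X, l ≫ pullback.lift i 0 (by rw [w, zero_comp]) = k := by
    have hk' : (k ≫ pullback.fst p e) ≫ p = 0 := by
      rw [Category.assoc, pullback.condition, ← Category.assoc, hk, zero_comp]
    have hl : hS.exact.lift _ hk' ≫ i = k ≫ pullback.fst p e := hS.exact.lift_f _ hk'
    refine ⟨hS.exact.lift _ hk', pullback.hom_ext ?_ ?_⟩
    · rw [Category.assoc, pullback.lift_fst, hl]
    · rw [Category.assoc, pullback.lift_snd, hk]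
      exact comp_zero
  exact ShortComplex.exact_of_f_is_kernel _ (KernelFork.IsLimit.ofι' _ _ fun k hk =>
    ⟨(h k hk).choose, (h k hk).choose_spec⟩)

variable {A : Type u} [Ring A]

/-- With `J` a complex of injectives containing `X`, and `e` a degreewise split epi from a
contractible complex onto `J / X`, take `X'` to be the pullback of `J ⟶ J / X` along `e`. Then `X' /
X` is contractible. A degreewise section `σ` of `e` gives maps `y ↦ (y, σ [y])` from the terms of
`J` to those of `X'`, extending `j`. -/
lemma exists_effaceable_embedding (X : CochainComplex (ModuleCat.{u} A) ℤ) :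
    ∃ (X' : CochainComplex (ModuleCat.{u} A) ℤ) (j : X ⟶ X'), Mono j ∧
      IsIso ((CoderivedCategory.Q A).map j) ∧
      ∀ n, ∃ (I : ModuleCat.{u} A) (a : X.X n ⟶ I) (b : I ⟶ X'.X n), Injective I ∧ a ≫ b = j.f n := by
  obtain ⟨J, i, hi, hJ⟩ := exists_mono_hasInjectiveTerms X
  obtain ⟨G, e, he⟩ := exists_degreewise_splitEpi (cokernel i)
  have hS := shortExact_pullback _ _ _ (shortExact_cokernel i) e
  let j : X ⟶ pullback (cokernel.π i) e := pullback.lift i 0 (by simp)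
  have hj₁ : j ≫ pullback.fst (cokernel.π i) e = i := pullback.lift_fst _ _ _
  have hj₂ : j ≫ pullback.snd (cokernel.π i) e = 0 := pullback.lift_snd _ _ _
  refine ⟨pullback (cokernel.π i) e, j, hS.mono_f, ?_, fun n => ?_⟩
  · obtain ⟨h, hT⟩ := exists_distinguished_of_shortExact _ hS
    refine (Triangle.isZero₃_iff_isIso₁ _ hT).1 ?_
    exact Functor.map_isZero (coacyclic A).trW.Q (isZero_quotient_cone_id G)
  · obtain ⟨σ, hσ⟩ := he n
    have hpb : IsPullback ((pullback.fst (cokernel.π i) e).f n) ((pullback.snd (cokernel.π i) e).f n)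
        ((cokernel.π i).f n) (e.f n) :=
      (IsPullback.of_hasPullback (cokernel.π i) e).map (HomologicalComplex.eval _ _ n)
    refine ⟨J.X n, i.f n, hpb.lift (𝟙 _) ((cokernel.π i).f n ≫ σ) (by simp [hσ]), hJ n,
      hpb.hom_ext ?_ ?_⟩
    · rw [Category.assoc, hpb.lift_fst, Category.comp_id, ← HomologicalComplex.comp_f, hj₁]
    · rw [Category.assoc, hpb.lift_snd, ← Category.assoc, ← HomologicalComplex.comp_f,
        cokernel.condition, ← HomologicalComplex.comp_f, hj₂]
      exact zero_comp

end EffaceableEmbedding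

/-! ### Telescopes and sequential colimits -/

section CountableCoproducts

variable (A : Type u) [Ring A]

instance : PreservesColimitsOfShape (Discrete ℕ) (CoderivedCategory.Q A) :=
  preservesColimitsOfShape_of_equiv (Discrete.equivalence (Equiv.ulift.{u} (α := ℕ))) _

end CountableCoproducts

section TelescopeOfIsos

variable {T : Type*} [Category* T] [HasZeroObject T] [HasShift T ℤ] [Preadditive T]
  [∀ n : ℤ, (shiftFunctor T n).Additive] [Pretriangulated T]

/-- For a sequence of isomorphisms, `t = 1 - s` is a split mono with cokernel `X 0`: `σ` is a left
inverse of `t`, and `r` carries every summand back to `X 0`. -/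
lemma isIso_inj_zero_comp_of_telescope {X : ℕ → T} (s : ∀ k, X k ⟶ X (k + 1)) [∀ k, IsIso (s k)]
    {c : Cofan X} (hc : IsColimit c) {t : c.pt ⟶ c.pt}
    (ht : ∀ k, c.inj k ≫ t = c.inj k - s k ≫ c.inj (k + 1)) {Z : T} {π : c.pt ⟶ Z}
    {h : Z ⟶ c.pt⟦(1 : ℤ)⟧} (hT : Triangle.mk t π h ∈ distTriang T) :
    IsIso (c.inj 0 ≫ π) := by
  let σ' (k : ℕ) : X k ⟶ c.pt := Nat.rec 0 (fun k σk => inv (s k) ≫ (σk - c.inj k)) k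
  let r' (k : ℕ) : X k ⟶ X 0 := Nat.rec (𝟙 _) (fun k rk => inv (s k) ≫ rk) k
  have hσ' (k : ℕ) : s k ≫ σ' (k + 1) = σ' k - c.inj k := IsIso.hom_inv_id_assoc _ _
  have hr' (k : ℕ) : s k ≫ r' (k + 1) = r' k := IsIso.hom_inv_id_assoc _ _
  let σ : c.pt ⟶ c.pt := Cofan.IsColimit.desc hc σ'
  let r : c.pt ⟶ X 0 := Cofan.IsColimit.desc hc r'
  have hσ (k : ℕ) : c.inj k ≫ σ = σ' k := Cofan.IsColimit.fac hc _ k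
  have hr (k : ℕ) : c.inj k ≫ r = r' k := Cofan.IsColimit.fac hc _ k
  have htσ : t ≫ σ = 𝟙 _ := Cofan.IsColimit.hom_ext hc _ _ fun k => by
    rw [← Category.assoc, ht, Preadditive.sub_comp, Category.assoc, hσ, hσ, hσ', Category.comp_id,
      sub_sub_cancel]
  have htr : t ≫ r = 0 := Cofan.IsColimit.hom_ext hc _ _ fun k => by
    rw [← Category.assoc, ht, Preadditive.sub_comp, Category.assoc, hr, hr, hr', sub_self, comp_zero]
  have htπ : t ≫ π = 0 := comp_distTriang_mor_zero₁₂ _ hT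
  have hπ (k : ℕ) : s k ≫ c.inj (k + 1) ≫ π = c.inj k ≫ π := by
    have h1 := ht k =≫ π
    rw [Category.assoc, htπ, comp_zero, Preadditive.sub_comp, Category.assoc, eq_comm, sub_eq_zero] at h1
    exact h1.symm
  have hmono : Mono t := mono_of_mono_fac htσ
  have hepi : Epi π := (Triangle.mor₃_eq_zero_iff_epi₂ _ hT).1
    ((Triangle.mor₃_eq_zero_iff_mono₁ _ hT).2 hmono)
  obtain ⟨ρ, hρ⟩ : ∃ ρ : Z ⟶ X 0, r = π ≫ ρ := Triangle.yoneda_exact₂ _ hT r htr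
  have hr0 : r ≫ c.inj 0 ≫ π = π := Cofan.IsColimit.hom_ext hc _ _ fun k => by
    rw [← Category.assoc, hr]
    induction k with
    | zero => exact Category.id_comp _
    | succ k ih => rw [← cancel_epi (s k), ← Category.assoc, hr', ih, hπ]
  refine ⟨ρ, ?_, ?_⟩
  · rw [Category.assoc, ← hρ, hr]
    rfl
  · rw [← cancel_epi π, ← Category.assoc, ← hρ, hr0, Category.comp_id]

end TelescopeOfIsos

section Telescope

variable {C : Type*} [Category* C] [Preadditive C] [HasCoproductsOfShape ℕ C]
  {X : ℕ → C} (s : ∀ k, X k ⟶ X (k + 1))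

/-- The endomorphism `1 - s` of the coproduct of a sequence. -/
noncomputable def telescope : ∐ X ⟶ ∐ X :=
  Sigma.desc fun k => Sigma.ι X k - s k ≫ Sigma.ι X (k + 1)

lemma ι_telescope (k : ℕ) :
    Sigma.ι X k ≫ telescope s = Sigma.ι X k - s k ≫ Sigma.ι X (k + 1) := by
  simp [telescope]

lemma telescope_π_zero (_ : DecidableEq ℕ) : telescope s ≫ Sigma.π X 0 = Sigma.π X 0 := by
  refine Sigma.hom_ext _ _ fun k => ?_
  rw [← Category.assoc, ι_telescope, Preadditive.sub_comp, Category.assoc,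
    Sigma.ι_π_of_ne X (Nat.succ_ne_zero k), comp_zero, sub_zero]

lemma telescope_π_succ (_ : DecidableEq ℕ) (k : ℕ) :
    telescope s ≫ Sigma.π X (k + 1) = Sigma.π X (k + 1) - Sigma.π X k ≫ s k := by
  refine Sigma.hom_ext _ _ fun j => ?_
  rw [← Category.assoc, ι_telescope, Preadditive.sub_comp, Category.assoc, Preadditive.comp_sub]
  congr 1
  by_cases h : j = k
  · subst h
    simp
  · rw [Sigma.ι_π_of_ne X (by lia), ← Category.assoc, Sigma.ι_π_of_ne X h, comp_zero, zero_comp]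

end Telescope

section SequentialColimit

section

variable {C : Type*} [Category* C] [HasColimitsOfShape ℕ C] {X : ℕ → C}
  (s : ∀ k, X k ⟶ X (k + 1))

/-- The colimit of a sequence of morphisms. -/
noncomputable def seqColimit : C := colimit (Functor.ofSequence s)

/-- The inclusions into the colimit of a sequence. -/
noncomputable def seqColimit.ι (k : ℕ) : X k ⟶ seqColimit s := colimit.ι (Functor.ofSequence s) k

lemma seqColimit.comp_ι (k : ℕ) : s k ≫ seqColimit.ι s (k + 1) = seqColimit.ι s k := by
  have := colimit.w (Functor.ofSequence s) (homOfLE (Nat.le_add_right k 1))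
  rwa [Functor.ofSequence_map_homOfLE_succ] at this

lemma seqColimit.hom_ext {W : C} {f g : seqColimit s ⟶ W}
    (h : ∀ k, seqColimit.ι s k ≫ f = seqColimit.ι s k ≫ g) : f = g :=
  colimit.hom_ext h

lemma seqColimit.exists_desc {W : C} (φ : ∀ k, X k ⟶ W) (h : ∀ k, s k ≫ φ (k + 1) = φ k) :
    ∃ f : seqColimit s ⟶ W, ∀ k, seqColimit.ι s k ≫ f = φ k :=
  ⟨colimit.desc (Functor.ofSequence s)
    { pt := W
      ι := NatTrans.ofSequence φ fun k => by
        rw [Functor.ofSequence_map_homOfLE_succ]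
        exact (h k).trans (Category.comp_id _).symm }, fun k => colimit.ι_desc _ k⟩

variable [Preadditive C] [HasCoproductsOfShape ℕ C]

/-- The canonical map from the coproduct to the colimit of a sequence. -/
noncomputable def sigmaToSeqColimit : ∐ X ⟶ seqColimit s := Sigma.desc (seqColimit.ι s)

omit [Preadditive C] in
lemma ι_sigmaToSeqColimit (k : ℕ) : Sigma.ι X k ≫ sigmaToSeqColimit s = seqColimit.ι s k := by
  simp [sigmaToSeqColimit]

lemma telescope_sigmaToSeqColimit : telescope s ≫ sigmaToSeqColimit s = 0 := by
  refine Sigma.hom_ext _ _ fun k => ?_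
  rw [← Category.assoc, ι_telescope, Preadditive.sub_comp, Category.assoc, ι_sigmaToSeqColimit,
    ι_sigmaToSeqColimit, seqColimit.comp_ι, sub_self, comp_zero]

lemma exists_desc_of_telescope {W : C} (φ : ∐ X ⟶ W) (hφ : telescope s ≫ φ = 0) :
    ∃ f : seqColimit s ⟶ W, sigmaToSeqColimit s ≫ f = φ := by
  obtain ⟨f, hf⟩ := seqColimit.exists_desc s (fun k => Sigma.ι X k ≫ φ) fun k => by
    have := Sigma.ι X k ≫= hφ
    rw [← Category.assoc, ι_telescope, Preadditive.sub_comp, Category.assoc, comp_zero,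
      sub_eq_zero] at this
    exact this.symm
  exact ⟨f, Sigma.hom_ext _ _ fun k => by rw [← Category.assoc, ι_sigmaToSeqColimit, hf]⟩

omit [Preadditive C] in
lemma epi_sigmaToSeqColimit : Epi (sigmaToSeqColimit s) :=
  ⟨fun f g h => seqColimit.hom_ext s fun k => by
    rw [← ι_sigmaToSeqColimit, Category.assoc, h, Category.assoc]⟩

end

section

variable {A : Type u} [Ring A] {α : Type*} {c : ComplexShape α}
  {X : ℕ → HomologicalComplex (ModuleCat.{u} A) c} (s : ∀ k, X k ⟶ X (k + 1))

/-- If `f ≫ (1 - s) = 0`, the zeroth component of `f` vanishes and each further component is the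
previous one composed with `s`. -/
lemma mono_telescope : Mono (telescope s) := by
  refine Preadditive.mono_of_cancel_zero _ fun {L} f hf => ?_
  refine sigma_hom_ext X f ?_
  generalize (fun a b : ℕ => Classical.propDecidable (a = b)) = inst
  intro k
  induction k with
  | zero => rw [← telescope_π_zero s inst, ← Category.assoc, hf, zero_comp]
  | succ k ih =>
    have h : f ≫ Sigma.π X k ≫ s k = 0 := by rw [← Category.assoc, ih, zero_comp]
    rw [← sub_zero (f ≫ _), ← h, ← Preadditive.comp_sub, ← telescope_π_succ s inst,
      ← Category.assoc, hf, h, zero_comp]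

lemma shortExact_telescope : (ShortComplex.mk (telescope s) (sigmaToSeqColimit s)
    (telescope_sigmaToSeqColimit s)).ShortExact where
  exact := by
    have := epi_sigmaToSeqColimit s
    exact ShortComplex.exact_of_g_is_cokernel _ (CokernelCofork.IsColimit.ofπ' _ _ fun k hk =>
      ⟨(exists_desc_of_telescope s k hk).choose, (exists_desc_of_telescope s k hk).choose_spec⟩)
  mono_f := mono_telescope s
  epi_g := epi_sigmaToSeqColimit s

instance : PreservesColimitsOfShape ℕ (forget (ModuleCat.{u} A)) :=
  preservesColimitsOfShape_of_equiv (AsSmall.equiv : ℕ ≌ AsSmall.{u} ℕ).symm _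

lemma seqColimit.exists_rep (n : α) (x : (seqColimit s).X n) :
    ∃ (k : ℕ) (y : (X k).X n), (seqColimit.ι s k).f n y = x :=
  Concrete.isColimit_exists_rep (Functor.ofSequence s ⋙ HomologicalComplex.eval _ c n)
    (isColimitOfPreserves (HomologicalComplex.eval (ModuleCat.{u} A) c n)
      (colimit.isColimit (Functor.ofSequence s))) x

lemma injective_ofSequence_map_f (hs : ∀ k, Mono (s k)) (n : α) {k l : ℕ} (h : k ⟶ l) :
    Function.Injective (((Functor.ofSequence s).map h).f n) := by
  obtain ⟨m, rfl⟩ := Nat.exists_eq_add_of_le (leOfHom h)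
  have : Mono ((Functor.ofSequence s).map h) := by
    induction m with
    | zero =>
      obtain rfl : h = 𝟙 _ := Subsingleton.elim _ _
      infer_instance
    | succ m ih =>
      have := ih (homOfLE (Nat.le_add_right k m))
      have : Mono ((Functor.ofSequence s).map (homOfLE (Nat.le_add_right (k + m) 1))) := by
        rw [Functor.ofSequence_map_homOfLE_succ]
        exact hs _
      obtain rfl : h = homOfLE (Nat.le_add_right k m) ≫ homOfLE (Nat.le_add_right (k + m) 1) :=
        Subsingleton.elim _ _
      rw [Functor.map_comp]
      infer_instance
  exact (ModuleCat.mono_iff_injective _).1 inferInstance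

lemma seqColimit.ι_f_injective (hs : ∀ k, Mono (s k)) (n : α) (k : ℕ) :
    Function.Injective ((seqColimit.ι s k).f n) := by
  intro x y hxy
  obtain ⟨l, f, g, h⟩ := Concrete.isColimit_exists_of_rep_eq
    (Functor.ofSequence s ⋙ HomologicalComplex.eval _ c n)
    (isColimitOfPreserves (HomologicalComplex.eval (ModuleCat.{u} A) c n)
      (colimit.isColimit (Functor.ofSequence s))) (i := k) (j := k) x y hxy
  obtain rfl : f = g := Subsingleton.elim _ _
  exact injective_ofSequence_map_f s hs n f h

lemma seqColimit.range_ι_mono (n : α) :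
    Monotone fun k => LinearMap.range ((seqColimit.ι s k).f n).hom :=
  monotone_nat_of_le_succ fun k => by
    rintro _ ⟨x, rfl⟩
    exact ⟨(s k).f n x, congr(($(seqColimit.comp_ι s k)).f n x)⟩

lemma seqColimit.exists_factor (hs : ∀ k, Mono (s k)) (n : α) {N : Type*} [AddCommGroup N]
    [Module A N] [Module.Finite A N] (g : N →ₗ[A] (seqColimit s).X n) :
    ∃ (k : ℕ) (d : N →ₗ[A] (X k).X n), ∀ x, (seqColimit.ι s k).f n (d x) = g x := by
  obtain ⟨S, hS⟩ := Module.Finite.fg_top (R := A) (M := N)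
  choose k y hy using fun x : N => seqColimit.exists_rep s n (g x)
  have h : (⊤ : Submodule A N) ≤
      (LinearMap.range ((seqColimit.ι s (S.sup k)).f n).hom).comap g := by
    rw [← hS, Submodule.span_le]
    exact fun x hx => seqColimit.range_ι_mono s n (Finset.le_sup hx) ⟨y x, hy x⟩
  obtain ⟨d, hd⟩ := exists_comp_eq_of_exact ((seqColimit.ι s (S.sup k)).f n).hom
    (LinearMap.range ((seqColimit.ι s (S.sup k)).f n).hom).mkQ
    (seqColimit.ι_f_injective s hs n _)
    (fun x => (Submodule.Quotient.mk_eq_zero _)) g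
    (fun x => (Submodule.Quotient.mk_eq_zero _).2 (h trivial))
  exact ⟨_, d, hd⟩

/-- A map from a finitely generated module factors through some stage `k`; the passage to stage `k +
1` goes through an injective module, to which the map extends. -/
lemma isFPInjective_seqColimit (hs : ∀ k, Mono (s k)) (n : α)
    (hI : ∀ k, ∃ (I : ModuleCat.{u} A) (a : (X k).X n ⟶ I) (b : I ⟶ (X (k + 1)).X n),
      Injective I ∧ a ≫ b = (s k).f n) : IsFPInjective A ((seqColimit s).X n) := by
  intro S hS h₁ _ _ g
  have : Module.FinitePresentation A S.X₁ := h₁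
  have := hS.mono_f
  obtain ⟨k, d, hd⟩ := seqColimit.exists_factor s hs n g.hom
  obtain ⟨I, a, b, _, hab⟩ := hI k
  refine ⟨Injective.factorThru (ModuleCat.ofHom d ≫ a) S.f ≫ b ≫ (seqColimit.ι s (k + 1)).f n, ?_⟩
  rw [← Category.assoc, Injective.comp_factorThru, Category.assoc, ← Category.assoc a, hab,
    ← HomologicalComplex.comp_f, seqColimit.comp_ι]
  ext x
  exact hd x

end

end SequentialColimit

/-! ### Every object is represented by a complex of injectives -/

section Resolution

variable {A : Type u} [Ring A]

lemma isIso_Q_map_seqColimit_ι {X : ℕ → CochainComplex (ModuleCat.{u} A) ℤ}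
    (s : ∀ k, X k ⟶ X (k + 1)) (hs : ∀ k, IsIso ((CoderivedCategory.Q A).map (s k))) :
    IsIso ((CoderivedCategory.Q A).map (seqColimit.ι s 0)) := by
  let Q := CoderivedCategory.Q A
  obtain ⟨h, hT⟩ := exists_distinguished_of_shortExact _ (shortExact_telescope s)
  have hc : IsColimit (Cofan.mk (Q.obj (∐ X)) fun k => Q.map (Sigma.ι X k)) :=
    isColimitCofanMkObjOfIsColimit Q X _ (coproductIsCoproduct X)
  have := isIso_inj_zero_comp_of_telescope (fun k => Q.map (s k)) hc (fun k => by
    change Q.map (Sigma.ι X k) ≫ Q.map (telescope s) =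
      Q.map (Sigma.ι X k) - Q.map (s k) ≫ Q.map (Sigma.ι X (k + 1))
    rw [← Q.map_comp, ι_telescope, Q.map_sub, Q.map_comp]) hT
  rw [← ι_sigmaToSeqColimit, Functor.map_comp]
  exact this

lemma isFPInjective_pi (J : ℕ → ModuleCat.{u} A) (hJ : ∀ k, IsFPInjective A (J k)) :
    IsFPInjective A (∏ᶜ J) := by
  intro S hS h₁ h₂ h₃ g
  choose h hh using fun k => hJ k S hS h₁ h₂ h₃ (g ≫ Pi.π J k)
  exact ⟨Pi.lift h, Pi.hom_ext _ _ fun k => by rw [Category.assoc, Pi.lift_π, hh]⟩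

/-- Without a uniform bound, the product of counterexamples for all `N` is fp-injective, and has
each of them as a retract, so it would have infinite injective dimension. -/
lemma exists_hasInjectiveDimensionLE_of_isFPInjective
    (H : FPInjectivesHaveFiniteInjectiveDimension A) :
    ∃ N : ℕ, ∀ J : ModuleCat.{u} A, IsFPInjective A J → HasInjectiveDimensionLE J N := by
  by_contra! hN
  choose J hJ hJ' using hN
  obtain ⟨N, hN⟩ := H _ (isFPInjective_pi J hJ)
  exact hJ' N (Retract.hasInjectiveDimensionLT (Y := ∏ᶜ J)
    { i := Pi.ι J N, r := Pi.π J N, retract := Pi.ι_π_eq_id J N } _)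

lemma injectivelyResolved_Q_obj (H : FPInjectivesHaveFiniteInjectiveDimension A)
    (X : CochainComplex (ModuleCat.{u} A) ℤ) :
    injectivelyResolved A ((CoderivedCategory.Q A).obj X) := by
  obtain ⟨N, hN⟩ := exists_hasInjectiveDimensionLE_of_isFPInjective H
  choose E j hj hQ hI using exists_effaceable_embedding (A := A)
  let Y (k : ℕ) : CochainComplex (ModuleCat.{u} A) ℤ := Nat.rec X (fun _ => E) k
  let s (k : ℕ) : Y k ⟶ Y (k + 1) := j (Y k)
  have := isIso_Q_map_seqColimit_ι s fun k => hQ (Y k)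
  let e : (CoderivedCategory.Q A).obj (Y 0) ≅ (CoderivedCategory.Q A).obj (seqColimit s) :=
    @asIso _ _ _ _ ((CoderivedCategory.Q A).map (seqColimit.ι s 0)) this
  refine (injectivelyResolved A).prop_of_iso e.symm
    (injectivelyResolved_of_hasInjectiveDimensionLE N _ fun n => hN _ ?_)
  exact isFPInjective_seqColimit s (fun k => hj (Y k)) n fun k => hI (Y k) n

lemma injectivelyResolved_of_fpInjectivesHaveFiniteInjectiveDimension
    (H : FPInjectivesHaveFiniteInjectiveDimension A) (X : CoderivedCategory A) :
    injectivelyResolved A X :=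
  (injectivelyResolved A).prop_of_iso ((CoderivedCategory.Q A).objObjPreimageIso X)
    (injectivelyResolved_Q_obj H _)

end Resolution

/-! ### Stalks of finitely presented modules generate -/

section Generators

open CochainComplex HomComplex

variable {A : Type u} [Ring A]

lemma iCycles_comp_toCycles {C : Type*} [Category* C] [Abelian C]
    (I : CochainComplex C ℤ) (p q : ℤ) : I.iCycles p ≫ I.toCycles p q = 0 := by
  rw [← cancel_mono (I.iCycles q), Category.assoc, I.toCycles_i, I.iCycles_d, zero_comp]

lemma exact_iCycles_toCycles {C : Type*} [Category* C] [Abelian C]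
    (I : CochainComplex C ℤ) (p q : ℤ) (hpq : p + 1 = q) :
    (ShortComplex.mk (I.iCycles p) (I.toCycles p q) (iCycles_comp_toCycles I p q)).Exact :=
  ShortComplex.exact_of_f_is_kernel _ (KernelFork.IsLimit.ofι' _ _ fun k hk =>
    ⟨I.liftCycles k q ((ComplexShape.up ℤ).next_eq' hpq)
      (by rw [← I.toCycles_i p q, ← Category.assoc, hk, zero_comp]), I.liftCycles_i _ _ _ _⟩)

/-- The complex breaks into short exact sequences of cycles, which split; the contraction projects
to the cycles and then applies the section of `I.toCycles`. -/
lemma nonempty_homotopy_id_zero_of_cycles {C : Type*} [Category* C] [Abelian C]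
    (I : CochainComplex C ℤ) (hI : ∀ n, Injective (I.cycles n))
    (hepi : ∀ p q : ℤ, p + 1 = q → Epi (I.toCycles p q)) : Nonempty (Homotopy (𝟙 I) 0) := by
  have hr (n : ℤ) : ∃ r : I.X n ⟶ I.cycles n, I.iCycles n ≫ r = 𝟙 _ :=
    ⟨Injective.factorThru (𝟙 _) (I.iCycles n), Injective.comp_factorThru _ _⟩
  choose r hr using hr
  have hs (p q : ℤ) (hpq : p + 1 = q) : ∃ s : I.cycles q ⟶ I.X p,
      I.toCycles p q ≫ s = 𝟙 _ - r p ≫ I.iCycles p := by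
    have := hepi p q hpq
    have hS := exact_iCycles_toCycles I p q hpq
    exact ⟨hS.desc _ (by
      rw [Preadditive.comp_sub, ← Category.assoc, hr, Category.id_comp, Category.comp_id, sub_self]), hS.g_desc _ _⟩
  choose s hs using hs
  have hs' (p q : ℤ) (hpq : p + 1 = q) : s p q hpq ≫ I.toCycles p q = 𝟙 _ := by
    have := hepi p q hpq
    rw [← cancel_epi (I.toCycles p q), ← Category.assoc, hs, Preadditive.sub_comp,
      Category.assoc, iCycles_comp_toCycles, comp_zero, sub_zero, Category.id_comp, Category.comp_id]
  let z : Cochain I I (-1) := Cochain.mk fun p q hpq => r p ≫ s q p (by lia)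
  have hz (p q : ℤ) (hpq : p + (-1) = q) : z.v p q hpq = r p ≫ s q p (by lia) := rfl
  refine ⟨(Cochain.equivHomotopy _ _).symm ⟨z, ?_⟩⟩
  ext p
  rw [δ_neg_one_cochain]
  have h₁ : (ComplexShape.up ℤ).Rel (p - 1) p := by simp
  have h₂ : (ComplexShape.up ℤ).Rel p (p + 1) := by simp
  simp only [Cochain.ofHom_v, Cochain.add_v, Homotopy.nullHomotopicMap'_f h₁ h₂, hz,
    HomologicalComplex.id_f, HomologicalComplex.zero_f, add_zero]
  rw [← I.toCycles_i p (p + 1), ← I.toCycles_i (p - 1) p, Category.assoc,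
    ← Category.assoc (I.iCycles _), hr, Category.id_comp, hs, Category.assoc,
    ← Category.assoc (s _ _ _), hs', Category.id_comp]
  simp

/-- A complex is fp-exact if morphisms from finitely presented modules into its cycles lift. -/
def IsFPExact (I : CochainComplex (ModuleCat.{u} A) ℤ) : Prop :=
  ∀ (M : ModuleCat.{u} A), isFPModule A M → ∀ (p q : ℤ), p + 1 = q → ∀ f : M ⟶ I.X q,
    f ≫ I.d q (q + 1) = 0 → ∃ g : M ⟶ I.X p, g ≫ I.d p q = f

lemma IsFPExact.epi_toCycles {I : CochainComplex (ModuleCat.{u} A) ℤ} (hI : IsFPExact I)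
    (p q : ℤ) (hpq : p + 1 = q) : Epi (I.toCycles p q) := by
  rw [ModuleCat.epi_iff_surjective]
  intro z
  obtain ⟨g, hg⟩ := hI (ModuleCat.of A A) (inferInstanceAs (Module.FinitePresentation A A)) p q hpq
    (ModuleCat.ofHom (LinearMap.toSpanSingleton A _ z) ≫ I.iCycles q) (by simp)
  refine ⟨g.hom 1, (ModuleCat.mono_iff_injective (I.iCycles q)).1 inferInstance ?_⟩
  have h₁ : I.iCycles q (I.toCycles p q (g.hom 1)) = I.d p q (g.hom 1) :=
    congr(($(I.toCycles_i p q)).hom (g.hom 1))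
  have h₂ : I.d p q (g.hom 1) = I.iCycles q ((1 : A) • z) := congr(($hg).hom 1)
  rw [h₁, h₂, one_smul]

/-- Extend `g` to a map `h` into the injective term. Its differential factors through `S.X₃` as a
map into cycles, so fp-exactness provides the correction that moves `h` into the cycles. -/
lemma IsFPExact.isFPInjective_cycles {I : CochainComplex (ModuleCat.{u} A) ℤ} (hI : IsFPExact I)
    (hI' : HasInjectiveTerms I) (n : ℤ) : IsFPInjective A (I.cycles n) := by
  intro S hS _ _ h₃ g
  have := hI' n
  have := hS.mono_f
  have := hS.epi_g
  let h : S.X₂ ⟶ I.X n := Injective.factorThru (g ≫ I.iCycles n) S.f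
  have hh : S.f ≫ h = g ≫ I.iCycles n := Injective.comp_factorThru _ _
  obtain ⟨l, hl⟩ : ∃ l : S.X₃ ⟶ I.X (n + 1), S.g ≫ l = h ≫ I.d n (n + 1) :=
    ⟨hS.exact.desc _ (by rw [← Category.assoc, hh, Category.assoc, I.iCycles_d, comp_zero]),
      hS.exact.g_desc _ _⟩
  obtain ⟨k, hk⟩ := hI S.X₃ h₃ n (n + 1) rfl l (by
    rw [← cancel_epi S.g, ← Category.assoc, hl, Category.assoc, I.d_comp_d, comp_zero, comp_zero])
  refine ⟨I.liftCycles (h - S.g ≫ k) (n + 1) ((ComplexShape.up ℤ).next_eq' rfl)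
    (by rw [Preadditive.sub_comp, Category.assoc, hk, hl, sub_self]), ?_⟩
  rw [← cancel_mono (I.iCycles n), Category.assoc, I.liftCycles_i, Preadditive.comp_sub, hh,
    ← Category.assoc, S.zero, zero_comp, sub_zero]

/-- The cycles in degree `n` are a cosyzygy of those in degree `n - 1`. A bound on injective
dimension valid in all degrees can thus be lowered step by step to zero. -/
lemma IsFPExact.isZero_Q_obj (H : FPInjectivesHaveFiniteInjectiveDimension A)
    {I : CochainComplex (ModuleCat.{u} A) ℤ} (hI : IsFPExact I) (hI' : HasInjectiveTerms I) :
    IsZero ((CoderivedCategory.Q A).obj I) := by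
  obtain ⟨N, hN⟩ := exists_hasInjectiveDimensionLE_of_isFPInjective H
  have hinj (n : ℤ) : Injective (I.cycles n) := by
    have h (n : ℤ) : HasInjectiveDimensionLT (I.cycles n) (N + 1) :=
      hN _ (hI.isFPInjective_cycles hI' n)
    clear hN
    rw [injective_iff_hasInjectiveDimensionLT_one]
    induction N generalizing n with
    | zero => exact h n
    | succ N ih =>
      refine ih n fun n => ?_
      have := hI.epi_toCycles (n - 1) n (by lia)
      have hS : (ShortComplex.mk (I.iCycles (n - 1)) (I.toCycles (n - 1) n)
          (iCycles_comp_toCycles _ _ _)).ShortExact :=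
        { exact := exact_iCycles_toCycles I (n - 1) n (by lia) }
      exact (hS.hasInjectiveDimensionLT_X₃_iff N (hI' _)).2 (h _)
  obtain ⟨h⟩ := nonempty_homotopy_id_zero_of_cycles I hinj hI.epi_toCycles
  refine Functor.map_isZero (coacyclic A).trW.Q ?_
  rw [IsZero.iff_id_eq_zero, ← CategoryTheory.Functor.map_id]
  exact HomotopyCategory.eq_of_homotopy _ _ h

lemma isBoundedFP_single {M : ModuleCat.{u} A} (hM : isFPModule A M) (n : ℤ) :
    IsBoundedFP ((HomologicalComplex.single _ (ComplexShape.up ℤ) n).obj M) := by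
  refine ⟨⟨n, n, ?_, ?_⟩, fun i => ?_⟩
  · rw [CochainComplex.isStrictlyGE_iff]
    exact fun i hi => HomologicalComplex.isZero_single_obj_X _ _ _ _ (by lia)
  · rw [CochainComplex.isStrictlyLE_iff]
    exact fun i hi => HomologicalComplex.isZero_single_obj_X _ _ _ _ (by lia)
  · by_cases hi : i = n
    · exact (isFPModule A).prop_of_iso
        (HomologicalComplex.singleObjXIsoOfEq _ _ _ _ hi).symm hM
    · exact isFPModule_of_isZero (HomologicalComplex.isZero_single_obj_X _ _ _ _ hi)

lemma exists_lift_of_quotient_map_eq_zero {C : Type*} [Category* C] [Abelian C]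
    {K : CochainComplex C ℤ} {M : C} {p q : ℤ} (hpq : p + 1 = q)
    (φ : (HomologicalComplex.single _ (ComplexShape.up ℤ) q).obj M ⟶ K)
    (hφ : (HomotopyCategory.quotient _ _).map φ = 0) :
    ∃ g : M ⟶ K.X p, g ≫ K.d p q = (HomologicalComplex.singleObjXSelf _ q M).inv ≫ φ.f q := by
  subst hpq
  rw [HomotopyCategory.quotient_map_eq_zero_iff] at hφ
  obtain ⟨hφ⟩ := hφ
  refine ⟨(HomologicalComplex.singleObjXSelf _ _ M).inv ≫ hφ.hom (p + 1) p, ?_⟩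
  have h := hφ.comm (p + 1)
  rw [prevD_eq hφ.hom (show (ComplexShape.up ℤ).Rel p (p + 1) from rfl),
    dNext_eq hφ.hom (show (ComplexShape.up ℤ).Rel (p + 1) (p + 1 + 1) from rfl)] at h
  rw [HomologicalComplex.single_obj_d, zero_comp, zero_add, HomologicalComplex.zero_f, add_zero] at h
  rw [Category.assoc, h]

lemma isFPExact_of_forall_eq_zero {I : CochainComplex (ModuleCat.{u} A) ℤ}
    (hI : HasInjectiveTerms I)
    (h : ∀ (M : ModuleCat.{u} A), isFPModule A M → ∀ (n : ℤ)
      (f : (CoderivedCategory.Q A).obj ((HomologicalComplex.single _ _ n).obj M) ⟶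
        (CoderivedCategory.Q A).obj I), f = 0) : IsFPExact I := by
  rintro M hM p q hpq f hf
  let φ : (HomologicalComplex.single _ _ q).obj M ⟶ I :=
    HomologicalComplex.mkHomFromSingle f (by rintro _ rfl; exact hf)
  have hφ : (HomotopyCategory.quotient _ _).map φ = 0 := by
    refine (hI.Q_map_bijective _).1 ?_
    rw [Functor.map_zero]
    exact h M hM _ ((CoderivedCategory.Q A).map φ)
  obtain ⟨g, hg⟩ := exists_lift_of_quotient_map_eq_zero hpq φ hφ
  exact ⟨g, by rw [hg, HomologicalComplex.mkHomFromSingle_f, Iso.inv_hom_id_assoc]⟩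

lemma nonempty_Q_single_iso_shift (M : ModuleCat.{u} A) (n m : ℤ) :
    Nonempty ((CoderivedCategory.Q A).obj ((HomologicalComplex.single _ _ n).obj M) ≅
      ((CoderivedCategory.Q A).obj ((HomologicalComplex.single _ _ (n + m)).obj M))⟦m⟧) := by
  let e : ((HomologicalComplex.single _ (ComplexShape.up ℤ) (n + m)).obj M)⟦m⟧ ≅
      (HomologicalComplex.single _ (ComplexShape.up ℤ) n).obj M :=
    ((CochainComplex.singleFunctors (ModuleCat.{u} A)).shiftIso m n (n + m) (add_comm _ _)).app _
  exact ⟨(CoderivedCategory.Q A).mapIso e.symm ≪≫ ((CoderivedCategory.Q A).commShiftIso m).app _⟩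

variable (A) in
/-- An index set for representatives of the stalk complexes of finitely presented modules. -/
abbrev StalkIndex : Type u :=
  ℤ × (Σ n : ℕ, {N : Submodule A (Fin n → A) // N.FG})

variable (A) in
/-- The finitely presented module given by a presentation. -/
def StalkIndex.module (i : StalkIndex A) : ModuleCat.{u} A :=
  ModuleCat.of A ((Fin i.2.1 → A) ⧸ i.2.2.1)

variable (A) in
/-- The stalk complexes of finitely presented modules in the coderived category. -/
noncomputable def stalk (i : StalkIndex A) : CoderivedCategory A :=
  (CoderivedCategory.Q A).obj ((HomologicalComplex.single _ _ i.1).obj i.module)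

lemma StalkIndex.isFPModule_module (i : StalkIndex A) : isFPModule A (StalkIndex.module A i) :=
  Module.finitePresentation_of_surjective i.2.2.1.mkQ i.2.2.1.mkQ_surjective
    (i.2.2.1.ker_mkQ.symm ▸ i.2.2.2)

lemma exists_stalkIndex_iso {M : ModuleCat.{u} A} (hM : isFPModule A M) (n : ℤ) :
    ∃ i : StalkIndex A, i.1 = n ∧ Nonempty (StalkIndex.module A i ≅ M) := by
  have : Module.FinitePresentation A M := hM
  obtain ⟨k, π, hπ⟩ := Module.Finite.exists_fin' A M
  exact ⟨⟨n, k, LinearMap.ker π, Module.FinitePresentation.fg_ker π hπ⟩, rfl,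
    ⟨(π.quotKerEquivOfSurjective hπ).toModuleIso⟩⟩

lemma boundedFP_stalk (i : StalkIndex A) : boundedFP A (stalk A i) :=
  (boundedFP_iff _).2 ⟨_, isBoundedFP_single i.isFPModule_module i.1, ⟨Iso.refl _⟩⟩

lemma isZero_of_forall_stalk (H : FPInjectivesHaveFiniteInjectiveDimension A)
    (X : CoderivedCategory A) (hX : ∀ (i : StalkIndex A) (f : stalk A i ⟶ X), f = 0) :
    IsZero X := by
  obtain ⟨I, hI, ⟨e⟩⟩ := injectivelyResolved_of_fpInjectivesHaveFiniteInjectiveDimension H X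
  refine IsZero.of_iso (IsFPExact.isZero_Q_obj H (isFPExact_of_forall_eq_zero hI ?_) hI) e.symm
  intro M hM n f
  obtain ⟨i, rfl, ⟨e'⟩⟩ := exists_stalkIndex_iso hM n
  have : (CoderivedCategory.Q A).map ((HomologicalComplex.single _ _ i.1).map e'.hom) ≫
      f ≫ e.hom = 0 := hX i _
  rwa [Preadditive.IsIso.comp_left_eq_zero, Preadditive.IsIso.comp_right_eq_zero] at this

lemma isCompactlyGeneratedTriangulated_coderivedCategory [IsLeftCoherentRing A]
    (H : FPInjectivesHaveFiniteInjectiveDimension A) :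
    IsCompactlyGeneratedTriangulated.{u} (CoderivedCategory A) := by
  refine ⟨inferInstance, StalkIndex A, stalk A, fun i => isCompactObj_of_boundedFP (boundedFP_stalk i),
    fun X hX => isZero_of_forall_stalk H X fun i f => ?_⟩
  have := hX i 0 (f ≫ (shiftFunctorZero (CoderivedCategory A) ℤ).inv.app X)
  rwa [Preadditive.IsIso.comp_right_eq_zero] at this

end Generators

/-! ### Compact objects as retracts -/

section CompactRetract

variable {T : Type u} [Category.{v} T] [Preadditive T]

lemma IsCompactObj.isFinitelySupported_nat [HasCoproducts.{w} T] {X : T}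
    (hX : IsCompactObj.{w} X) {Y : ℕ → T} [HasCoproduct Y] (f : X ⟶ ∐ Y) :
    IsFinitelySupported f := by
  let Y' : ULift.{w} ℕ → T := fun i => Y i.down
  let φ : ∐ Y ⟶ ∐ Y' := Sigma.desc fun k => Sigma.ι Y' ⟨k⟩
  let ψ : ∐ Y' ⟶ ∐ Y := Sigma.desc fun i => Sigma.ι Y i.down
  have h : f = (f ≫ φ) ≫ ψ := by
    have : φ ≫ ψ = 𝟙 _ := Sigma.hom_ext _ _ fun k => by simp [φ, ψ, Y']
    rw [Category.assoc, this, Category.comp_id]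
  rw [h]
  refine (hX.isFinitelySupported (f ≫ φ)).comp_map ψ fun i => ?_
  have : Sigma.ι Y' i ≫ ψ = 𝟙 (Y i.down) ≫ Sigma.ι Y i.down := by simp [ψ, Y']
  rw [this]
  exact .comp_ι _

variable [HasZeroObject T] [HasShift T ℤ] [∀ n : ℤ, (shiftFunctor T n).Additive]
  [Pretriangulated T]

/-- After subtracting the finite part of `f` seen by `D.obj₁`, the remainder factors through
`D.obj₃`. -/
lemma isCompactObj_obj₂ [HasCoproducts.{w} T] {D : Triangle T} (hD : D ∈ distTriang T)
    (h₁ : IsCompactObj.{w} D.obj₁) (h₃ : IsCompactObj.{w} D.obj₃) : IsCompactObj.{w} D.obj₂ := by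
  classical
  refine isCompactObj_of_isFinitelySupported fun {ι} Y f => ?_
  obtain ⟨J, hJ⟩ := h₁.isFinitelySupported (D.mor₁ ≫ f)
  let g := ∑ j ∈ J, f ≫ Sigma.π Y j ≫ Sigma.ι Y j
  obtain ⟨k, hk⟩ := Triangle.yoneda_exact₂ D hD (f - g) (by
    rw [Preadditive.comp_sub, sub_eq_zero, Preadditive.comp_sum, hJ]
    simp only [Category.assoc])
  rw [← sub_add_cancel f g, hk]
  refine .add ((h₃.isFinitelySupported k).precomp _) ?_
  exact Finset.sum_induction _ IsFinitelySupported (fun _ _ => .add) .zero fun j _ => by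
    rw [← Category.assoc]
    exact .comp_ι _

lemma IsFinitelySupported.exists_fac (P : ObjectProperty T) [P.IsTriangulated]
    [P.IsClosedUnderIsomorphisms] {ι : Type*} {Y : ι → T} [HasCoproduct Y] (hY : ∀ i, P (Y i))
    {X : T} {f : X ⟶ ∐ Y} (hf : IsFinitelySupported f) :
    ∃ (B : T) (g : X ⟶ B) (j : B ⟶ ∐ Y), P B ∧ g ≫ j = f := by
  classical
  obtain ⟨J, hJ⟩ := hf
  rw [hJ]
  clear hJ
  induction J using Finset.induction_on with
  | empty =>
    obtain ⟨Z, hZ, hPZ⟩ := P.exists_prop_of_containsZero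
    exact ⟨Z, 0, 0, hPZ, by simp⟩
  | insert a J ha ih =>
    obtain ⟨B, g, j, hB, hg⟩ := ih
    refine ⟨Y a ⊞ B, biprod.lift (f ≫ Sigma.π Y a) g, biprod.desc (Sigma.ι Y a) j,
      P.ext_of_isTriangulatedClosed₂ _ (binaryBiproductTriangle_distinguished (Y a) B) (hY a) hB, ?_⟩
    rw [Finset.sum_insert ha, ← hg, biprod.lift_desc, Category.assoc]

section

variable [HasCoproducts.{w} T] {ι : Type w} {G : ι → T} [∀ i X, Small.{w} (G i ⟶ X)]

variable (G) in
lemma exists_cone_of_all_maps (X : T) : ∃ (X' : T) (s : X ⟶ X') (κ : Type w) (a : κ → ι)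
    (p : (∐ fun k => G (a k)) ⟶ X) (h : X' ⟶ (∐ fun k => G (a k))⟦(1 : ℤ)⟧),
    Triangle.mk p s h ∈ distTriang T ∧ ∀ (i : ι) (f : G i ⟶ X), f ≫ s = 0 := by
  -- `Shrink` keeps the index type in the universe where coproducts exist.
  let κ : Type w := Σ i, Shrink.{w} (G i ⟶ X)
  let p : (∐ fun k : κ => G k.1) ⟶ X := Sigma.desc fun k => (equivShrink _).symm k.2
  obtain ⟨X', s, h, hT⟩ := distinguished_cocone_triangle p
  refine ⟨X', s, κ, Sigma.fst, p, h, hT, fun i f => ?_⟩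
  have hf : Sigma.ι (fun k : κ => G k.1) ⟨i, equivShrink _ f⟩ ≫ p = f := by simp [p]
  have hps : p ≫ s = 0 := comp_distTriang_mor_zero₁₂ _ hT
  rw [← hf, Category.assoc, hps, comp_zero]

end

section

variable [HasCoproductsOfShape ℕ T] {X : ℕ → T} {s : ∀ k, X k ⟶ X (k + 1)}

omit [HasZeroObject T] [HasShift T ℤ] [∀ n : ℤ, (shiftFunctor T n).Additive] [Pretriangulated T] in
lemma comp_telescope_eq_self {C : T} {f : C ⟶ ∐ X} (hf : IsFinitelySupported f)
    (hs : ∀ k (g : C ⟶ X k), g ≫ s k = 0) : f ≫ telescope s = f := by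
  classical
  obtain ⟨J, hJ⟩ := hf
  conv_lhs => rw [hJ]
  conv_rhs => rw [hJ]
  rw [Preadditive.sum_comp]
  refine Finset.sum_congr rfl fun k _ => ?_
  simp only [Category.assoc, ι_telescope, Preadditive.comp_sub]
  have h (q : ∐ X ⟶ X k) : f ≫ q ≫ s k ≫ Sigma.ι X (k + 1) = 0 := by
    simpa using hs k (f ≫ q) =≫ Sigma.ι X (k + 1)
  rw [h, sub_zero]

/-- On morphisms from generators `1 - s` acts as the identity, since `s` kills them. The long exact
sequence then shows that the cone receives no nonzero morphism from a generator. -/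
lemma isIso_telescope_of_generators {ι : Type*} {G : ι → T}
    (hG : ∀ i (f : G i ⟶ ∐ X), IsFinitelySupported f)
    (hshift : ∀ i, ∃ j, Nonempty (G i ≅ (G j)⟦(1 : ℤ)⟧))
    (hgen : ∀ Z : T, (∀ i (f : G i ⟶ Z), f = 0) → IsZero Z)
    (hs : ∀ i k (g : G i ⟶ X k), g ≫ s k = 0) : IsIso (telescope s) := by
  have key (i : ι) (f : G i ⟶ ∐ X) : f ≫ telescope s = f :=
    comp_telescope_eq_self (hG i f) (hs i)
  obtain ⟨Z, π, h, hT⟩ := distinguished_cocone_triangle (telescope s)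
  refine (Triangle.isZero₃_iff_isIso₁ _ hT).1 (hgen Z fun i f => ?_)
  obtain ⟨j, ⟨e⟩⟩ := hshift i
  have hfh : f ≫ h = 0 := by
    obtain ⟨g, hg⟩ := (CategoryTheory.shiftFunctor T (1 : ℤ)).map_surjective (e.inv ≫ f ≫ h)
    have h₁ : h ≫ (telescope s)⟦(1 : ℤ)⟧' = 0 := comp_distTriang_mor_zero₃₁ _ hT
    have h₂ : (e.inv ≫ f ≫ h) ≫ (telescope s)⟦(1 : ℤ)⟧' = e.inv ≫ f ≫ h := by
      rw [← hg, ← Functor.map_comp, key]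
    rw [Category.assoc, Category.assoc, h₁, comp_zero, comp_zero] at h₂
    exact (Preadditive.IsIso.comp_left_eq_zero _ _).1 h₂.symm
  obtain ⟨g, rfl⟩ : ∃ g : G i ⟶ ∐ X, f = g ≫ π := Triangle.coyoneda_exact₃ _ hT f hfh
  have htπ : telescope s ≫ π = 0 := comp_distTriang_mor_zero₁₂ _ hT
  rw [← key i g, Category.assoc, htπ, comp_zero]

/-- The composition of the first morphisms of a sequence. -/
def seqComp {C : Type*} [Category* C] {X : ℕ → C} (s : ∀ k, X k ⟶ X (k + 1)) : ∀ k, X 0 ⟶ X k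
  | 0 => 𝟙 _
  | k + 1 => seqComp s k ≫ s k

omit [HasZeroObject T] [HasShift T ℤ] [∀ n : ℤ, (shiftFunctor T n).Additive] [Pretriangulated T] in
-- The preimage of `ι 0` under `1 - s` has the composites of `s` as components, and finite support
-- forces one of them to vanish.
lemma exists_seqComp_eq_zero [IsIso (telescope s)]
    (h : ∀ f : X 0 ⟶ ∐ X, IsFinitelySupported f) : ∃ m, seqComp s m = 0 := by
  classical
  obtain ⟨J, hJ⟩ := h (Sigma.ι X 0 ≫ inv (telescope s))
  set u := Sigma.ι X 0 ≫ inv (telescope s) with hu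
  have hut : u ≫ telescope s = Sigma.ι X 0 := by simp [hu]
  have hcomp (k : ℕ) : u ≫ Sigma.π X k = seqComp s k := by
    induction k with
    | zero =>
      have := hut =≫ Sigma.π X 0
      rwa [Category.assoc, telescope_π_zero, Sigma.ι_π_eq_id] at this
    | succ k ih =>
      have := hut =≫ Sigma.π X (k + 1)
      rw [Category.assoc, telescope_π_succ, Preadditive.comp_sub, ← Category.assoc u (Sigma.π X k),
        ih, Sigma.ι_π_of_ne X (Nat.succ_ne_zero k).symm, sub_eq_zero] at this
      exact this
  obtain ⟨m, hm⟩ := Infinite.exists_notMem_finset J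
  refine ⟨m, (hcomp m).symm.trans ?_⟩
  convert IsFinitelySupported.comp_ι_π_of_notMem hJ hm

end

variable [IsTriangulated T] (P : ObjectProperty T) [P.IsTriangulated]
  [P.IsClosedUnderIsomorphisms] [HasCoproducts.{w} T]

omit [IsTriangulated T] [P.IsClosedUnderIsomorphisms] in
lemma isCompactObj_of_trW (hP : ∀ Z, P Z → IsCompactObj.{w} Z) {C X : T} {σ : C ⟶ X}
    (hσ : P.trW σ) (hX : IsCompactObj.{w} X) : IsCompactObj.{w} C := by
  rw [ObjectProperty.trW_iff'] at hσ
  obtain ⟨Y, g, h, hT, hY⟩ := hσ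
  exact isCompactObj_obj₂ hT (hP _ hY) hX

/-- A compact object is a retract of an object of any triangulated subcategory consisting of
compact objects and containing a set of generators. -/
theorem exists_retract_of_isCompactObj {ι : Type w} (G : ι → T) [∀ i X, Small.{w} (G i ⟶ X)]
    (hP : ∀ Z, P Z → IsCompactObj.{w} Z) (hG : ∀ i, P (G i))
    (hshift : ∀ i, ∃ j, Nonempty (G i ≅ (G j)⟦(1 : ℤ)⟧))
    (hgen : ∀ Z : T, (∀ i (f : G i ⟶ Z), f = 0) → IsZero Z)
    {X : T} (hX : IsCompactObj.{w} X) : ∃ Z, P Z ∧ Nonempty (Retract X Z) := by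
  have : HasCoproductsOfShape ℕ T := hasColimitsOfShape_of_equivalence
    (Discrete.equivalence (Equiv.ulift.{w} (α := ℕ)))
  choose E j κ a p h hT hj using exists_cone_of_all_maps.{w} G
  let Y (k : ℕ) : T := Nat.rec (motive := fun _ => T) X (fun _ => E) k
  let s (k : ℕ) : Y k ⟶ Y (k + 1) := j (Y k)
  have : IsIso (telescope s) := isIso_telescope_of_generators
    (fun i f => (hP _ (hG i)).isFinitelySupported_nat f) hshift hgen fun i k g => hj (Y k) i g
  obtain ⟨m, hm⟩ := exists_seqComp_eq_zero (s := s) fun f => IsCompactObj.isFinitelySupported_nat hX f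
  have key (k : ℕ) (hk : ∃ (C : T) (σ : C ⟶ Y 0), P.trW σ ∧ σ ≫ seqComp s k = 0) :
      ∃ (C : T) (σ : C ⟶ Y 0), P.trW σ ∧ σ = 0 := by
    induction k with
    | zero =>
      obtain ⟨C, σ, hσ, h0⟩ := hk
      exact ⟨C, σ, hσ, (Category.comp_id σ).symm.trans h0⟩
    | succ k ih =>
      refine ih ?_
      obtain ⟨C, σ, hσ, h0⟩ := hk
      -- Being killed by the next map, the composite factors through a coproduct of generators, and
      -- by compactness of `C` through some `B` in `P`. Passing to the fibre of `C ⟶ B` lowers `k`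
      -- by one.
      obtain ⟨φ, hφ⟩ : ∃ φ, σ ≫ seqComp s k = φ ≫ p (Y k) :=
        Triangle.coyoneda_exact₂ _ (hT (Y k)) (σ ≫ seqComp s k) ((Category.assoc _ _ _).trans h0)
      obtain ⟨B, g, b, hB, hg⟩ := ((isCompactObj_of_trW P hP hσ (X := Y 0) hX).isFinitelySupported φ).exists_fac
        P (fun i => hG _)
      obtain ⟨C', τ, h', hT'⟩ := distinguished_cocone_triangle₁ g
      refine ⟨C', τ ≫ σ, P.trW.comp_mem _ _ (ObjectProperty.trW.mk P hT' hB) hσ, ?_⟩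
      have : τ ≫ g = 0 := comp_distTriang_mor_zero₁₂ _ hT'
      rw [Category.assoc, hφ, ← hg, Category.assoc, ← Category.assoc, this, zero_comp]
  -- A zero morphism into `X` with cone `Z` makes `X ⟶ Z` a split mono.
  obtain ⟨C, σ, ⟨Z, f, g, hT, hZ⟩, rfl⟩ := key m ⟨Y 0, 𝟙 _, MorphismProperty.id_mem _ _, by rw [hm, comp_zero]⟩
  obtain ⟨r, hr⟩ : ∃ r : Z ⟶ X, 𝟙 X = f ≫ r := Triangle.yoneda_exact₂ _ hT (𝟙 X) zero_comp
  exact ⟨Z, hZ, ⟨⟨f, r, hr.symm⟩⟩⟩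

end CompactRetract

/-! ### Compact objects of the coderived category -/

section CoderivedCompact

variable {A : Type u} [Ring A] [IsLeftCoherentRing A]

omit [IsLeftCoherentRing A] in
lemma IsBoundedFP.boundedFP_Q_obj {K : CochainComplex (ModuleCat.{u} A) ℤ} (hK : IsBoundedFP K) :
    boundedFP A ((CoderivedCategory.Q A).obj K) := (boundedFP_iff _).2 ⟨K, hK, ⟨Iso.refl _⟩⟩

instance : (boundedFP A).IsClosedUnderIsomorphisms where
  of_iso e := by
    rw [boundedFP_iff, boundedFP_iff]
    rintro ⟨K, hK, ⟨e'⟩⟩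
    exact ⟨K, hK, ⟨e' ≪≫ e⟩⟩

instance : (boundedFP A).ContainsZero where
  exists_zero := ⟨(CoderivedCategory.Q A).obj 0, Functor.map_isZero _ (isZero_zero _),
    IsBoundedFP.boundedFP_Q_obj ⟨⟨0, 0, inferInstance, inferInstance⟩, fun n => isFPModule_of_isZero
      (Functor.map_isZero (HomologicalComplex.eval _ _ n) (isZero_zero _))⟩⟩

instance : (boundedFP A).IsStableUnderShift ℤ where
  isStableUnderShiftBy n :=
    { le_shift X hX := by
        obtain ⟨K, hK, ⟨e⟩⟩ := (boundedFP_iff _).1 hX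
        exact (boundedFP_iff _).2 ⟨K⟦n⟧, hK.shift n, ⟨((CoderivedCategory.Q A).commShiftIso n).app K ≪≫
          (CategoryTheory.shiftFunctor _ n).mapIso e⟩⟩ }

lemma IsBoundedFP.exists_leftFactor {K : CochainComplex (ModuleCat.{u} A) ℤ} (hK : IsBoundedFP K)
    {L : CochainComplex (ModuleCat.{u} A) ℤ}
    (φ : (CoderivedCategory.Q A).obj K ⟶ (CoderivedCategory.Q A).obj L) :
    ∃ (K' : CochainComplex (ModuleCat.{u} A) ℤ) (e : (CoderivedCategory.Q A).obj K' ≅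
      (CoderivedCategory.Q A).obj K) (f : K' ⟶ L), IsBoundedFP K' ∧
      (CoderivedCategory.Q A).map f = e.hom ≫ φ := by
  obtain ⟨F', s, f, hF', hs, h⟩ := exists_rightFraction_of_bfp (bfp_quotient_obj hK) φ
  have := isIso_Q_map_of_trW_inf hs
  obtain ⟨K', rfl⟩ := F'.quotient_obj_surjective
  obtain ⟨f, rfl⟩ := (HomotopyCategory.quotient _ _).map_surjective f
  exact ⟨K', asIso ((coacyclic A).trW.Q.map s), f, hF', h.symm⟩

instance : (boundedFP A).IsTriangulatedClosed₃ := .mk' fun T hT h₁ h₂ => by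
  obtain ⟨K, hK, ⟨e⟩⟩ := (boundedFP_iff _).1 h₁
  obtain ⟨L, hL, ⟨e'⟩⟩ := (boundedFP_iff _).1 h₂
  obtain ⟨K', s, f, hK', hf⟩ := hK.exists_leftFactor (e.hom ≫ T.mor₁ ≫ e'.inv)
  obtain ⟨h, hT'⟩ := exists_distinguished_of_mappingCone f
  refine (boundedFP_iff _).2 ⟨CochainComplex.mappingCone f, hK'.mappingCone hL f,
    ⟨Triangle.π₃.mapIso (isoTriangleOfIso₁₂ _ T hT' hT (s ≪≫ e) e' ?_)⟩⟩
  change (CoderivedCategory.Q A).map f ≫ e'.hom = (s.hom ≫ e.hom) ≫ T.mor₁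
  rw [hf]
  simp

instance : (boundedFP A).IsTriangulated where
  toIsTriangulatedClosed₂ := .of_isTriangulatedClosed₃

omit [IsLeftCoherentRing A] in
-- Morphisms into a complex of injectives are represented by chain maps, which form a small set.
lemma small_hom_of_fpInjectivesHaveFiniteInjectiveDimension
    (H : FPInjectivesHaveFiniteInjectiveDimension A) (i : StalkIndex A) (X : CoderivedCategory A) :
    Small.{u} (stalk A i ⟶ X) := by
  obtain ⟨I, hI, ⟨e⟩⟩ := injectivelyResolved_of_fpInjectivesHaveFiniteInjectiveDimension H X
  refine small_of_surjective (α := (HomologicalComplex.single _ _ i.1).obj i.module ⟶ I)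
    (f := fun f => (CoderivedCategory.Q A).map f ≫ e.hom) fun φ => ?_
  obtain ⟨f, hf⟩ := hI.Q_map_surjective (φ ≫ e.inv)
  exact ⟨f, (hf =≫ e.hom).trans ((Category.assoc _ _ _).trans
    ((φ ≫= e.inv_hom_id).trans (Category.comp_id φ)))⟩

omit [IsLeftCoherentRing A] in
lemma exists_stalk_iso_shift (i : StalkIndex A) :
    ∃ j, Nonempty (stalk A i ≅ (stalk A j)⟦(1 : ℤ)⟧) :=
  ⟨⟨i.1 + 1, i.2⟩, nonempty_Q_single_iso_shift i.module i.1 1⟩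

lemma exists_retract_boundedFP (H : FPInjectivesHaveFiniteInjectiveDimension A)
    {X : CoderivedCategory A} (hX : IsCompactObj.{u} X) :
    ∃ Z, boundedFP A Z ∧ Nonempty (Retract X Z) := by
  have := small_hom_of_fpInjectivesHaveFiniteInjectiveDimension H
  exact exists_retract_of_isCompactObj (boundedFP A) (stalk A)
    (fun _ => isCompactObj_of_boundedFP) boundedFP_stalk exists_stalk_iso_shift
    (isZero_of_forall_stalk H) hX

end CoderivedCompact

/-! ### Direct summands of objects of a triangulated subcategory -/

section TriangulatedSummands

variable {T : Type*} [Category* T] [Preadditive T] [HasZeroObject T] [HasShift T ℤ]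
  [∀ n : ℤ, (shiftFunctor T n).Additive] [Pretriangulated T] (P : ObjectProperty T)
  [P.IsClosedUnderIsomorphisms]

lemma prop_biprod_symm {X Y : T} (h : P (X ⊞ Y)) : P (Y ⊞ X) :=
  P.prop_of_iso (biprod.braiding X Y) h

lemma prop_of_biprod_of_isZero {X Y : T} (h : P (X ⊞ Y)) (hY : IsZero Y) : P X :=
  P.prop_of_iso (isoBiprodZero hY).symm h

lemma prop_biprod_of_isZero {X Y : T} (h : P X) (hY : IsZero Y) : P (X ⊞ Y) :=
  P.prop_of_iso (isoBiprodZero hY) h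

lemma prop_biprod_map_iso {X Y X' Y' : T} (e : X ≅ X') (e' : Y ≅ Y') (h : P (X ⊞ Y)) :
    P (X' ⊞ Y') := P.prop_of_iso (biprod.mapIso e e') h

variable [P.IsTriangulated]

lemma prop_biprod_obj₃ {D D' : Triangle T} (hD : D ∈ distTriang T) (hD' : D' ∈ distTriang T)
    (h₁ : P (D.obj₁ ⊞ D'.obj₁)) (h₂ : P (D.obj₂ ⊞ D'.obj₂)) : P (D.obj₃ ⊞ D'.obj₃) := by
  let F (j : WalkingPair) : Triangle T := WalkingPair.casesOn j D D'
  have hF := productTriangle_distinguished F (by rintro (_ | _) <;> assumption)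
  let e (G : WalkingPair → T) : G .left ⊞ G .right ≅ ∏ᶜ G :=
    { hom := Pi.lift fun j => WalkingPair.casesOn j biprod.fst biprod.snd
      inv := biprod.lift (Pi.π G .left) (Pi.π G .right)
      hom_inv_id := by apply biprod.hom_ext <;> simp
      inv_hom_id := by
        apply Pi.hom_ext
        rintro (_ | _) <;> simp }
  refine P.prop_of_iso (e fun j => (F j).obj₃).symm (P.ext_of_isTriangulatedClosed₃ _ hF ?_ ?_)
  · exact P.prop_of_iso (e fun j => (F j).obj₁) h₁
  · exact P.prop_of_iso (e fun j => (F j).obj₂) h₂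

lemma prop_biprod_shift {X Y : T} (h : P (X ⊞ Y)) (n : ℤ) : P (X⟦n⟧ ⊞ Y⟦n⟧) :=
  have := preservesBinaryBiproducts_of_preservesBiproducts (CategoryTheory.shiftFunctor T n)
  P.prop_of_iso ((CategoryTheory.shiftFunctor T n).mapBiprod X Y) (P.le_shift n _ h)

lemma prop_obj₃_of_biprod {D : Triangle T} (hD : D ∈ distTriang T) {U : T}
    (h₁ : P (D.obj₁ ⊞ U)) (h₂ : P (D.obj₂ ⊞ U)) : P D.obj₃ :=
  prop_of_biprod_of_isZero P
    (prop_biprod_obj₃ P hD (contractible_distinguished U) h₁ h₂) (isZero_zero _)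

/-- `V' ⊞ V` is the cone of the zero map from `V⟦-1⟧` to `V'`, and a common complement `U` of source
and target cancels. -/
lemma prop_biprod_of_biprod_shift_neg {U V V' : T} (h : P (V⟦(-1 : ℤ)⟧ ⊞ U)) (h' : P (V' ⊞ U)) :
    P (V' ⊞ V) :=
  prop_obj₃_of_biprod P (inv_rot_of_distTriang _ (binaryBiproductTriangle_distinguished V' V)) h h'

/-- The complement `Y` cancels to give `X ⊞ X⟦1⟧`. Its shift by `2k + 1` then trades the complement
`X⟦2k+1⟧` of `X` for `X⟦2k+3⟧`. -/
lemma prop_biprod_shift_odd {X Y : T} (h : P (X ⊞ Y)) (k : ℕ) :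
    P (X ⊞ X⟦(2 * k + 1 : ℤ)⟧) := by
  have h₁ : P (X ⊞ X⟦(1 : ℤ)⟧) := prop_biprod_of_biprod_shift_neg P
    (prop_biprod_map_iso P (shiftShiftNeg X (1 : ℤ)).symm (Iso.refl _) h) h
  induction k with
  | zero => simpa using h₁
  | succ k ih =>
    refine prop_biprod_of_biprod_shift_neg P (U := X⟦(2 * k + 1 : ℤ)⟧) ?_ ih
    refine prop_biprod_symm P (prop_biprod_map_iso P (Iso.refl _) ?_
      (prop_biprod_shift P h₁ (2 * k + 1 : ℤ)))
    exact ((shiftFunctorAdd' T (1 : ℤ) (2 * k + 1) (2 * k + 2) (by lia)).app X).symm ≪≫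
      (shiftFunctorAdd' T (2 * ((k + 1 : ℕ) : ℤ) + 1) (-1) (2 * k + 2) (by push_cast; lia)).app X

end TriangulatedSummands

/-! ### Homology of objects of the coderived category -/

section HomologyVanishing

variable {A : Type u} [Ring A]

lemma quotient_map_eq_zero_of_lift {C : Type*} [Category* C] [Abelian C]
    {K : CochainComplex C ℤ} {M : C} {p q : ℤ} (hpq : p + 1 = q)
    (φ : (HomologicalComplex.single _ (ComplexShape.up ℤ) q).obj M ⟶ K) (g : M ⟶ K.X p)
    (hg : g ≫ K.d p q = (HomologicalComplex.singleObjXSelf _ q M).inv ≫ φ.f q) :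
    (HomotopyCategory.quotient _ _).map φ = 0 := by
  rw [HomotopyCategory.quotient_map_eq_zero_iff]
  let h (i j : ℤ) (hij : (ComplexShape.up ℤ).Rel j i) :
      ((HomologicalComplex.single _ (ComplexShape.up ℤ) q).obj M).X i ⟶ K.X j :=
    if hi : i = q then (HomologicalComplex.singleObjXIsoOfEq _ _ M i hi).hom ≫ g ≫
      (K.XIsoOfEq (show p = j by change j + 1 = i at hij; lia)).hom else 0
  have hφ : φ = Homotopy.nullHomotopicMap' h := by
    refine HomologicalComplex.from_single_hom_ext ?_
    rw [Homotopy.nullHomotopicMap'_f (show (ComplexShape.up ℤ).Rel p q from hpq)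
      (show (ComplexShape.up ℤ).Rel q (q + 1) from rfl), HomologicalComplex.single_obj_d, zero_comp,
      zero_add]
    have hh : h q p hpq = (HomologicalComplex.singleObjXSelf _ q M).hom ≫ g := by
      simp only [h, dif_pos, HomologicalComplex.XIsoOfEq_rfl, Iso.refl_hom, Category.comp_id]
      rfl
    rw [hh, Category.assoc, hg, Iso.hom_inv_id_assoc]
  rw [hφ]
  exact ⟨Homotopy.nullHomotopy' h⟩

variable (A) in
/-- The ring, placed in degree `n`, as an object of the coderived category. -/
noncomputable def ringStalk (n : ℤ) : CoderivedCategory A :=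
  (CoderivedCategory.Q A).obj ((HomologicalComplex.single _ _ n).obj (ModuleCat.of A A))

/-- The free stalk is K-projective, so it is left orthogonal to acyclic and a fortiori to coacyclic
complexes. Morphisms from it therefore detect homology. -/
lemma Q_map_bijective_of_single (n : ℤ) (Y : HotMod A) : Function.Bijective
    ((coacyclic A).trW.Q.map : ((HomotopyCategory.quotient _ _).obj
      ((HomologicalComplex.single _ (ComplexShape.up ℤ) n).obj (ModuleCat.of A A)) ⟶ Y) → _) := by
  let K := (HomologicalComplex.single _ (ComplexShape.up ℤ) n).obj (ModuleCat.of A A)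
  have : CochainComplex.IsStrictlyLE K n := by
    rw [CochainComplex.isStrictlyLE_iff]
    exact fun i hi => HomologicalComplex.isZero_single_obj_X _ _ _ _ (by lia)
  have (i : ℤ) : Projective (K.X i) := by
    by_cases hi : i = n
    · have : Projective (ModuleCat.of A A) :=
        (IsProjective.iff_projective (R := A) A).1 inferInstance
      exact Projective.of_iso (HomologicalComplex.singleObjXIsoOfEq _ _ _ _ hi).symm this
    · exact (HomologicalComplex.isZero_single_obj_X _ _ _ _ hi).projective
  have : CochainComplex.IsKProjective K := CochainComplex.isKProjective_of_projective K n
  have h : (coacyclic A).leftOrthogonal ((HomotopyCategory.quotient _ _).obj K) :=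
    fun _ f hY => CochainComplex.IsKProjective.leftOrthogonal K f
      (coacyclic_le_subcategoryAcyclic A _ hY)
  exact h.map_bijective_of_isTriangulated (coacyclic A).trW.Q Y

/-- The vanishing of the homology in degree `n` of an object of the coderived category. -/
def HomologyVanishes (X : CoderivedCategory A) (n : ℤ) : Prop := ∀ f : ringStalk A n ⟶ X, f = 0

lemma homologyVanishes_Q_obj_iff (K : CochainComplex (ModuleCat.{u} A) ℤ) (n : ℤ) :
    HomologyVanishes ((CoderivedCategory.Q A).obj K) n ↔ K.ExactAt n := by
  rw [K.exactAt_iff' (n - 1) n (n + 1) (by simp) (by simp), ShortComplex.moduleCat_exact_iff]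
  let S := (HomologicalComplex.single _ (ComplexShape.up ℤ) n).obj (ModuleCat.of A A)
  let e : S.X n ≅ ModuleCat.of A A := HomologicalComplex.singleObjXSelf _ n _
  constructor
  · intro h (x : K.X n) (hx : K.d n (n + 1) x = 0)
    let f : ModuleCat.of A A ⟶ K.X n := ModuleCat.ofHom (LinearMap.toSpanSingleton A _ x)
    let φ : S ⟶ K := HomologicalComplex.mkHomFromSingle f (by
      rintro _ rfl
      ext
      change K.d n (n + 1) ((1 : A) • x) = 0
      rw [one_smul, hx])
    obtain ⟨g, hg⟩ := exists_lift_of_quotient_map_eq_zero (sub_add_cancel n 1) φ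
      ((Q_map_bijective_of_single n _).1 ((h ((CoderivedCategory.Q A).map φ)).trans
        (Functor.map_zero _ _ _).symm))
    rw [HomologicalComplex.mkHomFromSingle_f, Iso.inv_hom_id_assoc] at hg
    refine ⟨g.hom 1, ?_⟩
    have : K.d (n - 1) n (g.hom 1) = (1 : A) • x := congr(($hg).hom 1)
    exact this.trans (one_smul _ _)
  · intro h f
    obtain ⟨ψ, hψ⟩ := (Q_map_bijective_of_single n _).2 f
    obtain ⟨φ, rfl⟩ := (HomotopyCategory.quotient _ _).map_surjective ψ
    obtain ⟨y : K.X (n - 1), hy : K.d (n - 1) n y = φ.f n (e.inv (1 : A))⟩ :=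
      h (φ.f n (e.inv (1 : A))) (by
        have : φ.f n ≫ K.d n (n + 1) = 0 := by
          rw [φ.comm, HomologicalComplex.single_obj_d, zero_comp]
        exact congr(($this).hom (e.inv (1 : A))))
    have hφ := quotient_map_eq_zero_of_lift (sub_add_cancel n 1) φ
      (ModuleCat.ofHom (LinearMap.toSpanSingleton A _ y)) (by
        ext
        change K.d (n - 1) n ((1 : A) • y) = φ.f n (e.inv (1 : A))
        rw [one_smul, hy])
    exact hψ.symm.trans ((congr_arg _ hφ).trans (Functor.map_zero _ _ _))

end HomologyVanishing

/-! ### Closure under retracts by truncation -/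

section RetractsOfBoundedFP

variable {A : Type u} [Ring A]

namespace HomologyVanishes

lemma of_retract {X Y : CoderivedCategory A} {n : ℤ} (hY : HomologyVanishes Y n)
    (r : Retract X Y) : HomologyVanishes X n := fun f => by
  rw [← Category.comp_id f, ← r.retract, ← Category.assoc, hY (f ≫ r.i), zero_comp]

lemma obj₂ {T : Triangle (CoderivedCategory A)} (hT : T ∈ distTriang (CoderivedCategory A))
    {n : ℤ} (h₁ : HomologyVanishes T.obj₁ n) (h₃ : HomologyVanishes T.obj₃ n) :
    HomologyVanishes T.obj₂ n := fun f => by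
  obtain ⟨g, rfl⟩ := Triangle.coyoneda_exact₂ T hT f (h₃ _)
  rw [h₁ g, zero_comp]

lemma shift {X : CoderivedCategory A} {n m : ℤ} (h : HomologyVanishes X (n + m)) :
    HomologyVanishes (X⟦m⟧) n := fun f => by
  obtain ⟨e⟩ : Nonempty (ringStalk A n ≅ (ringStalk A (n + m))⟦m⟧) :=
    nonempty_Q_single_iso_shift _ n m
  obtain ⟨g, hg⟩ := (CategoryTheory.shiftFunctor (CoderivedCategory A) m).map_surjective (e.inv ≫ f)
  rw [h g, Functor.map_zero] at hg
  exact (Preadditive.IsIso.comp_left_eq_zero _ _).1 hg.symm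

end HomologyVanishes

lemma IsBoundedFP.exists_homologyVanishes {K : CochainComplex (ModuleCat.{u} A) ℤ}
    (hK : IsBoundedFP K) : ∃ a b : ℤ,
      (∀ n < a, HomologyVanishes ((CoderivedCategory.Q A).obj K) n) ∧
        ∀ n > b, HomologyVanishes ((CoderivedCategory.Q A).obj K) n := by
  obtain ⟨⟨a, b, _, _⟩, _⟩ := hK
  refine ⟨a, b, fun n hn => ?_, fun n hn => ?_⟩
  · rw [homologyVanishes_Q_obj_iff]
    exact ShortComplex.exact_of_isZero_X₂ _ (K.isZero_of_isStrictlyGE a n hn)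
  · rw [homologyVanishes_Q_obj_iff]
    exact ShortComplex.exact_of_isZero_X₂ _ (K.isZero_of_isStrictlyLE b n hn)

lemma isZero_of_homologyVanishes {X : CoderivedCategory A} (hX : boundedFP A X)
    (h : ∀ n, HomologyVanishes X n) : IsZero X := by
  obtain ⟨K, hK, ⟨e⟩⟩ := (boundedFP_iff _).1 hX
  refine IsZero.of_iso ?_ e.symm
  obtain ⟨⟨a, b, _, _⟩, _⟩ := hK
  exact isZero_trW_Q_obj (coacyclic_of_acyclic_of_bounded K a b fun n =>
    (homologyVanishes_Q_obj_iff K n).1 ((h n).of_retract ⟨e.hom, e.inv, e.hom_inv_id⟩))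

variable [IsLeftCoherentRing A]

/-- `X` itself is not known to be bounded and finitely presented, but the cone of `0 : X ⟶ X` is,
because the complement cancels. That cone has no homology, so it is zero and `0` is an isomorphism.
-/
lemma isZero_of_biprod_of_homologyVanishes {X Y : CoderivedCategory A}
    (hXY : boundedFP A (X ⊞ Y)) (h : ∀ n, HomologyVanishes X n) : IsZero X := by
  obtain ⟨C, f, g, hT⟩ := distinguished_cocone_triangle (0 : X ⟶ X)
  have hC : IsZero C := isZero_of_homologyVanishes (prop_obj₃_of_biprod (boundedFP A) hT hXY hXY)
    fun n => HomologyVanishes.obj₂ (rot_of_distTriang _ hT) (h n) (h (n + 1)).shift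
  have : IsIso (0 : X ⟶ X) := (Triangle.isZero₃_iff_isIso₁ _ hT).1 hC
  rw [IsZero.iff_id_eq_zero, ← IsIso.hom_inv_id (0 : X ⟶ X), zero_comp]

lemma IsBoundedFP.truncLE {K : CochainComplex (ModuleCat.{u} A) ℤ} (hK : IsBoundedFP K) (c : ℤ) :
    IsBoundedFP (K.truncLE c) := by
  obtain ⟨⟨a, b, _, _⟩, h⟩ := hK
  refine ⟨⟨a, c, inferInstance, inferInstance⟩, fun i => ?_⟩
  rcases lt_trichotomy i c with hi | rfl | hi
  · exact (isFPModule A).prop_of_iso (K.truncLEXIso c i hi).symm (h i)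
  · exact (isFPModule A).prop_of_iso (K.truncLEXIsoCycles i).symm
      ((isFPModule A).prop_of_isLimit_kernelFork (K.cyclesIsKernel i (i + 1) (by simp)) (h _) (h _))
  · exact isFPModule_of_isZero ((K.truncLE c).isZero_of_isStrictlyLE c i hi)

/-- `X` carries the homology of the sum below degree `c` and `Y` that above, so the truncation in
degrees `≤ c` should be `X`. The cone `W` of the projection of the truncation to `X` has no
homology, and `W ⊞ Y` is bounded and finitely presented, so `W` vanishes. -/
lemma boundedFP_of_biprod_of_homologyVanishes {X Y : CoderivedCategory A}
    (hXY : boundedFP A (X ⊞ Y)) (c : ℤ) (hX : ∀ n ≥ c, HomologyVanishes X n)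
    (hY : ∀ n ≤ c, HomologyVanishes Y n) : boundedFP A X := by
  let Q := CoderivedCategory.Q A
  obtain ⟨K, hK, ⟨e'⟩⟩ := (boundedFP_iff _).1 hXY
  let S := HomologicalComplex.shortComplexTruncLE K (ComplexShape.embeddingUpIntLE c)
  let e : Q.obj S.X₂ ≅ X ⊞ Y := e'
  have hS : S.ShortExact := HomologicalComplex.shortComplexTruncLE_shortExact K _
  have hS₁ : IsBoundedFP S.X₁ := hK.truncLE c
  have h₁ (n : ℤ) (hn : c < n) : HomologyVanishes (Q.obj S.X₁) n := by
    rw [homologyVanishes_Q_obj_iff]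
    exact ShortComplex.exact_of_isZero_X₂ _ ((K.truncLE c).isZero_of_isStrictlyLE c n hn)
  have h₃ (n : ℤ) (hn : n ≤ c) : HomologyVanishes (Q.obj S.X₃) n := by
    rw [homologyVanishes_Q_obj_iff]
    obtain ⟨m, rfl⟩ : ∃ m : ℕ, n = c - m := ⟨(c - n).toNat, by lia⟩
    exact (HomologicalComplex.shortComplexTruncLE_X₃_isSupportedOutside K
      (ComplexShape.embeddingUpIntLE c)).exactAt m
  obtain ⟨δ, hT⟩ := exists_distinguished_of_shortExact S hS
  let ι : Q.obj S.X₁ ⟶ X ⊞ Y := Q.map S.f ≫ e.hom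
  obtain ⟨W, v, w, hT'⟩ := distinguished_cocone_triangle (ι ≫ biprod.fst)
  have hW : IsZero W := by
    refine isZero_of_biprod_of_homologyVanishes (Y := Y) ?_ ?_
    · exact prop_biprod_obj₃ (boundedFP A) hT' (contractible_distinguished₁ Y)
        (prop_biprod_of_isZero _ hS₁.boundedFP_Q_obj (isZero_zero _)) hXY
    · intro n f
      have hfw : f ≫ w = 0 := by
        rcases lt_or_ge c (n + 1) with hn | hn
        · exact (h₁ (n + 1) hn).shift _
        · let t := (f ≫ w) ≫ ι⟦(1 : ℤ)⟧'
          have ht₁ : t ≫ (biprod.fst : X ⊞ Y ⟶ X)⟦(1 : ℤ)⟧' = 0 := by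
            have : w ≫ (ι ≫ biprod.fst)⟦(1 : ℤ)⟧' = 0 := comp_distTriang_mor_zero₃₁ _ hT'
            simp only [t, Category.assoc]
            rw [← Functor.map_comp, this, comp_zero]
          have ht₂ : t ≫ (biprod.snd : X ⊞ Y ⟶ Y)⟦(1 : ℤ)⟧' = 0 := (hY (n + 1) hn).shift _
          have ht : t = 0 := by
            rw [← Category.comp_id t, ← CategoryTheory.Functor.map_id, ← biprod.total,
              Functor.map_add, Functor.map_comp, Functor.map_comp, Preadditive.comp_add,
              ← Category.assoc, ← Category.assoc, ht₁, ht₂, zero_comp, zero_comp, add_zero]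
          obtain ⟨k, hk⟩ : ∃ k, f ≫ w = k ≫ δ := Triangle.coyoneda_exact₁ _ hT (f ≫ w) (by
            simp only [t, ι, Functor.map_comp] at ht
            rwa [← Category.assoc (f ≫ w), Preadditive.IsIso.comp_right_eq_zero] at ht)
          rw [hk, h₃ n (by lia) k, zero_comp]
      obtain ⟨g, rfl⟩ : ∃ g, f = g ≫ v := Triangle.coyoneda_exact₃ _ hT' f hfw
      rcases lt_or_ge n c with hn | hn
      · obtain ⟨k, hk⟩ : ∃ k, g ≫ biprod.inl ≫ e.inv = k ≫ Q.map S.f :=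
          Triangle.coyoneda_exact₂ _ hT (g ≫ biprod.inl ≫ e.inv) (h₃ n hn.le _)
        have hg : g = k ≫ ι ≫ biprod.fst := by
          have := hk =≫ e.hom ≫ biprod.fst
          simp only [Category.assoc, Iso.inv_hom_id_assoc, biprod.inl_fst, Category.comp_id] at this
          simpa only [ι, Category.assoc] using this
        have huv : (ι ≫ biprod.fst) ≫ v = 0 := comp_distTriang_mor_zero₁₂ _ hT'
        rw [hg, Category.assoc, huv, comp_zero]
      · rw [hX n hn g, zero_comp]
  have : IsIso (ι ≫ biprod.fst) := (Triangle.isZero₃_iff_isIso₁ _ hT').1 hW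
  exact (boundedFP A).prop_of_iso (asIso (ι ≫ biprod.fst)) hS₁.boundedFP_Q_obj

/-- The bounded complexes of finitely presented modules are closed under retracts in the coderived
category. -/
theorem boundedFP_of_biprod {X Y : CoderivedCategory A} (hXY : boundedFP A (X ⊞ Y)) :
    boundedFP A X := by
  obtain ⟨K, hK, ⟨e⟩⟩ := (boundedFP_iff _).1 hXY
  obtain ⟨a, b, ha, hb⟩ := hK.exists_homologyVanishes
  let r : Retract X ((CoderivedCategory.Q A).obj K) :=
    { i := biprod.inl ≫ e.inv, r := e.hom ≫ biprod.fst }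
  -- The homology of `X` lies in degrees `a` to `b`. This `k` ensures `b - (2k + 1) < a - 1`, so the
  -- shifted copy lives strictly below degree `a - 1` and `X` strictly above it.
  let k := (b - a + 2).toNat
  have h := prop_biprod_symm _ (prop_biprod_shift_odd (boundedFP A) hXY k)
  have h' := boundedFP_of_biprod_of_homologyVanishes h (a - 1)
    (fun n hn => ((hb (n + (2 * k + 1)) (by lia)).of_retract r).shift)
    (fun n hn => (ha n (by lia)).of_retract r)
  exact (boundedFP A).prop_of_iso (shiftShiftNeg X (2 * k + 1 : ℤ))
    ((boundedFP A).le_shift (-(2 * k + 1 : ℤ)) _ h')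

lemma boundedFP_of_retract {X Z : CoderivedCategory A} (hZ : boundedFP A Z) (r : Retract X Z) :
    boundedFP A X := by
  obtain ⟨Y, g, h, hT⟩ := distinguished_cocone_triangle r.i
  have hmono : Mono r.i := mono_of_mono_fac r.retract
  obtain ⟨e, -⟩ := exists_iso_binaryBiproduct_of_distTriang _ hT
    ((Triangle.mor₃_eq_zero_iff_mono₁ _ hT).2 hmono)
  exact boundedFP_of_biprod ((boundedFP A).prop_of_iso e hZ)

end RetractsOfBoundedFP

theorem mainTheorem3 (A : Type u) [Ring A] [IsLeftCoherentRing A] :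
    -- (a) the bounded complexes of finitely presented modules form a full subcategory of the
    -- coderived category equivalent to `D^b(A-mod_fp)`, and all of its objects are compact
    (HasCoproducts.{u} (CoderivedCategory A) ∧
      (∃ F : DerivedCategory.Bounded (FPModuleCat A) ⥤ CoderivedCategory A,
        Nonempty (BoundedFPComplex.toDerived A ⋙ F ≅ BoundedFPComplex.toCoderived A) ∧
          F.Full ∧ F.Faithful ∧ F.essImage = boundedFP A) ∧
      (∀ X : CoderivedCategory A, boundedFP A X → IsCompactObj.{u} X)) ∧
    -- (b) compact generation, and the description of all compact objects
    (FPInjectivesHaveFiniteInjectiveDimension A →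
      IsCompactlyGeneratedTriangulated.{u} (CoderivedCategory A) ∧
        ∀ X : CoderivedCategory A, IsCompactObj.{u} X ↔ boundedFP A X) ∧
    -- the hypothesis of (b) holds when all left ideals are countably generated
    ((∀ I : Ideal A, ∃ s : Set A, s.Countable ∧ Ideal.span s = I) →
      FPInjectivesHaveFiniteInjectiveDimension A) := by
  refine ⟨⟨inferInstance, exists_fullyFaithful_boundedDerived A,
    fun X hX => isCompactObj_of_boundedFP hX⟩, fun H =>
      ⟨isCompactlyGeneratedTriangulated_coderivedCategory H, fun X =>
        ⟨fun hX => ?_, isCompactObj_of_boundedFP⟩⟩,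
    fpInjectivesHaveFiniteInjectiveDimension_of_countably_generated⟩
  obtain ⟨Z, hZ, ⟨r⟩⟩ := exists_retract_boundedFP H hX
  exact boundedFP_of_retract hZ r
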